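/- Let $f:\hat{\mathbb C}\to\hat{\mathbb C}$ be a rational function of degree at least $2$ with Fatou set $F$ and Julia set $J=\hat{\mathbb C}\setminus F$. Assume that either $f$ is a polynomial, or $f$ is not a polynomial and is normalized as follows: the point $\infty$ lies in a periodic component of $F$, and $a:=f(\infty)$ is a finite point which is not a critical value of $f$. (In both cases $J$ is a compact subset of $\mathbb C$.) Let $v_1,\dots,v_p$ be the pairwise distinct points $v\in\mathbb C$ of the form $v=f(c)$ with $c\in\mathbb C$, $f'(c)=0$. Let $|dx|^2$ denote planar Lebesgue measure (area), let $$f^*\nu=(\nu\circ f)\,\frac{|f'|^2}{(f')^2},$$ and let $\mathrm{Fix}(f^*)$ be the complex vector space of all $\nu\in L_\infty(J)$ with $f^*\nu=\nu$ almost everywhere. For $\nu\in L_\infty(J)$ put $$\hat\nu(z)=\int_J\frac{\nu(x)}{z-x}|dx|^2,\qquad \hat\nu'(z)=\int_J\frac{\nu(x)}{(z-x)^2}|dx|^2,\qquad \hat\nu''(z)=\int_J\frac{\nu(x)}{(z-x)^3}|dx|^2 .$$ An *invariant line field* on $J$ is $\mu\in\mathrm{Fix}(f^*)$ such that $|\mu|=1$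 on a subset of $J$ of positive area and $\mu=0$ elsewhere; its support is $\{\mu\ne0\}$ (up to a null set). A measurable set $E\subset J$ is *completely invariant* if $f^{-1}(E)=E$; a completely invariant set $E$ of positive area is *ergodic* if every completely invariant measurable $A\subset E$ satisfies $\mathrm{area}(A)=0$ or $\mathrm{area}(E\setminus A)=0$. An invariant line field $\mu$ is *ergodic* if its support is (up to a null set) a completely invariant ergodic set $E$ and every invariant line field with support contained in $E$ is of the form $t\mu$ with $|t|=1$. Then: 1. The integrals defining $\hat\nu(v_1),\dots,\hat\nu(v_p)$ converge absolutely for every $\nu\in\mathrm{Fix}(f^*)$, as do those defining $\hat\nu(a),\hat\nu'(a),\hat\nu''(a)$ if $f$ is not a polynomial, and the map $$\mathrm{Fix}(f^*)\to\mathbb C^{p+3},\qquad \nu\mapsto(\hat\nu(v_1),\dots,\hat\nu(v_p),\hat\nu(a),\hat\nu'(a),\hat\nu''(a)),$$ where the last three coordinates are set equal to $0$ if $f$ is a polynomial, is linear and injective. 2. $\mathrm{Fix}(f^*)$ is a finite (possibly empty) direct sum of one-dimensional spaces spanned by ergodic invariant line fields: there are $m\ge0$, pairwise disjoint completely invariant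 ergodic sets $E_1,\dots,E_m\subset J$, and ergodic invariant line fields $\mu_i$ with support $E_i$ (unique up to rotation), such that $\mathrm{Fix}(f^*)=\bigoplus_{i=1}^m\mathbb C\mu_i$, i.e. every $\nu\in\mathrm{Fix}(f^*)$ has a unique representation $\nu=\sum_{i=1}^m t_i\mu_i$ with $(t_1,\dots,t_m)\in\mathbb C^m$. -/

import Mathlib

open MeasureTheory Filter Topology Polynomial

noncomputable section

/-- A rational function of degree at least two with complex coefficients
(`num` and `denom` of a `RatFunc` are coprime). -/
structure RationalMap where
  toRatFunc : RatFunc ℂ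
  two_le_degree : 2 ≤ max toRatFunc.num.natDegree toRatFunc.denom.natDegree

namespace RationalMap

/-- `f` is a polynomial. -/
def IsPolynomial (f : RationalMap) : Prop :=
  ∃ p : ℂ[X], algebraMap ℂ[X] (RatFunc ℂ) p = f.toRatFunc

/-- `z` is a pole of `f` in the plane. -/
def IsPole (f : RationalMap) (z : ℂ) : Prop := f.toRatFunc.denom.eval z = 0

/-- The value of `f` at a point of the plane which is not a pole (and `0` at the poles). -/
def val (f : RationalMap) (z : ℂ) : ℂ := f.toRatFunc.num.eval z / f.toRatFunc.denom.eval z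

open Classical in
/-- The self-map of the Riemann sphere `OnePoint ℂ` defined by `f`. -/
def sphereMap (f : RationalMap) : OnePoint ℂ → OnePoint ℂ
  | some z => if f.IsPole z then OnePoint.infty else ((f.val z : ℂ) : OnePoint ℂ)
  | OnePoint.infty =>
      if f.toRatFunc.denom.natDegree < f.toRatFunc.num.natDegree then OnePoint.infty
      else ((f.toRatFunc.num.coeff f.toRatFunc.denom.natDegree /
        f.toRatFunc.denom.leadingCoeff : ℂ) : OnePoint ℂ)

/-- The Fatou set: the points having an open neighbourhood on which the iterates of `f` are
equicontinuous, the sphere being equipped with its unique compatible uniform structure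
(equivalently, with the spherical metric). -/
def fatouSet (f : RationalMap) : Set (OnePoint ℂ) :=
  letI : UniformSpace (OnePoint ℂ) := uniformSpaceOfCompactR1
  {x | ∃ U : Set (OnePoint ℂ), IsOpen U ∧ x ∈ U ∧
    EquicontinuousOn (fun n : ℕ => f.sphereMap^[n]) U}

/-- The Julia set, as a subset of the sphere. -/
def juliaSet (f : RationalMap) : Set (OnePoint ℂ) := f.fatouSetᶜ

/-- The part of the Julia set in the plane (all of it when `∞` is in the Fatou set). -/
def juliaPlane (f : RationalMap) : Set ℂ := {z | (z : OnePoint ℂ) ∈ f.juliaSet}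

/-- The standard coordinate of the sphere near `x`: the identity if `x` is in the plane, and
`z ↦ 1 / z` if `x = ∞`. -/
def chart : OnePoint ℂ → OnePoint ℂ → ℂ
  | some _, some z => z
  | some _, OnePoint.infty => 0
  | OnePoint.infty, some z => z⁻¹
  | OnePoint.infty, OnePoint.infty => 0

open Classical in
/-- The inverse of the coordinate `chart x`. -/
def chartInv : OnePoint ℂ → ℂ → OnePoint ℂ
  | some _, w => (w : OnePoint ℂ)
  | OnePoint.infty, w => if w = 0 then OnePoint.infty else ((w⁻¹ : ℂ) : OnePoint ℂ)

/-- `x` is a critical point of `f` on the sphere: the derivative vanishes in coordinates. -/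
def IsCriticalPoint (f : RationalMap) (x : OnePoint ℂ) : Prop :=
  deriv (fun w : ℂ => chart (f.sphereMap x) (f.sphereMap (chartInv x w))) (chart x x) = 0

/-- `y` is a critical value of `f` on the sphere. -/
def IsCriticalValue (f : RationalMap) (y : OnePoint ℂ) : Prop :=
  ∃ x, f.IsCriticalPoint x ∧ f.sphereMap x = y

/-- The finite critical values of `f` which are images of finite critical points. -/
def finiteCriticalValues (f : RationalMap) : Set ℂ :=
  {v | ∃ c : ℂ, ¬ f.IsPole c ∧ deriv f.val c = 0 ∧ f.val c = v}

/-- `U` is a periodic component of the Fatou set. -/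
def IsPeriodicFatouComponent (f : RationalMap) (U : Set (OnePoint ℂ)) : Prop :=
  (∃ x ∈ f.fatouSet, U = connectedComponentIn f.fatouSet x) ∧
    ∃ n : ℕ, 1 ≤ n ∧ f.sphereMap^[n] '' U = U

/-- The normalization at infinity: `∞` lies in a periodic component of the Fatou set,
and `a = f(∞)` is finite and is not a critical value. -/
def IsNormalizedAt (f : RationalMap) (a : ℂ) : Prop :=
  (∃ U, f.IsPeriodicFatouComponent U ∧ OnePoint.infty ∈ U) ∧
    f.sphereMap OnePoint.infty = (a : OnePoint ℂ) ∧ ¬ f.IsCriticalValue (a : OnePoint ℂ)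

lemma denom_ne_zero (f : RationalMap) : f.toRatFunc.denom ≠ 0 := f.toRatFunc.denom_ne_zero

lemma hasDerivAt_val (f : RationalMap) {z : ℂ} (hz : ¬ f.IsPole z) :
    HasDerivAt f.val ((f.toRatFunc.num.derivative.eval z * f.toRatFunc.denom.eval z -
      f.toRatFunc.num.eval z * f.toRatFunc.denom.derivative.eval z) /
        f.toRatFunc.denom.eval z ^ 2) z :=
  (f.toRatFunc.num.hasDerivAt z).div (f.toRatFunc.denom.hasDerivAt z) hz

lemma measurable_val (f : RationalMap) : Measurable f.val :=
  (Polynomial.continuous _).measurable.div (Polynomial.continuous _).measurable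

lemma wronskian_ne_zero (f : RationalMap) :
    f.toRatFunc.num.derivative * f.toRatFunc.denom -
      f.toRatFunc.num * f.toRatFunc.denom.derivative ≠ 0 := by
  intro h
  have hc := f.toRatFunc.isCoprime_num_denom
  have hd : f.toRatFunc.denom ∣ f.toRatFunc.denom.derivative :=
    hc.symm.dvd_of_dvd_mul_left ⟨f.toRatFunc.num.derivative, by rw [← sub_eq_zero.1 h, mul_comm]⟩
  have hd0 : f.toRatFunc.denom.derivative = 0 := by
    by_contra hne
    exact absurd (Polynomial.degree_le_of_dvd hd hne)
      (not_le.2 (Polynomial.degree_derivative_lt f.denom_ne_zero))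
  have hn0 : f.toRatFunc.num.derivative = 0 := by
    rw [hd0, mul_zero, sub_zero] at h
    exact (mul_eq_zero.1 h).resolve_right f.denom_ne_zero
  have h1 := Polynomial.derivative_eq_zero.1 hd0
  have h2 := Polynomial.derivative_eq_zero.1 hn0
  have h3 := f.two_le_degree
  omega

/-- Preimages of null sets under `f` are null sets. -/
lemma quasiMeasurePreserving_val (f : RationalMap) :
    Measure.QuasiMeasurePreserving f.val volume volume := by
  refine ⟨f.measurable_val, Measure.AbsolutelyContinuous.mk fun s hs h0 => ?_⟩
  rw [Measure.map_apply f.measurable_val hs]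
  set W := f.toRatFunc.num.derivative * f.toRatFunc.denom -
      f.toRatFunc.num * f.toRatFunc.denom.derivative with hW
  set B : Set ℂ := {z | (W * f.toRatFunc.denom).IsRoot z} with hB
  have hBfin : B.Finite :=
    Polynomial.finite_setOfPred_isRoot (mul_ne_zero f.wronskian_ne_zero f.denom_ne_zero)
  have hB0 : volume B = 0 := hBfin.measure_zero _
  suffices h : volume (f.val ⁻¹' s \ B) = 0 by
    refine measure_mono_null (t := (f.val ⁻¹' s \ B) ∪ B) ?_ (measure_union_null h hB0)
    intro z hz
    by_cases hzB : z ∈ B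
    · exact Or.inr hzB
    · exact Or.inl ⟨hz, hzB⟩
  refine measure_null_of_locally_null _ fun z hz => ?_
  have hzB : ¬ (W.eval z = 0 ∨ f.toRatFunc.denom.eval z = 0) := by
    have := hz.2
    simpa [hB, Polynomial.IsRoot] using this
  push Not at hzB
  have hp : ¬ f.IsPole z := hzB.2
  have hnum : ContDiffAt ℂ 1 f.val z := by
    have h1 : ContDiffAt ℂ 1 (fun x => f.toRatFunc.num.eval x) z :=
      by
      simpa using (Polynomial.contDiff_aeval (𝕜 := ℂ) f.toRatFunc.num 1).contDiffAt (x := z)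
    have h2 : ContDiffAt ℂ 1 (fun x => f.toRatFunc.denom.eval x) z :=
      by
      simpa using (Polynomial.contDiff_aeval (𝕜 := ℂ) f.toRatFunc.denom 1).contDiffAt (x := z)
    exact h1.div h2 hp
  have hder := f.hasDerivAt_val hp
  have hne : (f.toRatFunc.num.derivative.eval z * f.toRatFunc.denom.eval z -
      f.toRatFunc.num.eval z * f.toRatFunc.denom.derivative.eval z) /
        f.toRatFunc.denom.eval z ^ 2 ≠ 0 := by
    refine div_ne_zero ?_ (pow_ne_zero 2 hp)
    simpa only [hW, Polynomial.eval_sub, Polynomial.eval_mul] using hzB.1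
  have hstrict := hnum.hasStrictDerivAt' hder one_ne_zero
  have hfd := hstrict.hasStrictFDerivAt_equiv hne
  set g := hfd.localInverse with hg
  have hgd : ContDiffAt ℂ 1 g (f.val z) := hnum.to_localInverse hfd.hasFDerivAt one_ne_zero
  obtain ⟨V, hV, hVd⟩ : ∃ V ∈ 𝓝 (f.val z), DifferentiableOn ℂ g V := by
    obtain ⟨V, hV, h⟩ := hgd.contDiffOn le_rfl (by simp)
    exact ⟨V, hV, h.differentiableOn one_ne_zero⟩
  have hev : ∀ᶠ x in 𝓝 z, g (f.val x) = x := hfd.eventually_left_inverse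
  have hVz : f.val ⁻¹' V ∈ 𝓝 z := hder.continuousAt hV
  refine ⟨{x | g (f.val x) = x} ∩ f.val ⁻¹' V ∩ (f.val ⁻¹' s \ B), ?_, ?_⟩
  · exact inter_mem (mem_nhdsWithin_of_mem_nhds (inter_mem hev hVz)) self_mem_nhdsWithin
  · refine measure_mono_null (t := g '' (s ∩ V)) ?_ ?_
    · rintro x ⟨⟨h1, h2⟩, h3, -⟩
      exact ⟨f.val x, ⟨h3, h2⟩, h1⟩
    · refine addHaar_image_eq_zero_of_differentiableOn_of_addHaar_eq_zero volume ?_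
        (measure_mono_null Set.inter_subset_left h0)
      exact (hVd.restrictScalars ℝ).mono Set.inter_subset_right

/-- The factor `|f'|² / (f')²`. -/
def factor (f : RationalMap) (z : ℂ) : ℂ := (‖deriv f.val z‖ : ℂ) ^ 2 / (deriv f.val z) ^ 2

lemma norm_factor_le (f : RationalMap) (z : ℂ) : ‖f.factor z‖ ≤ 1 := by
  simp only [factor, norm_div, norm_pow, Complex.norm_real, norm_norm]
  exact div_self_le_one _

lemma measurable_factor (f : RationalMap) : Measurable f.factor := by
  unfold factor
  have := measurable_deriv f.val
  fun_prop

lemma memLp_pushforward (f : RationalMap) (ν : Lp ℂ ⊤ (volume : Measure ℂ)) :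
    MemLp (fun z => ν (f.val z) * f.factor z) ⊤ (volume : Measure ℂ) := by
  refine memLp_top_of_bound (C := lpNorm ν ⊤ volume) ?_ ?_
  · exact ((Lp.aestronglyMeasurable ν).comp_quasiMeasurePreserving
      f.quasiMeasurePreserving_val).mul f.measurable_factor.aestronglyMeasurable
  · filter_upwards [f.quasiMeasurePreserving_val.ae
      (ae_le_lpNorm_exponent_top (Lp.memLp ν))] with z hz
    rw [norm_mul]
    calc ‖ν (f.val z)‖ * ‖f.factor z‖ ≤ ‖ν (f.val z)‖ * 1 := by
          gcongr
          exact f.norm_factor_le z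
      _ ≤ _ := by simpa using hz

/-- The operator `f^* : ν ↦ (ν ∘ f) |f'|² / (f')²` on `L_∞(ℂ)`. -/
def pushforward (f : RationalMap) :
    Lp ℂ ⊤ (volume : Measure ℂ) →ₗ[ℂ] Lp ℂ ⊤ (volume : Measure ℂ) where
  toFun ν := (f.memLp_pushforward ν).toLp _
  map_add' ν ν' := by
    refine Lp.ext ?_
    filter_upwards [(f.memLp_pushforward (ν + ν')).coeFn_toLp, (f.memLp_pushforward ν).coeFn_toLp,
      (f.memLp_pushforward ν').coeFn_toLp,
      Lp.coeFn_add ((f.memLp_pushforward ν).toLp _) ((f.memLp_pushforward ν').toLp _),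
      f.quasiMeasurePreserving_val.ae (Lp.coeFn_add ν ν')] with z h1 h2 h3 h4 h5
    rw [h1, h4, Pi.add_apply, h2, h3, h5, Pi.add_apply, add_mul]
  map_smul' c ν := by
    refine Lp.ext ?_
    filter_upwards [(f.memLp_pushforward (c • ν)).coeFn_toLp, (f.memLp_pushforward ν).coeFn_toLp,
      Lp.coeFn_smul c ((f.memLp_pushforward ν).toLp _),
      f.quasiMeasurePreserving_val.ae (Lp.coeFn_smul c ν)] with z h1 h2 h3 h4
    rw [h1, RingHom.id_apply, h3, Pi.smul_apply, h2, h4, Pi.smul_apply, smul_eq_mul,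
      smul_eq_mul, mul_assoc]

/-- `L_∞(J)`, as the space of elements of `L_∞(ℂ)` vanishing almost everywhere off `J`. -/
def lInftyJulia (f : RationalMap) : Submodule ℂ (Lp ℂ ⊤ (volume : Measure ℂ)) where
  carrier := {ν | ∀ᵐ z : ℂ, z ∉ f.juliaPlane → ν z = 0}
  zero_mem' := by
    filter_upwards [Lp.coeFn_zero ℂ ⊤ (volume : Measure ℂ)] with z h _
    exact h
  add_mem' {ν ν'} h h' := by
    change ∀ᵐ z : ℂ, z ∉ f.juliaPlane → (ν + ν' : Lp ℂ ⊤ (volume : Measure ℂ)) z = 0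
    filter_upwards [Lp.coeFn_add ν ν', h, h'] with z h1 h2 h3 hz
    rw [h1, Pi.add_apply, h2 hz, h3 hz, add_zero]
  smul_mem' c ν h := by
    change ∀ᵐ z : ℂ, z ∉ f.juliaPlane → (c • ν : Lp ℂ ⊤ (volume : Measure ℂ)) z = 0
    filter_upwards [Lp.coeFn_smul c ν, h] with z h1 h2 hz
    rw [h1, Pi.smul_apply, h2 hz, smul_zero]

/-- `Fix(f^*)`: the fixed points of `f^*` in `L_∞(J)`. -/
def fixedSpace (f : RationalMap) : Submodule ℂ (Lp ℂ ⊤ (volume : Measure ℂ)) :=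
  f.lInftyJulia ⊓ LinearMap.eqLocus f.pushforward LinearMap.id

/-- `∫_J ν(x) / (z - x)^k |dx|²`; for `k = 1, 2, 3` these are the quantities denoted by
`ν̂(z)`, `ν̂'(z)`, `ν̂''(z)`. -/
def cauchyTransform (f : RationalMap) (k : ℕ) (ν : Lp ℂ ⊤ (volume : Measure ℂ)) (z : ℂ) : ℂ :=
  ∫ x in f.juliaPlane, ν x / (z - x) ^ k

open Classical in
/-- The map `ν ↦ (ν̂(v_1), …, ν̂(v_p), ν̂(a), ν̂'(a), ν̂''(a))`, where the last three entries are
set to be zero if `f` is a polynomial. -/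
def cauchyData (f : RationalMap) {p : ℕ} (v : Fin p → ℂ) (a : ℂ) (ν : f.fixedSpace) :
    Fin (p + 3) → ℂ :=
  Fin.append (fun j => f.cauchyTransform 1 ν.1 (v j))
    (if f.IsPolynomial then 0
      else ![f.cauchyTransform 1 ν.1 a, f.cauchyTransform 2 ν.1 a, f.cauchyTransform 3 ν.1 a])

/-- `μ` is an invariant line field on `J`: `μ` is in `L_∞(J)`, `f^* μ = μ`, and `|μ| = 1` on a set
of positive area and `μ = 0` elsewhere. -/
def IsInvariantLineField (f : RationalMap) (μ : Lp ℂ ⊤ (volume : Measure ℂ)) : Prop :=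
  μ ∈ f.fixedSpace ∧ (∀ᵐ z : ℂ, ‖μ z‖ = 1 ∨ μ z = 0) ∧ 0 < volume {z : ℂ | ‖μ z‖ = 1}

/-- The set `E` in the plane, viewed in the sphere, is completely invariant under `f`. -/
def IsCompletelyInvariant (f : RationalMap) (E : Set ℂ) : Prop :=
  f.sphereMap ⁻¹' ((↑) '' E) = ((↑) '' E : Set (OnePoint ℂ))

/-- `E` is a completely invariant ergodic subset of `J` (of positive area). -/
def IsErgodicSubset (f : RationalMap) (E : Set ℂ) : Prop :=
  MeasurableSet E ∧ E ⊆ f.juliaPlane ∧ 0 < volume E ∧ f.IsCompletelyInvariant E ∧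
    ∀ A ⊆ E, MeasurableSet A → f.IsCompletelyInvariant A → volume A = 0 ∨ volume (E \ A) = 0

/-- `μ` is an ergodic invariant line field with support `E`: the support `E` is a completely
invariant ergodic subset of `J`, and every invariant line field with support contained in `E`
is equal to `μ` up to a rotation. -/
def IsErgodicLineField (f : RationalMap) (E : Set ℂ) (μ : Lp ℂ ⊤ (volume : Measure ℂ)) : Prop :=
  f.IsErgodicSubset E ∧ f.IsInvariantLineField μ ∧
    {z : ℂ | μ z ≠ 0} =ᵐ[volume] E ∧
    ∀ μ' : Lp ℂ ⊤ (volume : Measure ℂ), f.IsInvariantLineField μ' →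
      {z : ℂ | μ' z ≠ 0} ≤ᵐ[volume] E → ∃ t : ℂ, ‖t‖ = 1 ∧ μ' = t • μ

end RationalMap

end

/-!
Let `ν` be fixed by `f^*` and supported on the Julia set `J`, which is compact in the plane
(`RationalMap.isBounded_juliaPlane`), and let `ν̂(z) = ∫ ν(x) / (z - x)` be its Cauchy transform. It is
bounded, Hölder continuous of every exponent below one, holomorphic off `J`, and tends to zero at
infinity.

*Injectivity.* Consider `G = (ν̂ ∘ f) / f' - ν̂`. Away from poles and critical points, the change of
variables `y = f(x)` and the invariance of `ν` show that the singular parts of the two terms cancel,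
so `G` is holomorphic (`RationalMap.differentiableAt_cauchyInt_comp_sub`). If `ν̂` vanishes at the
critical values, the Hölder estimate makes `G` bounded near the critical points. It is always bounded
near the poles, so `G` extends to an entire function. At infinity `G` tends to zero: for a polynomial
because `f'` tends to infinity, otherwise because `f(z) - a` and `f'(z)` are of exact orders `1 / z`
and `1 / z²` while `ν̂`, whose Taylor coefficients of order at most two at `a` vanish, is
`O((w - a)³)`. Hence `G = 0` by Liouville's theorem, that is, `ν̂ ∘ f = f' ν̂`
(`RationalMap.cauchyInt_comp_eq_deriv_mul`): `ν̂` is an invariant vector field.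

If `ν̂(z) ≠ 0` at some `z`, the relation `ν̂ ∘ f^n = (f^n)' ν̂` bounds the derivatives of all iterates
near `z`, so that `z` is in the Fatou set. Thus `ν̂ = 0` on `J`
(`RationalMap.eq_zero_of_mem_juliaPlane`), then everywhere by the maximum principle, and `ν = 0`
because integrating `ν̂` along a circle gives the integral of `ν` over the disk
(`IsBoundedDensity.ae_eq_zero_of_cauchyInt_eq_zero`). In particular the fixed space is
finite-dimensional.

*Decomposition.* Invariant line fields with disjoint supports are linearly independent, so there is a
family of such line fields of maximal cardinality. Maximality forces every support to be ergodic and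
every element of the fixed space to vanish off the union of the supports; on each support, the
quotient of such an element by the line field is an invariant function, hence constant
(`RationalMap.exists_ergodic_decomposition`). Sets which are only invariant up to null sets are
replaced by exactly invariant ones by taking the points whose orbits eventually stay in them; that
these points are in `J` uses the forward invariance of the Fatou set, which holds because rational
maps are open.
-/

/-! ### The Cauchy transform of a bounded density -/

lemma integrableOn_norm_rpow_neg {s : ℝ} (hs : s < 2) :
    IntegrableOn (fun x : ℂ => ‖x‖ ^ (-s)) (Metric.ball 0 1) := by
  rw [integrableOn_fun_norm_addHaar volume (f := fun y : ℝ => y ^ (-s))]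
  have h1 : IntegrableOn (fun y : ℝ => y ^ (1 - s)) (Set.Ioo 0 1) := by
    have := intervalIntegral.intervalIntegrable_rpow' (a := 0) (b := 1) (r := 1 - s) (by linarith)
    rw [intervalIntegrable_iff_integrableOn_Ioo_of_le zero_le_one] at this
    exact this
  refine h1.congr_fun (fun y hy => ?_) measurableSet_Ioo
  have hy0 : 0 < y := hy.1
  simp only [Complex.finrank_real_complex, smul_eq_mul]
  rw [show 1 - s = 1 + -s by ring, Real.rpow_add hy0]
  simp

lemma exists_integral_closedBall_norm_sub_rpow_le {s : ℝ} (h0 : 0 ≤ s) (hs : s < 2) (R : ℝ) :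
    ∃ C, ∀ z : ℂ, IntegrableOn (fun x => ‖z - x‖ ^ (-s)) (Metric.closedBall 0 R) ∧
      ∫ x in Metric.closedBall 0 R, ‖z - x‖ ^ (-s) ≤ C := by
  set k : ℂ → ℝ := (Metric.ball 0 1).indicator (fun x : ℂ => ‖x‖ ^ (-s)) with hk
  have hki : Integrable k :=
    (integrable_indicator_iff measurableSet_ball).2 (integrableOn_norm_rpow_neg hs)
  set e : ℂ → ℝ := (Metric.closedBall (0 : ℂ) R).indicator (fun _ => (1 : ℝ)) with he
  have hei : Integrable e := by
    rw [he, integrable_indicator_iff Metric.isClosed_closedBall.measurableSet]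
    exact integrableOn_const (measure_closedBall_lt_top.ne)
  have hk0 : ∀ x, 0 ≤ k x := fun x => Set.indicator_nonneg (fun y _ => by positivity) x
  refine ⟨(∫ x, k x) + ∫ x, e x, fun z => ?_⟩
  have hkz : Integrable (fun x => k (z - x)) := hki.comp_sub_left z
  have hle : ∀ x ∈ Metric.closedBall (0 : ℂ) R, ‖z - x‖ ^ (-s) ≤ k (z - x) + e x := by
    intro x hx
    have hex : e x = 1 := by rw [he, Set.indicator_of_mem hx]
    rw [hex]
    by_cases h : z - x ∈ Metric.ball (0 : ℂ) 1
    · rw [hk, Set.indicator_of_mem h]; linarith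
    · have h1 : 1 ≤ ‖z - x‖ := by simpa using h
      have := Real.rpow_le_one_of_one_le_of_nonpos h1 (neg_nonpos.2 h0)
      linarith [hk0 (z - x)]
  have hmeas : AEStronglyMeasurable (fun x : ℂ => ‖z - x‖ ^ (-s))
      (volume.restrict (Metric.closedBall 0 R)) := by
    apply Measurable.aestronglyMeasurable
    fun_prop
  have hint : IntegrableOn (fun x => ‖z - x‖ ^ (-s)) (Metric.closedBall (0 : ℂ) R) := by
    refine Integrable.mono' (hkz.add hei).integrableOn hmeas ?_
    filter_upwards [ae_restrict_mem Metric.isClosed_closedBall.measurableSet] with x hx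
    rw [Real.norm_of_nonneg (by positivity)]
    exact hle x hx
  refine ⟨hint, ?_⟩
  calc ∫ x in Metric.closedBall 0 R, ‖z - x‖ ^ (-s)
      ≤ ∫ x in Metric.closedBall 0 R, (k (z - x) + e x) :=
        setIntegral_mono_on hint (hkz.add hei).integrableOn
          Metric.isClosed_closedBall.measurableSet hle
    _ ≤ ∫ x, (k (z - x) + e x) := by
        refine setIntegral_le_integral (hkz.add hei) (Eventually.of_forall fun x => ?_)
        exact add_nonneg (hk0 _) (Set.indicator_nonneg (fun _ _ => zero_le_one) x)
    _ = _ := by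
        rw [integral_add hkz hei, integral_sub_left_eq_self]

/-- `g` is a measurable function bounded by `M` which vanishes off the disk of radius `R`. -/
structure IsBoundedDensity (g : ℂ → ℂ) (M R : ℝ) : Prop where
  aestronglyMeasurable : AEStronglyMeasurable g volume
  norm_le : ∀ x, ‖g x‖ ≤ M
  eq_zero : ∀ x, R < ‖x‖ → g x = 0

/-- The Cauchy transform of `g`, with the normalization `∫ g(x) / (z - x)`. -/
noncomputable def cauchyInt (g : ℂ → ℂ) (z : ℂ) : ℂ := ∫ x, g x / (z - x)

namespace IsBoundedDensity

variable {g : ℂ → ℂ} {M R : ℝ}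

lemma bound_nonneg (hg : IsBoundedDensity g M R) : 0 ≤ M := (norm_nonneg _).trans (hg.norm_le 0)

lemma indicator (hg : IsBoundedDensity g M R) {s : Set ℂ} (hs : MeasurableSet s) :
    IsBoundedDensity (s.indicator g) M R where
  aestronglyMeasurable := hg.aestronglyMeasurable.indicator hs
  norm_le x := (norm_indicator_le_norm_self g x).trans (hg.norm_le x)
  eq_zero x hx := by simp [hg.eq_zero x hx]

lemma integrable (hg : IsBoundedDensity g M R) : Integrable g := by
  have h : IntegrableOn g (Metric.closedBall 0 R) :=
    Measure.integrableOn_of_bounded measure_closedBall_lt_top.ne hg.aestronglyMeasurable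
      (Eventually.of_forall hg.norm_le)
  refine (integrableOn_iff_integrable_of_support_subset fun x hx => ?_).1 h
  by_contra hxR
  exact hx (hg.eq_zero x (by simpa using hxR))

lemma exists_integral_norm_mul_rpow_le (hg : IsBoundedDensity g M R) {s : ℝ} (h0 : 0 ≤ s)
    (hs : s < 2) :
    ∃ C, ∀ z : ℂ, Integrable (fun x => ‖g x‖ * ‖z - x‖ ^ (-s)) ∧
      ∫ x, ‖g x‖ * ‖z - x‖ ^ (-s) ≤ C := by
  obtain ⟨C, hC⟩ := exists_integral_closedBall_norm_sub_rpow_le h0 hs R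
  refine ⟨M * C, fun z => ?_⟩
  obtain ⟨hi, hle⟩ := hC z
  have hsupp : Function.support (fun x => ‖g x‖ * ‖z - x‖ ^ (-s)) ⊆ Metric.closedBall 0 R := by
    intro x hx
    by_contra hxR
    exact hx (by simp [hg.eq_zero x (by simpa using hxR)])
  have hpt : ∀ x, ‖g x‖ * ‖z - x‖ ^ (-s) ≤ M * ‖z - x‖ ^ (-s) := fun x =>
    mul_le_mul_of_nonneg_right (hg.norm_le x) (by positivity)
  have hm : AEStronglyMeasurable (fun x => ‖g x‖ * ‖z - x‖ ^ (-s)) volume := by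
    refine hg.aestronglyMeasurable.norm.mul (Measurable.aestronglyMeasurable ?_)
    fun_prop
  have hion : IntegrableOn (fun x => ‖g x‖ * ‖z - x‖ ^ (-s)) (Metric.closedBall 0 R) := by
    refine Integrable.mono' (hi.const_mul M) hm.restrict (Eventually.of_forall fun x => ?_)
    rw [Real.norm_of_nonneg (by positivity)]
    exact hpt x
  refine ⟨(integrableOn_iff_integrable_of_support_subset hsupp).1 hion, ?_⟩
  rw [← setIntegral_eq_integral_of_forall_compl_eq_zero (s := Metric.closedBall (0 : ℂ) R)
    (fun x hx => by simp [hg.eq_zero x (by simpa using hx)])]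
  calc _ ≤ ∫ x in Metric.closedBall 0 R, M * ‖z - x‖ ^ (-s) :=
        integral_mono hion (hi.const_mul M) hpt
    _ = M * ∫ x in Metric.closedBall 0 R, ‖z - x‖ ^ (-s) := integral_const_mul _ _
    _ ≤ M * C := mul_le_mul_of_nonneg_left hle hg.bound_nonneg

lemma aestronglyMeasurable_div (hg : IsBoundedDensity g M R) (z : ℂ) (k : ℕ) :
    AEStronglyMeasurable (fun x => g x / (z - x) ^ k) volume := by
  simp_rw [div_eq_mul_inv]
  refine hg.aestronglyMeasurable.mul (Measurable.aestronglyMeasurable ?_)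
  fun_prop

lemma exists_integral_norm_div_le (hg : IsBoundedDensity g M R) :
    ∃ C, ∀ z : ℂ, Integrable (fun x => g x / (z - x)) ∧ ∫ x, ‖g x / (z - x)‖ ≤ C := by
  obtain ⟨C, hC⟩ := hg.exists_integral_norm_mul_rpow_le (s := 1) zero_le_one one_lt_two
  refine ⟨C, fun z => ?_⟩
  have h : ∀ x, ‖g x / (z - x)‖ = ‖g x‖ * ‖z - x‖ ^ (-1 : ℝ) := fun x => by
    rw [norm_div, Real.rpow_neg_one, div_eq_mul_inv]
  refine ⟨?_, by simp_rw [h]; exact (hC z).2⟩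
  have hm := hg.aestronglyMeasurable_div z 1
  simp only [pow_one] at hm
  rw [← integrable_norm_iff hm]
  simp_rw [h]
  exact (hC z).1

lemma integrable_div (hg : IsBoundedDensity g M R) (z : ℂ) :
    Integrable (fun x => g x / (z - x)) :=
  (hg.exists_integral_norm_div_le.choose_spec z).1

lemma exists_norm_cauchyInt_le (hg : IsBoundedDensity g M R) :
    ∃ C, ∀ z, ‖cauchyInt g z‖ ≤ C := by
  obtain ⟨C, hC⟩ := hg.exists_integral_norm_div_le
  exact ⟨C, fun z => (norm_integral_le_integral_norm _).trans (hC z).2⟩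

/-- The Cauchy transform is Hölder continuous of every exponent `α < 1`: the kernel increment
`|z - w| / (|z - x| |w - x|)` is at most `2 |z - w| ^ α` times the sum of `|z - x| ^ (-1 - α)` and
`|w - x| ^ (-1 - α)`, which are uniformly integrable against `g`. -/
lemma exists_holder (hg : IsBoundedDensity g M R) {α : ℝ} (h0 : 0 ≤ α) (h1 : α < 1) :
    ∃ C, ∀ z w, ‖cauchyInt g z - cauchyInt g w‖ ≤ C * ‖z - w‖ ^ α := by
  obtain ⟨C, hC⟩ := hg.exists_integral_norm_mul_rpow_le (s := 1 + α) (by linarith) (by linarith)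
  -- the elementary estimate when `p` is the smaller of the distances to `z` and `w`
  have key : ∀ p q d : ℝ, 0 < p → p ≤ q → 0 ≤ d → d ≤ p + q →
      d / (p * q) ≤ 2 * d ^ α * p ^ (-(1 + α)) := by
    intro p q d hp hpq hd hdpq
    have hq : 0 < q := hp.trans_le hpq
    rcases hd.eq_or_lt with rfl | hd
    · simp only [zero_div]; positivity
    have e1 : d = d ^ α * d ^ (1 - α) := by
      rw [← Real.rpow_add hd]; simp
    have e2 : d ^ (1 - α) ≤ 2 * q ^ (1 - α) := by
      calc d ^ (1 - α) ≤ (2 * q) ^ (1 - α) :=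
            Real.rpow_le_rpow hd.le (by linarith) (by linarith)
        _ = 2 ^ (1 - α) * q ^ (1 - α) := Real.mul_rpow zero_le_two hq.le
        _ ≤ 2 * q ^ (1 - α) := by
            gcongr
            calc (2 : ℝ) ^ (1 - α) ≤ 2 ^ (1 : ℝ) :=
                  Real.rpow_le_rpow_of_exponent_le one_le_two (by linarith)
              _ = 2 := Real.rpow_one 2
    have e3 : q ^ (1 - α) / q = q ^ (-α) := by
      rw [show -α = (1 - α) - 1 by ring, Real.rpow_sub_one hq.ne']
    have e4 : q ^ (-α) ≤ p ^ (-α) := Real.rpow_le_rpow_of_nonpos hp hpq (by linarith)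
    have e5 : p ^ (-(1 + α)) = p ^ (-α) / p := by
      rw [show -(1 + α) = -α - 1 by ring, Real.rpow_sub_one hp.ne']
    calc d / (p * q) = d ^ α * d ^ (1 - α) / (p * q) := by rw [← e1]
      _ ≤ d ^ α * (2 * q ^ (1 - α)) / (p * q) := by gcongr
      _ = 2 * d ^ α * ((q ^ (1 - α) / q) / p) := by field_simp
      _ ≤ 2 * d ^ α * (p ^ (-α) / p) := by rw [e3]; gcongr
      _ = _ := by rw [e5]
  refine ⟨2 * (C + C), fun z w => ?_⟩
  unfold cauchyInt
  rw [← integral_sub (hg.integrable_div z) (hg.integrable_div w)]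
  set B : ℂ → ℝ := fun x => 2 * ‖z - w‖ ^ α *
    (‖g x‖ * ‖z - x‖ ^ (-(1 + α)) + ‖g x‖ * ‖w - x‖ ^ (-(1 + α))) with hB
  have hBi : Integrable B := ((hC z).1.add (hC w).1).const_mul _
  calc ‖∫ x, (g x / (z - x) - g x / (w - x))‖ ≤ ∫ x, B x := by
        refine norm_integral_le_of_norm_le hBi ?_
        have hz : ∀ᵐ x : ℂ, x ≠ z := by simp [ae_iff, measure_singleton]
        have hw : ∀ᵐ x : ℂ, x ≠ w := by simp [ae_iff, measure_singleton]
        filter_upwards [hz, hw] with x hxz hxw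
        have hz' : z - x ≠ 0 := sub_ne_zero.2 hxz.symm
        have hw' : w - x ≠ 0 := sub_ne_zero.2 hxw.symm
        have e : g x / (z - x) - g x / (w - x) = g x * ((w - z) / ((z - x) * (w - x))) := by
          field_simp; ring
        have hp : 0 < ‖z - x‖ := norm_pos_iff.2 hz'
        have hq : 0 < ‖w - x‖ := norm_pos_iff.2 hw'
        have hd : ‖z - w‖ ≤ ‖z - x‖ + ‖w - x‖ := by
          calc ‖z - w‖ = ‖(z - x) - (w - x)‖ := by congr 1; ring
            _ ≤ _ := norm_sub_le _ _
        have h3 : ‖z - w‖ / (‖z - x‖ * ‖w - x‖) ≤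
            2 * ‖z - w‖ ^ α * (‖z - x‖ ^ (-(1 + α)) + ‖w - x‖ ^ (-(1 + α))) := by
          rcases le_total ‖z - x‖ ‖w - x‖ with h | h
          · refine (key _ _ _ hp h (norm_nonneg _) hd).trans ?_
            gcongr
            linarith [Real.rpow_nonneg hq.le (-(1 + α))]
          · rw [mul_comm ‖z - x‖]
            refine (key _ _ _ hq h (norm_nonneg _) (by linarith)).trans ?_
            gcongr
            linarith [Real.rpow_nonneg hp.le (-(1 + α))]
        rw [e, norm_mul, norm_div, norm_mul, norm_sub_rev w z]
        calc ‖g x‖ * (‖z - w‖ / (‖z - x‖ * ‖w - x‖)) ≤ ‖g x‖ * (2 * ‖z - w‖ ^ α *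
              (‖z - x‖ ^ (-(1 + α)) + ‖w - x‖ ^ (-(1 + α)))) := by gcongr
          _ = B x := by rw [hB]; ring
    _ = 2 * ‖z - w‖ ^ α * ((∫ x, ‖g x‖ * ‖z - x‖ ^ (-(1 + α))) +
          ∫ x, ‖g x‖ * ‖w - x‖ ^ (-(1 + α))) := by
        rw [hB, integral_const_mul, integral_add (hC z).1 (hC w).1]
    _ ≤ 2 * ‖z - w‖ ^ α * (C + C) := by gcongr <;> [exact (hC z).2; exact (hC w).2]
    _ = _ := by ring

lemma continuous_cauchyInt (hg : IsBoundedDensity g M R) : Continuous (cauchyInt g) := by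
  obtain ⟨C, hC⟩ := hg.exists_holder (α := 1 / 2) (by norm_num) (by norm_num)
  rw [continuous_iff_continuousAt]
  intro z
  rw [ContinuousAt, tendsto_iff_norm_sub_tendsto_zero]
  refine squeeze_zero (fun _ => norm_nonneg _) (fun w => hC w z) ?_
  have : ContinuousAt (fun w : ℂ => C * ‖w - z‖ ^ (1 / 2 : ℝ)) z := by
    refine continuousAt_const.mul (ContinuousAt.rpow_const (by fun_prop) (Or.inr (by norm_num)))
  simpa [ContinuousAt, Real.zero_rpow] using this

lemma tendsto_cauchyInt (hg : IsBoundedDensity g M R) :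
    Tendsto (cauchyInt g) (cocompact ℂ) (𝓝 0) := by
  have hbound : ∀ z : ℂ, 2 * |R| < ‖z‖ → ‖cauchyInt g z‖ ≤ (2 * ∫ x, ‖g x‖) * ‖z‖⁻¹ := by
    intro z hz
    have hz0 : 0 < ‖z‖ := lt_of_le_of_lt (by positivity) hz
    have : ‖cauchyInt g z‖ ≤ ∫ x, 2 * ‖z‖⁻¹ * ‖g x‖ := by
      refine norm_integral_le_of_norm_le (hg.integrable.norm.const_mul _)
        (Eventually.of_forall fun x => ?_)
      by_cases hx : R < ‖x‖
      · simp [hg.eq_zero x hx]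
      · have h1 : ‖z‖ / 2 ≤ ‖z - x‖ := by
          have := norm_sub_norm_le z x
          linarith [le_abs_self R]
        rw [norm_div, div_eq_mul_inv, mul_comm]
        gcongr
        calc ‖z - x‖⁻¹ ≤ (‖z‖ / 2)⁻¹ := by gcongr
          _ = 2 * ‖z‖⁻¹ := by rw [inv_div]; ring
    rw [integral_const_mul] at this
    linarith
  rw [tendsto_zero_iff_norm_tendsto_zero]
  have hlim : Tendsto (fun z : ℂ => (2 * ∫ x, ‖g x‖) * ‖z‖⁻¹) (cocompact ℂ) (𝓝 0) := by
    have := (tendsto_inv_atTop_zero.comp (tendsto_norm_cocompact_atTop (E := ℂ))).const_mul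
      (2 * ∫ x, ‖g x‖)
    simpa using this
  refine squeeze_zero' (Eventually.of_forall fun _ => norm_nonneg _) ?_ hlim
  filter_upwards [(tendsto_norm_cocompact_atTop (E := ℂ)).eventually_gt_atTop (2 * |R|)] with z hz
  exact hbound z hz

end IsBoundedDensity

/-- Integrals depending holomorphically on a parameter: a locally uniform integrable bound on the
integrand suffices, since it bounds the derivative by Cauchy's estimate. -/
lemma differentiableAt_integral_of_norm_le {X : Type*} [MeasurableSpace X] {μ : Measure X}
    {F : ℂ → X → ℂ} {u₀ : ℂ} {r : ℝ} (hr : 0 < r) {b : X → ℝ}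
    (hm : ∀ u ∈ Metric.ball u₀ r, AEStronglyMeasurable (F u) μ)
    (hd : ∀ᵐ x ∂μ, DifferentiableOn ℂ (F · x) (Metric.ball u₀ r))
    (hb : ∀ᵐ x ∂μ, ∀ u ∈ Metric.ball u₀ r, ‖F u x‖ ≤ b x) (hbi : Integrable b μ) :
    DifferentiableAt ℂ (fun u => ∫ x, F u x ∂μ) u₀ := by
  have hu₀ : u₀ ∈ Metric.ball u₀ r := Metric.mem_ball_self hr
  have hda : ∀ᵐ x ∂μ, HasDerivAt (F · x) (deriv (F · x) u₀) u₀ := by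
    filter_upwards [hd] with x hx
    exact (hx.differentiableAt (Metric.isOpen_ball.mem_nhds hu₀)).hasDerivAt
  have hint : Integrable (F u₀) μ := by
    refine hbi.mono' (hm _ hu₀) ?_
    filter_upwards [hb] with x hx using hx _ hu₀
  -- the derivative is a limit of difference quotients, hence measurable
  have hm' : AEStronglyMeasurable (fun x => deriv (F · x) u₀) μ := by
    set c : ℕ → ℂ := fun n => ((r / (n + 2) : ℝ) : ℂ) with hc
    have hcpos : ∀ n : ℕ, 0 < r / ((n : ℝ) + 2) := fun n => by positivity
    have hc0 : ∀ n, c n ≠ 0 := fun n => Complex.ofReal_ne_zero.2 (hcpos n).ne'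
    have hcb : ∀ n, u₀ + c n ∈ Metric.ball u₀ r := by
      intro n
      rw [mem_ball_iff_norm, add_sub_cancel_left, hc, Complex.norm_real,
        Real.norm_of_nonneg (hcpos n).le]
      rw [div_lt_iff₀ (by positivity)]
      nlinarith [(Nat.cast_nonneg n : (0 : ℝ) ≤ n)]
    have hct : Tendsto c atTop (𝓝[≠] 0) := by
      rw [tendsto_nhdsWithin_iff]
      refine ⟨?_, Eventually.of_forall hc0⟩
      have h1 : Tendsto (fun n : ℕ => r / ((n : ℝ) + 2)) atTop (𝓝 0) :=
        tendsto_const_nhds.div_atTop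
          (tendsto_atTop_add_const_right _ _ tendsto_natCast_atTop_atTop)
      have := (Complex.continuous_ofReal.tendsto 0).comp h1
      rwa [Complex.ofReal_zero] at this
    refine aestronglyMeasurable_of_tendsto_ae (u := atTop)
      (f := fun n x => (c n)⁻¹ • (F (u₀ + c n) x - F u₀ x)) (fun n => ?_) ?_
    · exact ((hm _ (hcb n)).sub (hm _ hu₀)).const_smul (c n)⁻¹
    · filter_upwards [hda] with x hx
      exact (hasDerivAt_iff_tendsto_slope_zero.1 hx).comp hct
  refine (hasDerivAt_integral_of_dominated_loc_of_deriv_le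
    (s := Metric.ball u₀ (r / 2)) (F' := fun u x => deriv (F · x) u)
    (bound := fun x => b x / (r / 2)) (Metric.ball_mem_nhds _ (by positivity)) ?_ hint hm' ?_
    (hbi.div_const _) ?_).2.differentiableAt
  · filter_upwards [Metric.ball_mem_nhds u₀ hr] with u hu using hm u hu
  · filter_upwards [hd, hb] with x hx hbx u hu
    have hsub : Metric.closedBall u (r / 2) ⊆ Metric.ball u₀ r := by
      refine Metric.closedBall_subset_ball' ?_
      have := Metric.mem_ball.1 hu
      linarith
    refine Complex.norm_deriv_le_of_forall_mem_sphere_norm_le (by positivity) ?_ ?_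
    · exact (hx.mono hsub).diffContOnCl_ball subset_rfl
    · intro z hz
      exact hbx z (hsub (Metric.sphere_subset_closedBall hz))
  · filter_upwards [hd] with x hx u hu
    exact (hx.differentiableAt (Metric.isOpen_ball.mem_nhds
      (Metric.ball_subset_ball (by linarith) hu))).hasDerivAt

namespace IsBoundedDensity

variable {g : ℂ → ℂ} {M R : ℝ}

lemma differentiableAt_cauchyInt (hg : IsBoundedDensity g M R) {u₀ : ℂ} {r : ℝ} (hr : 0 < r)
    (h0 : ∀ x ∈ Metric.ball u₀ r, g x = 0) : DifferentiableAt ℂ (cauchyInt g) u₀ := by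
  have hne : ∀ u ∈ Metric.ball u₀ (r / 2), ∀ x ∉ Metric.ball u₀ r, r / 2 ≤ ‖u - x‖ := by
    intro u hu x hx
    rw [mem_ball_iff_norm] at hu hx
    have : ‖x - u₀‖ ≤ ‖u - u₀‖ + ‖u - x‖ := by
      calc ‖x - u₀‖ = ‖(u - u₀) - (u - x)‖ := by congr 1; ring
        _ ≤ _ := norm_sub_le _ _
    linarith
  refine differentiableAt_integral_of_norm_le (r := r / 2) (by positivity)
    (b := fun x => ‖g x‖ * (r / 2)⁻¹) (fun u _ => ?_) (Eventually.of_forall fun x => ?_)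
    (Eventually.of_forall fun x u hu => ?_) (hg.integrable.norm.mul_const _)
  · simpa using hg.aestronglyMeasurable_div u 1
  · by_cases hx : x ∈ Metric.ball u₀ r
    · simp only [h0 x hx, zero_div]
      exact differentiableOn_const 0
    · refine DifferentiableOn.div (differentiableOn_const _) (by fun_prop) fun u hu => ?_
      rw [← norm_pos_iff]
      exact lt_of_lt_of_le (by positivity) (hne u hu x hx)
  · by_cases hx : x ∈ Metric.ball u₀ r
    · simp [h0 x hx]
    · rw [norm_div, div_eq_mul_inv]
      gcongr
      exact hne u hu x hx

end IsBoundedDensity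

lemma circleIntegral_inv_sub {c x : ℂ} {r : ℝ} (hr : 0 ≤ r) (hx : ‖x - c‖ ≠ r) :
    (∮ z in C(c, r), (z - x)⁻¹) =
      (Metric.closedBall c r).indicator (fun _ => 2 * (Real.pi : ℂ) * Complex.I) x := by
  by_cases h : x ∈ Metric.closedBall c r
  · rw [Set.indicator_of_mem h]
    refine circleIntegral.integral_sub_inv_of_mem_ball ?_
    rw [mem_closedBall_iff_norm] at h
    exact mem_ball_iff_norm.2 (lt_of_le_of_ne h hx)
  · rw [Set.indicator_of_notMem h]
    refine Complex.circleIntegral_eq_zero_of_differentiable_on_off_countable hr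
      Set.countable_empty ?_ ?_
    · intro z hz
      have : z - x ≠ 0 := sub_ne_zero.2 fun e => h (e ▸ hz)
      exact ContinuousAt.continuousWithinAt (by fun_prop (disch := assumption))
    · rintro z ⟨hz, -⟩
      have : z - x ≠ 0 := sub_ne_zero.2 fun e => h (e ▸ Metric.ball_subset_closedBall hz)
      fun_prop (disch := assumption)

namespace IsBoundedDensity

variable {g : ℂ → ℂ} {M R : ℝ}

/-- Integrating the Cauchy transform along a circle gives the integral of `g` over the disk. -/
lemma setIntegral_closedBall_eq_zero (hg : IsBoundedDensity g M R) (h : ∀ z, cauchyInt g z = 0)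
    (c : ℂ) {r : ℝ} (hr : 0 < r) : ∫ x in Metric.closedBall c r, g x = 0 := by
  set ν : Measure ℝ := volume.restrict (Set.Ioc 0 (2 * Real.pi)) with hν
  set F : ℝ → ℂ → ℂ := fun θ x => deriv (circleMap c r) θ • (g x / (circleMap c r θ - x)) with hF
  obtain ⟨C, hC⟩ := hg.exists_integral_norm_div_le
  have hFm : AEStronglyMeasurable (Function.uncurry F) (ν.prod volume) := by
    have e : Function.uncurry F = fun p : ℝ × ℂ =>
        (circleMap 0 r p.1 * Complex.I) * (g p.2 * (circleMap c r p.1 - p.2)⁻¹) := by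
      ext ⟨θ, x⟩
      simp [hF, Function.uncurry, div_eq_mul_inv]
    rw [e]
    refine AEStronglyMeasurable.mul ?_ ((hg.aestronglyMeasurable.comp_snd).mul ?_)
    · have : Continuous fun p : ℝ × ℂ => circleMap 0 r p.1 * Complex.I := by fun_prop
      exact this.aestronglyMeasurable
    · have : Measurable fun p : ℝ × ℂ => (circleMap c r p.1 - p.2)⁻¹ :=
        Measurable.inv (by
          have : Continuous fun p : ℝ × ℂ => circleMap c r p.1 - p.2 := by fun_prop
          exact this.measurable)
      exact this.aestronglyMeasurable
  have hFi : Integrable (Function.uncurry F) (ν.prod volume) := by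
    rw [integrable_prod_iff hFm]
    refine ⟨Eventually.of_forall fun θ =>
      (hg.integrable_div (circleMap c r θ)).smul (deriv (circleMap c r) θ), ?_⟩
    refine Integrable.of_bound hFm.norm.integral_prod_right' (r * C)
      (Eventually.of_forall fun θ => ?_)
    rw [Real.norm_of_nonneg (integral_nonneg fun _ => norm_nonneg _)]
    have : ∀ x, ‖Function.uncurry F (θ, x)‖ = r * ‖g x / (circleMap c r θ - x)‖ := fun x => by
      simp [hF, Function.uncurry, abs_of_pos hr]
    simp_rw [this]
    rw [integral_const_mul]
    exact mul_le_mul_of_nonneg_left (hC _).2 hr.le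
  have hswap := integral_integral_swap hFi
  have hleft : ∫ θ, ∫ x, F θ x ∂volume ∂ν = 0 := by
    have : ∀ θ, ∫ x, F θ x = 0 := fun θ => by
      simp only [hF]
      rw [integral_smul]
      have := h (circleMap c r θ)
      unfold cauchyInt at this
      rw [this, smul_zero]
    simp [this]
  have hright : ∀ᵐ x : ℂ, ∫ θ, F θ x ∂ν =
      (Metric.closedBall c r).indicator (fun x => 2 * (Real.pi : ℂ) * Complex.I * g x) x := by
    have hs : ∀ᵐ x : ℂ, x ∉ Metric.sphere c r :=
      measure_eq_zero_iff_ae_notMem.1 (Measure.addHaar_sphere _ _ _)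
    filter_upwards [hs] with x hx
    have hx' : ‖x - c‖ ≠ r := fun e => hx (mem_sphere_iff_norm.2 e)
    have h1 := circleIntegral_inv_sub hr.le hx'
    rw [circleIntegral, intervalIntegral.integral_of_le Real.two_pi_pos.le] at h1
    have : ∀ θ, F θ x = g x * (deriv (circleMap c r) θ • (circleMap c r θ - x)⁻¹) := fun θ => by
      simp only [hF, smul_eq_mul]; ring
    simp_rw [this]
    rw [integral_const_mul, h1]
    by_cases hxb : x ∈ Metric.closedBall c r
    · rw [Set.indicator_of_mem hxb, Set.indicator_of_mem hxb]; ring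
    · rw [Set.indicator_of_notMem hxb, Set.indicator_of_notMem hxb, mul_zero]
  rw [hleft, integral_congr_ae hright, integral_indicator Metric.isClosed_closedBall.measurableSet,
    integral_const_mul] at hswap
  have h2 : (2 * (Real.pi : ℂ) * Complex.I) ≠ 0 := Complex.two_pi_I_ne_zero
  exact (mul_eq_zero.1 hswap.symm).resolve_left h2

/-- The Cauchy transform determines the density. -/
lemma ae_eq_zero_of_cauchyInt_eq_zero (hg : IsBoundedDensity g M R)
    (h : ∀ z, cauchyInt g z = 0) : ∀ᵐ x, g x = 0 := by
  have hlim := IsUnifLocDoublingMeasure.ae_tendsto_average (volume : Measure ℂ)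
    hg.integrable.locallyIntegrable 1
  filter_upwards [hlim] with x hx
  have h1 := hx (ι := ℝ) (l := 𝓝[>] 0) (fun _ => x) id tendsto_id (by
    filter_upwards [self_mem_nhdsWithin] with r hr
    exact Metric.mem_closedBall_self (by simpa using (Set.mem_Ioi.1 hr).le))
  have h2 : Tendsto (fun r : ℝ => ⨍ y in Metric.closedBall x r, g y) (𝓝[>] 0) (𝓝 0) := by
    refine tendsto_const_nhds.congr' ?_
    filter_upwards [self_mem_nhdsWithin] with r hr
    rw [setAverage_eq, hg.setIntegral_closedBall_eq_zero h x hr, smul_zero]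
  exact tendsto_nhds_unique h1 h2

lemma integrable_div_pow (hg : IsBoundedDensity g M R) {a : ℂ} {r : ℝ} (hr : 0 < r)
    (h0 : ∀ x ∈ Metric.ball a r, g x = 0) (k : ℕ) : Integrable (fun x => g x / (a - x) ^ k) := by
  refine Integrable.mono' (hg.integrable.norm.mul_const ((r ^ k)⁻¹))
    (hg.aestronglyMeasurable_div a k) (Eventually.of_forall fun x => ?_)
  by_cases hx : x ∈ Metric.ball a r
  · simp [h0 x hx]
  · rw [norm_div, norm_pow, div_eq_mul_inv]
    gcongr
    rwa [mem_ball_iff_norm, not_lt, norm_sub_rev] at hx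

/-- Away from the support, the Cauchy transform vanishes to third order as soon as its first three
Taylor coefficients, which are integrals against powers of `1 / (a - x)`, are zero. -/
lemma exists_norm_cauchyInt_le_cube (hg : IsBoundedDensity g M R) {a : ℂ} {r : ℝ} (hr : 0 < r)
    (h0 : ∀ x ∈ Metric.ball a r, g x = 0)
    (h : ∀ k ∈ ({1, 2, 3} : Set ℕ), ∫ x, g x / (a - x) ^ k = 0) :
    ∃ C, ∀ w, ‖w - a‖ < r / 2 → ‖cauchyInt g w‖ ≤ C * ‖w - a‖ ^ 3 := by
  have hge : ∀ x ∉ Metric.ball a r, r ≤ ‖a - x‖ := fun x hx => by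
    rw [mem_ball_iff_norm, not_lt, norm_sub_rev] at hx; exact hx
  have hint := hg.integrable_div_pow hr h0
  refine ⟨(∫ x, ‖g x‖) * ((r ^ 3)⁻¹ * (r / 2)⁻¹), fun w hw => ?_⟩
  set d := w - a with hd
  have hwx : ∀ x ∉ Metric.ball a r, r / 2 ≤ ‖w - x‖ := fun x hx => by
    have h1 := hge x hx
    have h2 : ‖a - x‖ ≤ ‖w - x‖ + ‖d‖ := by
      calc ‖a - x‖ = ‖(w - x) - d‖ := by congr 1; rw [hd]; ring
        _ ≤ _ := norm_sub_le _ _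
    linarith
  have hexp : ∀ x, g x / (w - x) = g x / (a - x) ^ 1 - d * (g x / (a - x) ^ 2) +
      d ^ 2 * (g x / (a - x) ^ 3) - d ^ 3 * (g x / ((a - x) ^ 3 * (w - x))) := by
    intro x
    by_cases hx : x ∈ Metric.ball a r
    · simp [h0 x hx]
    · have h1 : a - x ≠ 0 := norm_pos_iff.1 (hr.trans_le (hge x hx))
      have h2 : w - x ≠ 0 := norm_pos_iff.1 ((half_pos hr).trans_le (hwx x hx))
      field_simp
      rw [hd]; ring
  have hb : ∀ x, ‖g x / ((a - x) ^ 3 * (w - x))‖ ≤ ‖g x‖ * ((r ^ 3)⁻¹ * (r / 2)⁻¹) := by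
    intro x
    by_cases hx : x ∈ Metric.ball a r
    · simp [h0 x hx]
    · rw [norm_div, norm_mul, norm_pow, div_eq_mul_inv, mul_inv]
      gcongr
      · exact hge x hx
      · exact hwx x hx
  have hm : AEStronglyMeasurable (fun x => g x / ((a - x) ^ 3 * (w - x))) volume := by
    simp_rw [div_eq_mul_inv]
    refine hg.aestronglyMeasurable.mul (Measurable.aestronglyMeasurable ?_)
    fun_prop
  have hbi := hg.integrable.norm.mul_const ((r ^ 3)⁻¹ * (r / 2)⁻¹)
  have hrem : Integrable (fun x => g x / ((a - x) ^ 3 * (w - x))) :=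
    hbi.mono' hm (Eventually.of_forall hb)
  have hval : cauchyInt g w = - (d ^ 3 * ∫ x, g x / ((a - x) ^ 3 * (w - x))) := by
    unfold cauchyInt
    simp_rw [hexp]
    have i2 := (hint 2).const_mul d
    have i3 := (hint 3).const_mul (d ^ 2)
    have i12 : Integrable fun x => g x / (a - x) ^ 1 - d * (g x / (a - x) ^ 2) := (hint 1).sub i2
    have i123 : Integrable fun x => g x / (a - x) ^ 1 - d * (g x / (a - x) ^ 2) +
      d ^ 2 * (g x / (a - x) ^ 3) := i12.add i3
    rw [integral_sub i123 (hrem.const_mul _), integral_add i12 i3,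
      integral_sub (hint 1) i2, integral_const_mul, integral_const_mul,
      integral_const_mul, h 1 (by simp), h 2 (by simp), h 3 (by simp)]
    ring
  rw [hval, norm_neg, norm_mul, norm_pow, mul_comm]
  gcongr
  calc _ ≤ ∫ x, ‖g x‖ * ((r ^ 3)⁻¹ * (r / 2)⁻¹) :=
        norm_integral_le_of_norm_le hbi (Eventually.of_forall hb)
    _ = _ := integral_mul_const _ _

/-- A Cauchy transform vanishing on a closed set which carries the density vanishes identically,
by the maximum principle off that set. -/
lemma cauchyInt_eq_zero_of_eqOn (hg : IsBoundedDensity g M R) {K : Set ℂ} (hK : IsClosed K)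
    (hgK : ∀ x ∉ K, g x = 0) (h : ∀ z ∈ K, cauchyInt g z = 0) (z : ℂ) : cauchyInt g z = 0 := by
  by_contra hz
  set δ := ‖cauchyInt g z‖ with hδ
  have hδ0 : 0 < δ := norm_pos_iff.2 hz
  have hsmall : ∀ᶠ w in cocompact ℂ, ‖cauchyInt g w‖ < δ / 2 := by
    have := hg.tendsto_cauchyInt.norm
    rw [norm_zero] at this
    exact this.eventually_lt_const (by positivity)
  rw [← Metric.cobounded_eq_cocompact, ← comap_norm_atTop, eventually_comap] at hsmall
  obtain ⟨T, hT⟩ := (hsmall.and (eventually_gt_atTop 0)).exists_forall_of_atTop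
  have hTs : ∀ w, T ≤ ‖w‖ → ‖cauchyInt g w‖ < δ / 2 := fun w hw => (hT _ hw).1 w rfl
  set U := Metric.ball (0 : ℂ) T ∩ Kᶜ with hU
  have hUo : IsOpen U := Metric.isOpen_ball.inter hK.isOpen_compl
  have hzU : z ∈ U := by
    refine ⟨?_, fun hzK => hz (h z hzK)⟩
    by_contra hzT
    have := hTs z (by simpa using hzT)
    linarith
  have hdiff : DiffContOnCl ℂ (cauchyInt g) U := by
    refine ⟨fun w hw => ?_, hg.continuous_cauchyInt.continuousOn⟩
    obtain ⟨r, hr, hball⟩ := Metric.isOpen_iff.1 hK.isOpen_compl w hw.2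
    exact (hg.differentiableAt_cauchyInt hr fun x hx => hgK x (hball hx)).differentiableWithinAt
  have := Complex.norm_le_of_forall_mem_frontier_norm_le
    (Metric.isBounded_ball.subset Set.inter_subset_left) hdiff (C := δ / 2) (fun w hw => ?_)
    (subset_closure hzU)
  · linarith
  · have hwU : w ∉ U := by
      rw [frontier, hUo.interior_eq] at hw
      exact hw.2
    by_cases hwK : w ∈ K
    · rw [h w hwK, norm_zero]; positivity
    · refine (hTs w ?_).le
      by_contra hlt
      exact hwU ⟨by simpa using hlt, hwK⟩

end IsBoundedDensity

/-! ### Algebra of rational maps and their local behaviour -/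

/-- A bivariate polynomial vanishing on the diagonal is divisible by the difference of the
variables, and the quotient restricts on the diagonal to the derivative. -/
lemma Polynomial.exists_evalEval_eq_sub_mul (T : ℂ[X][X]) (hT : T.eval X = 0) :
    ∃ S : ℂ[X][X], (∀ x z, T.evalEval x z = (z - x) * S.evalEval x z) ∧
      S.eval X = T.derivative.eval X := by
  obtain ⟨S, rfl⟩ := Polynomial.dvd_iff_isRoot.2 (show T.IsRoot X from hT)
  refine ⟨S, fun x z => ?_, ?_⟩
  · simp [Polynomial.evalEval]
  · simp

lemma Polynomial.evalEval_eq_sum (T : ℂ[X][X]) (x z : ℂ) :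
    T.evalEval x z = ∑ i ∈ Finset.range (T.natDegree + 1), (T.coeff i).eval x * z ^ i := by
  rw [Polynomial.evalEval, Polynomial.eval_eq_sum_range (p := T), Polynomial.eval_finsetSum]
  simp

lemma Polynomial.continuous_evalEval_uncurry (T : ℂ[X][X]) :
    Continuous fun p : ℂ × ℂ => T.evalEval p.1 p.2 := by
  simp_rw [Polynomial.evalEval_eq_sum]
  refine continuous_finsetSum _ fun i _ => ?_
  exact ((T.coeff i).continuous.comp continuous_fst).mul (continuous_snd.pow i)

lemma Polynomial.differentiable_evalEval (T : ℂ[X][X]) (x : ℂ) :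
    Differentiable ℂ fun z => T.evalEval x z := by
  simp_rw [Polynomial.evalEval_eq_sum]
  fun_prop

lemma Polynomial.continuous_evalEval_left (T : ℂ[X][X]) (z : ℂ) :
    Continuous fun x => T.evalEval x z := by
  simp_rw [Polynomial.evalEval_eq_sum]
  fun_prop

lemma Polynomial.evalEval_diag (T : ℂ[X][X]) (x : ℂ) : T.evalEval x x = (T.eval X).eval x := by
  rw [Polynomial.evalEval_eq_sum, Polynomial.eval_eq_sum_range (p := T), Polynomial.eval_finsetSum]
  simp

/-- Near a point `b`, a nonconstant analytic function `φ` satisfies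
`|φ - φ(b)| ^ α ≤ C |φ'|` for some `α < 1`, namely `α = (n - 1) / n` where `n` is the local degree. -/
lemma AnalyticAt.exists_norm_sub_rpow_le_deriv {φ : ℂ → ℂ} {b : ℂ} (hφ : AnalyticAt ℂ φ b)
    (hne : ¬ ∀ᶠ z in 𝓝 b, φ z = φ b) :
    ∃ α : ℝ, 0 ≤ α ∧ α < 1 ∧ ∃ C, 0 ≤ C ∧
      ∀ᶠ z in 𝓝 b, ‖φ z - φ b‖ ^ α ≤ C * ‖deriv φ z‖ := by
  have hψ : AnalyticAt ℂ (fun z => φ z - φ b) b := hφ.sub analyticAt_const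
  obtain ⟨n, g, hg, hg0, hgn⟩ := hψ.exists_eventuallyEq_pow_smul_nonzero_iff.2
    (by simpa only [sub_eq_zero] using hne)
  obtain _ | m := n
  · have := hgn.self_of_nhds
    simp only [sub_self, pow_zero, one_smul] at this
    exact absurd this.symm hg0
  set k : ℂ → ℂ := fun z => (m + 1 : ℂ) * g z + (z - b) * deriv g z with hk
  have hkc : ContinuousAt k b := by
    have := hg.deriv.continuousAt
    have := hg.continuousAt
    fun_prop
  have hkb : k b = (m + 1 : ℂ) * g b := by simp [hk]
  have hkb0 : 0 < ‖k b‖ := by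
    rw [hkb]
    exact norm_pos_iff.2 (mul_ne_zero (by exact_mod_cast m.succ_ne_zero) hg0)
  have hderiv : ∀ᶠ z in 𝓝 b, deriv φ z = (z - b) ^ m * k z := by
    filter_upwards [hgn.eventually_nhds, hg.eventually_analyticAt] with z hz hgz
    have e : φ =ᶠ[𝓝 z] fun w => (w - b) ^ (m + 1) * g w + φ b := by
      filter_upwards [hz] with w hw
      rw [← smul_eq_mul, ← hw]; ring
    rw [e.deriv_eq]
    have h1 : HasDerivAt (fun w : ℂ => (w - b) ^ (m + 1)) ((m + 1 : ℕ) * (z - b) ^ m) z := by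
      simpa using ((hasDerivAt_id z).sub_const b).fun_pow (m + 1)
    have h2 := (h1.mul hgz.differentiableAt.hasDerivAt).add_const (φ b)
    have h3 := h2.deriv
    simp only [Pi.mul_def] at h3
    rw [h3, hk]
    push_cast
    ring
  have hm1 : (0 : ℝ) < m + 1 := by positivity
  refine ⟨m / (m + 1), by positivity, by rw [div_lt_one hm1]; linarith,
    (‖g b‖ + 1) ^ ((m : ℝ) / (m + 1)) / (‖k b‖ / 2), by positivity, ?_⟩
  have hgle : ∀ᶠ z in 𝓝 b, ‖g z‖ < ‖g b‖ + 1 :=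
    hg.continuousAt.norm.eventually_lt_const (by linarith)
  have hkge : ∀ᶠ z in 𝓝 b, ‖k b‖ / 2 < ‖k z‖ :=
    hkc.norm.eventually_const_lt (by linarith)
  filter_upwards [hgn, hderiv, hgle, hkge] with z h1 h2 h3 h4
  rw [h1, h2, smul_eq_mul, norm_mul, norm_mul, norm_pow, norm_pow,
    Real.mul_rpow (by positivity) (by positivity), ← Real.rpow_natCast ‖z - b‖ (m + 1),
    ← Real.rpow_mul (norm_nonneg _), Nat.cast_add_one, mul_div_cancel₀ _ hm1.ne',
    Real.rpow_natCast]
  calc ‖z - b‖ ^ m * ‖g z‖ ^ ((m : ℝ) / (m + 1))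
      ≤ ‖z - b‖ ^ m * (‖g b‖ + 1) ^ ((m : ℝ) / (m + 1)) := by gcongr
    _ = (‖g b‖ + 1) ^ ((m : ℝ) / (m + 1)) / (‖k b‖ / 2) * (‖z - b‖ ^ m * (‖k b‖ / 2)) := by
        field_simp
    _ ≤ _ := by gcongr

namespace RationalMap

/-- The Wronskian of the numerator and denominator of `f`; the derivative of `f` is its quotient
by the square of the denominator. -/
noncomputable def wronskian (f : RationalMap) : ℂ[X] :=
  f.toRatFunc.num.derivative * f.toRatFunc.denom - f.toRatFunc.num * f.toRatFunc.denom.derivative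

variable (f : RationalMap)

lemma wronskian_ne_zero' : f.wronskian ≠ 0 := f.wronskian_ne_zero

lemma hasDerivAt_val' {z : ℂ} (hz : ¬ f.IsPole z) :
    HasDerivAt f.val (f.wronskian.eval z / f.toRatFunc.denom.eval z ^ 2) z := by
  have := f.hasDerivAt_val hz
  simpa only [wronskian, eval_sub, eval_mul] using this

lemma deriv_val {z : ℂ} (hz : ¬ f.IsPole z) :
    deriv f.val z = f.wronskian.eval z / f.toRatFunc.denom.eval z ^ 2 := (f.hasDerivAt_val' hz).deriv

lemma deriv_val_eq_zero_iff {z : ℂ} (hz : ¬ f.IsPole z) :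
    deriv f.val z = 0 ↔ f.wronskian.eval z = 0 := by
  rw [f.deriv_val hz, div_eq_zero_iff, or_iff_left (pow_ne_zero 2 hz)]

lemma _root_.Polynomial.eventually_eval_ne_zero {p : ℂ[X]} (hp : p ≠ 0) (b : ℂ) : ∀ᶠ z in 𝓝[≠] b, p.eval z ≠ 0 := by
  have hfin : {z | p.IsRoot z}.Finite := Polynomial.finite_setOfPred_isRoot hp
  have := (hfin.subset (Set.sdiff_subset (t := {b}))).isClosed.isOpen_compl.mem_nhds
    (x := b) (by simp)
  filter_upwards [mem_nhdsWithin_of_mem_nhds this, self_mem_nhdsWithin] with z hz hzb h0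
  exact hz ⟨h0, hzb⟩

/-- The points where `f` is not locally injective, together with the poles, form a finite set. -/
lemma finite_bad : {z | f.IsPole z ∨ f.wronskian.eval z = 0}.Finite := by
  refine (Polynomial.finite_setOfPred_isRoot (mul_ne_zero f.denom_ne_zero f.wronskian_ne_zero')).subset
    fun z hz => ?_
  simpa [IsPole] using hz

lemma isOpen_not_isPole : IsOpen {z | ¬ f.IsPole z} :=
  isOpen_ne_fun f.toRatFunc.denom.continuous continuous_const

lemma analyticAt_val {z : ℂ} (hz : ¬ f.IsPole z) : AnalyticAt ℂ f.val z := by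
  rw [Complex.analyticAt_iff_eventually_differentiableAt]
  filter_upwards [f.isOpen_not_isPole.mem_nhds hz] with w hw
  exact (f.hasDerivAt_val' hw).differentiableAt

lemma not_eventually_val_eq {z : ℂ} (hz : ¬ f.IsPole z) (c : ℂ) :
    ¬ ∀ᶠ w in 𝓝 z, f.val w = c := by
  intro h
  have h1 : ∀ᶠ w in 𝓝[≠] z, f.wronskian.eval w = 0 := by
    have h2 : ∀ᶠ w in 𝓝 z, (∀ᶠ y in 𝓝 w, f.val y = c) ∧ ¬ f.IsPole w :=
      h.eventually_nhds.and (f.isOpen_not_isPole.mem_nhds hz)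
    filter_upwards [h2.filter_mono nhdsWithin_le_nhds] with w hw
    rw [← f.deriv_val_eq_zero_iff hw.2]
    have : f.val =ᶠ[𝓝 w] fun _ => c := hw.1
    rw [this.deriv_eq, deriv_const]
  obtain ⟨w, h1, h2⟩ := (h1.and (eventually_eval_ne_zero f.wronskian_ne_zero' z)).exists
  exact h2 h1

lemma num_ne_zero_of_isPole {z : ℂ} (hz : f.IsPole z) : f.toRatFunc.num.eval z ≠ 0 := by
  intro h
  obtain ⟨a, b, hab⟩ := f.toRatFunc.isCoprime_num_denom
  have := congrArg (Polynomial.eval z) hab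
  simp only [eval_add, eval_mul, h, show f.toRatFunc.denom.eval z = 0 from hz] at this
  simp at this

/-- The function `1 / f`, analytic at the poles of `f`. -/
noncomputable def invVal (z : ℂ) : ℂ := f.toRatFunc.denom.eval z / f.toRatFunc.num.eval z

lemma hasDerivAt_invVal {z : ℂ} (hz : f.toRatFunc.num.eval z ≠ 0) :
    HasDerivAt f.invVal (-(f.wronskian.eval z / f.toRatFunc.num.eval z ^ 2)) z := by
  refine ((f.toRatFunc.denom.hasDerivAt z).div (f.toRatFunc.num.hasDerivAt z) hz).congr_deriv ?_
  simp only [wronskian, eval_sub, eval_mul]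
  ring

lemma analyticAt_invVal {z : ℂ} (hz : f.toRatFunc.num.eval z ≠ 0) : AnalyticAt ℂ f.invVal z := by
  rw [Complex.analyticAt_iff_eventually_differentiableAt]
  have : IsOpen {z | f.toRatFunc.num.eval z ≠ 0} :=
    isOpen_ne_fun f.toRatFunc.num.continuous continuous_const
  filter_upwards [this.mem_nhds hz] with w hw
  exact (f.hasDerivAt_invVal hw).differentiableAt

lemma not_eventually_invVal_eq {z : ℂ} (hz : f.IsPole z) :
    ¬ ∀ᶠ w in 𝓝 z, f.invVal w = f.invVal z := by
  intro h
  have h0 : f.invVal z = 0 := by rw [invVal, show f.toRatFunc.denom.eval z = 0 from hz, zero_div]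
  have hnum : ∀ᶠ w in 𝓝 z, f.toRatFunc.num.eval w ≠ 0 :=
    f.toRatFunc.num.continuous.continuousAt.eventually_ne (f.num_ne_zero_of_isPole hz)
  obtain ⟨w, ⟨h1, h3⟩, h2⟩ := (((h.and hnum).filter_mono nhdsWithin_le_nhds).and
    (eventually_eval_ne_zero f.denom_ne_zero z)).exists
  rw [h0, invVal] at h1
  exact div_ne_zero h2 h3 h1

/-- At a pole `b` of `f`, the quantity `|f'|` dominates a power of `|f|` greater than one. -/
lemma exists_norm_invVal_rpow_le {b : ℂ} (hb : f.IsPole b) :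
    ∃ α : ℝ, 0 ≤ α ∧ α < 1 ∧ ∃ C, 0 ≤ C ∧
      ∀ᶠ z in 𝓝 b, ‖f.invVal z‖ ^ α ≤ C * ‖deriv f.invVal z‖ := by
  have h := (f.analyticAt_invVal (f.num_ne_zero_of_isPole hb)).exists_norm_sub_rpow_le_deriv
    (f.not_eventually_invVal_eq hb)
  have h0 : f.invVal b = 0 := by rw [invVal, show f.toRatFunc.denom.eval b = 0 from hb, zero_div]
  simpa only [h0, sub_zero] using h

lemma factor_mul_norm_sq {z : ℂ} (hz : deriv f.val z ≠ 0) :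
    f.factor z * (deriv f.val z) ^ 2 = (‖deriv f.val z‖ : ℂ) ^ 2 := by
  rw [factor, div_mul_cancel₀ _ (pow_ne_zero 2 hz)]

/-- Subtracting the singularities of `f'(x)² / (f(z) - f(x))` and `f'(z) / (z - x)` leaves a
rational kernel without pole on the diagonal. -/
lemma exists_kernel : ∃ U S : ℂ[X][X],
    (∀ x, U.evalEval x x = f.wronskian.eval x) ∧
    (∀ x z, ¬ f.IsPole x → ¬ f.IsPole z → f.val z - f.val x =
      (z - x) * (U.evalEval x z / (f.toRatFunc.denom.eval x * f.toRatFunc.denom.eval z))) ∧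
    ∀ x z, ¬ f.IsPole x → ¬ f.IsPole z → x ≠ z → U.evalEval x z ≠ 0 →
      deriv f.val x ^ 2 / (f.val z - f.val x) = S.evalEval x z /
        (f.toRatFunc.denom.eval x ^ 3 * f.toRatFunc.denom.eval z ^ 2 * U.evalEval x z) +
        deriv f.val z / (z - x) := by
  set P := f.toRatFunc.num with hP
  set Q := f.toRatFunc.denom with hQ
  set W := f.wronskian with hW
  obtain ⟨U, hU, hUd⟩ := Polynomial.exists_evalEval_eq_sub_mul
    (P.map C * C Q - C P * Q.map C) (by simp [Polynomial.eval_map, Polynomial.eval₂_C_X, mul_comm])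
  have hUX : U.eval X = W := by
    rw [hUd]
    simp [Polynomial.eval_map, Polynomial.eval₂_C_X, Polynomial.derivative_map, hW, wronskian,
      ← hP, ← hQ]
  obtain ⟨S, hS, -⟩ := Polynomial.exists_evalEval_eq_sub_mul
    (C (W ^ 2) * (Q.map C) ^ 3 - W.map C * U * C (Q ^ 3))
    (by simp [Polynomial.eval_map, Polynomial.eval₂_C_X, hUX]; ring)
  have hev : ∀ (p : ℂ[X]) (x z : ℂ), (p.map C).evalEval x z = p.eval z := fun p x z =>
    evalEval_map_C x z p
  have hsub : ∀ x z, ¬ f.IsPole x → ¬ f.IsPole z → f.val z - f.val x =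
      (z - x) * (U.evalEval x z / (Q.eval x * Q.eval z)) := by
    intro x z hx hz
    have h := hU x z
    simp only [evalEval_sub, evalEval_mul, hev, evalEval_C] at h
    have hx' : Q.eval x ≠ 0 := hx
    have hz' : Q.eval z ≠ 0 := hz
    rw [← mul_div_assoc, ← h, val, val, ← hP, ← hQ]
    field_simp
  refine ⟨U, S, fun x => by rw [Polynomial.evalEval_diag, hUX], hsub, fun x z hx hz hxz hUn => ?_⟩
  have h := hS x z
  simp only [evalEval_sub, evalEval_mul, evalEval_pow, hev, evalEval_C, eval_pow] at h
  have hx' : Q.eval x ≠ 0 := hx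
  have hz' : Q.eval z ≠ 0 := hz
  have hzx : z - x ≠ 0 := sub_ne_zero.2 hxz.symm
  rw [hsub x z hx hz, f.deriv_val hx, f.deriv_val hz, ← hW, ← hQ]
  field_simp
  linear_combination h

end RationalMap

/-! ### The invariant vector field attached to an invariant density -/

namespace IsBoundedDensity

variable {g : ℂ → ℂ} {M R : ℝ}

lemma cauchyInt_indicator_add_compl (hg : IsBoundedDensity g M R) {s : Set ℂ}
    (hs : MeasurableSet s) (z : ℂ) :
    cauchyInt g z = cauchyInt (s.indicator g) z + cauchyInt (sᶜ.indicator g) z := by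
  unfold cauchyInt
  rw [← integral_add ((hg.indicator hs).integrable_div z) ((hg.indicator hs.compl).integrable_div z)]
  congr 1
  ext x
  rw [← add_div, ← Pi.add_apply, Set.indicator_self_add_compl]

lemma cauchyInt_indicator {s : Set ℂ} (hs : MeasurableSet s) (z : ℂ) :
    cauchyInt (s.indicator g) z = ∫ x in s, g x / (z - x) := by
  unfold cauchyInt
  rw [← integral_indicator hs]
  congr 1
  ext x
  by_cases hx : x ∈ s <;> simp [hx]

end IsBoundedDensity

lemma abs_det_restrictScalars_toSpanSingleton (c : ℂ) :
    |((ContinuousLinearMap.toSpanSingleton ℂ c).restrictScalars ℝ : ℂ →L[ℝ] ℂ).det| = ‖c‖ ^ 2 := by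
  have h : ((ContinuousLinearMap.toSpanSingleton ℂ c).restrictScalars ℝ : ℂ →L[ℝ] ℂ).det =
      ‖c‖ ^ 2 := by
    rw [ContinuousLinearMap.det]
    rw [← LinearMap.det_toMatrix Complex.basisOneI, Matrix.det_fin_two]
    simp [LinearMap.toMatrix_apply, Complex.coe_basisOneI, ← Complex.normSq_eq_norm_sq,
      Complex.normSq_apply]
  rw [h, abs_of_nonneg (by positivity)]

namespace RationalMap

variable (f : RationalMap) {g : ℂ → ℂ} {M R : ℝ}

/-- Near a point of local injectivity of `f`, the kernels `f'(x)² / (f(z) - f(x))` and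
`f'(z) / (z - x)` differ by a bounded kernel which is holomorphic in `z`. -/
lemma exists_local_kernel {z₀ : ℂ} (hz₀ : ¬ f.IsPole z₀) (hW : f.wronskian.eval z₀ ≠ 0) :
    ∃ r > 0, ∃ (k : ℂ → ℂ → ℂ) (C : ℝ), Set.InjOn f.val (Metric.ball z₀ r) ∧
      (∀ x ∈ Metric.ball z₀ r, ¬ f.IsPole x ∧ deriv f.val x ≠ 0) ∧
      (∀ z, Measurable fun x => k x z) ∧
      (∀ x ∈ Metric.ball z₀ r, DifferentiableOn ℂ (k x) (Metric.ball z₀ r)) ∧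
      (∀ x ∈ Metric.ball z₀ r, ∀ z ∈ Metric.ball z₀ r, ‖k x z‖ ≤ C) ∧
      ∀ x ∈ Metric.ball z₀ r, ∀ z ∈ Metric.ball z₀ r, x ≠ z →
        deriv f.val x ^ 2 / (f.val z - f.val x) = k x z + deriv f.val z / (z - x) := by
  obtain ⟨U, S, hUd, hU, hK⟩ := f.exists_kernel
  set Q := f.toRatFunc.denom with hQ
  set k : ℂ × ℂ → ℂ := fun p =>
    S.evalEval p.1 p.2 / (Q.eval p.1 ^ 3 * Q.eval p.2 ^ 2 * U.evalEval p.1 p.2) with hk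
  have hUc := U.continuous_evalEval_uncurry
  have hQ1 : Continuous fun p : ℂ × ℂ => Q.eval p.1 := Q.continuous.comp continuous_fst
  have hQ2 : Continuous fun p : ℂ × ℂ => Q.eval p.2 := Q.continuous.comp continuous_snd
  have hden0 : Q.eval z₀ ^ 3 * Q.eval z₀ ^ 2 * U.evalEval z₀ z₀ ≠ 0 := by
    rw [hUd]
    exact mul_ne_zero (mul_ne_zero (pow_ne_zero _ hz₀) (pow_ne_zero _ hz₀)) hW
  have hkc : ContinuousAt k (z₀, z₀) :=
    S.continuous_evalEval_uncurry.continuousAt.div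
      (((hQ1.pow 3).mul (hQ2.pow 2)).mul hUc).continuousAt hden0
  have hev : ∀ᶠ p : ℂ × ℂ in 𝓝 (z₀, z₀), ¬ f.IsPole p.1 ∧ ¬ f.IsPole p.2 ∧
      U.evalEval p.1 p.2 ≠ 0 ∧ f.wronskian.eval p.1 ≠ 0 ∧ ‖k p‖ ≤ ‖k (z₀, z₀)‖ + 1 := by
    have e1 : ∀ᶠ p : ℂ × ℂ in 𝓝 (z₀, z₀), Q.eval p.1 ≠ 0 :=
      hQ1.continuousAt.eventually_ne (by exact hz₀)
    have e2 : ∀ᶠ p : ℂ × ℂ in 𝓝 (z₀, z₀), Q.eval p.2 ≠ 0 :=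
      hQ2.continuousAt.eventually_ne (by exact hz₀)
    have e3 : ∀ᶠ p : ℂ × ℂ in 𝓝 (z₀, z₀), f.wronskian.eval p.1 ≠ 0 :=
      (f.wronskian.continuous.comp continuous_fst).continuousAt.eventually_ne (by exact hW)
    refine e1.and (e2.and ((hUc.continuousAt.eventually_ne (by rwa [hUd])).and (e3.and ?_)))
    filter_upwards [hkc.norm.eventually_lt_const (lt_add_one _)] with p hp using hp.le
  rw [nhds_prod_eq] at hev
  obtain ⟨t, ht, hev⟩ := mem_prod_same_iff.1 hev
  obtain ⟨r, hr, hrt⟩ := Metric.mem_nhds_iff.1 ht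
  have hD' : ∀ x ∈ Metric.ball z₀ r, ∀ z ∈ Metric.ball z₀ r, ¬ f.IsPole x ∧ ¬ f.IsPole z ∧
      U.evalEval x z ≠ 0 ∧ f.wronskian.eval x ≠ 0 ∧ ‖k (x, z)‖ ≤ ‖k (z₀, z₀)‖ + 1 :=
    fun x hx z hz => hev (Set.mk_mem_prod (hrt hx) (hrt hz))
  refine ⟨r, hr, fun x z => k (x, z), ‖k (z₀, z₀)‖ + 1, ?_, ?_, ?_, ?_, ?_, ?_⟩
  · intro x hx z hz hxz
    obtain ⟨h1, h2, h3, -⟩ := hD' x hx z hz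
    have h := hU x z h1 h2
    rw [hxz, sub_self, eq_comm, mul_eq_zero, sub_eq_zero] at h
    exact (h.resolve_right (div_ne_zero h3 (mul_ne_zero h1 h2))).symm
  · intro x hx
    obtain ⟨h1, -, -, h4, -⟩ := hD' x hx x hx
    exact ⟨h1, fun h => h4 ((f.deriv_val_eq_zero_iff h1).1 h)⟩
  · intro z
    have h1 := (S.continuous_evalEval_left z).measurable
    have h2 : Continuous fun x => Q.eval x ^ 3 * Q.eval z ^ 2 * U.evalEval x z :=
      ((Q.continuous.pow 3).mul continuous_const).mul (U.continuous_evalEval_left z)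
    exact h1.div h2.measurable
  · intro x hx z hz
    obtain ⟨h1, h2, h3, -⟩ := hD' x hx z hz
    refine DifferentiableAt.differentiableWithinAt (((S.differentiable_evalEval x) z).div ?_ ?_)
    · exact ((differentiableAt_const (Q.eval x ^ 3)).fun_mul (Q.differentiableAt.fun_pow 2)).fun_mul
        ((U.differentiable_evalEval x) z)
    · exact mul_ne_zero (mul_ne_zero (pow_ne_zero _ h1) (pow_ne_zero _ h2)) h3
  · exact fun x hx z hz => (hD' x hx z hz).2.2.2.2
  · intro x hx z hz hxz
    obtain ⟨h1, h2, h3, -⟩ := hD' x hx z hz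
    exact hK x z h1 h2 hxz h3

/-- Around a point of local injectivity, if `g` is invariant then `ν̂ ∘ f` and `f' ν̂`, where `ν̂` is
the Cauchy transform of `g`, have the same singular part: the change of variables `y = f(x)` turns
the kernel `1 / (f(z) - y)` into `f'(x)² / (f(z) - f(x))`, which differs from `f'(z) / (z - x)` by a
kernel holomorphic in `z`. -/
lemma differentiableAt_cauchyInt_comp_sub (hg : IsBoundedDensity g M R)
    (hinv : ∀ᵐ x, g (f.val x) * f.factor x = g x) {z₀ : ℂ} (hz₀ : ¬ f.IsPole z₀)
    (hW : f.wronskian.eval z₀ ≠ 0) :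
    DifferentiableAt ℂ (fun z => cauchyInt g (f.val z) / deriv f.val z - cauchyInt g z) z₀ := by
  obtain ⟨r, hr, k, C, hinj, hreg, hkm, hkd, hkb, hK⟩ := f.exists_local_kernel hz₀ hW
  set D := Metric.ball z₀ r with hD
  have hDm : MeasurableSet D := measurableSet_ball
  have hz₀D : z₀ ∈ D := Metric.mem_ball_self hr
  have hderiv : ∀ x ∈ D, HasDerivAt f.val (deriv f.val x) x := fun x hx =>
    (f.hasDerivAt_val' (hreg x hx).1).differentiableAt.hasDerivAt
  have hderiv0 : ∀ x ∈ D, deriv f.val x ≠ 0 := fun x hx => (hreg x hx).2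
  have hcont : ContinuousOn f.val D := fun x hx => (hderiv x hx).continuousAt.continuousWithinAt
  set E := f.val '' D with hE
  have hEm : MeasurableSet E := hDm.image_of_continuousOn_injOn hcont hinj
  have hEn : E ∈ 𝓝 (f.val z₀) := by
    have h := ((f.analyticAt_val hz₀).eventually_constant_or_nhds_le_map_nhds).resolve_left
      (f.not_eventually_val_eq hz₀ _)
    exact h (image_mem_map (Metric.ball_mem_nhds z₀ hr))
  obtain ⟨ε, hε, hεE⟩ := Metric.mem_nhds_iff.1 hEn
  -- the contribution of the regular kernel
  set H : ℂ → ℂ := fun z => ∫ x in D, g x * k x z with hH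
  have hgD : IntegrableOn g D := hg.integrable.integrableOn
  have hkint : ∀ z ∈ D, IntegrableOn (fun x => g x * k x z) D := by
    intro z hz
    refine Integrable.mono' (hgD.norm.mul_const (C))
      (hgD.aestronglyMeasurable.mul (hkm z).aestronglyMeasurable) ?_
    filter_upwards [ae_restrict_mem hDm] with x hx
    rw [norm_mul]
    gcongr
    exact hkb x hx z hz
  have hHd : DifferentiableAt ℂ H z₀ := by
    refine differentiableAt_integral_of_norm_le hr
      (b := fun x => ‖g x‖ * (C)) (fun z hz => (hkint z hz).aestronglyMeasurable)
      ?_ ?_ (hgD.norm.mul_const _)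
    · filter_upwards [ae_restrict_mem hDm] with x hx z hz
      exact (differentiableWithinAt_const _).mul (hkd x hx z hz)
    · filter_upwards [ae_restrict_mem hDm] with x hx z hz
      rw [norm_mul]
      gcongr
      exact hkb x hx z hz
  have hchange : ∀ z ∈ D, cauchyInt (E.indicator g) (f.val z) =
      H z + deriv f.val z * cauchyInt (D.indicator g) z := by
    intro z hz
    rw [IsBoundedDensity.cauchyInt_indicator hEm, IsBoundedDensity.cauchyInt_indicator hDm,
      integral_image_eq_integral_abs_det_fderiv_smul volume hDm
        (fun x hx => ((hderiv x hx).hasFDerivAt.restrictScalars ℝ).hasFDerivWithinAt) hinj,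
      ← integral_const_mul, ← integral_add (hkint z hz)
        ((hg.integrable_div z).integrableOn.const_mul _)]
    refine integral_congr_ae ?_
    have hne : ∀ᵐ x : ℂ ∂volume.restrict D, x ≠ z :=
      ae_restrict_of_ae (by simp [ae_iff, measure_singleton])
    filter_upwards [ae_restrict_mem hDm, ae_restrict_of_ae hinv, hne] with x hx hxinv hxz
    have e := hK x hx z hz hxz
    rw [abs_det_restrictScalars_toSpanSingleton, Complex.real_smul]
    push_cast
    rw [← f.factor_mul_norm_sq (hderiv0 x hx)]
    calc f.factor x * deriv f.val x ^ 2 * (g (f.val x) / (f.val z - f.val x))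
        = (g (f.val x) * f.factor x) * (deriv f.val x ^ 2 / (f.val z - f.val x)) := by ring
      _ = g x * (k x z + deriv f.val z / (z - x)) := by rw [hxinv, e]
      _ = _ := by ring
  have hEc : DifferentiableAt ℂ (cauchyInt (Eᶜ.indicator g)) (f.val z₀) :=
    (hg.indicator hEm.compl).differentiableAt_cauchyInt hε fun x hx => by
      simp [hεE hx]
  have hDc : DifferentiableAt ℂ (cauchyInt (Dᶜ.indicator g)) z₀ :=
    (hg.indicator hDm.compl).differentiableAt_cauchyInt hr fun x hx => by
      rw [← hD] at hx
      simp [hx]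
  have hfd : DifferentiableAt ℂ f.val z₀ := (hderiv z₀ hz₀D).differentiableAt
  have hcomp : DifferentiableAt ℂ (fun z => cauchyInt (Eᶜ.indicator g) (f.val z)) z₀ :=
    DifferentiableAt.comp (g := cauchyInt (Eᶜ.indicator g)) z₀ hEc hfd
  have hd' : DifferentiableAt ℂ (deriv f.val) z₀ := (f.analyticAt_val hz₀).deriv.differentiableAt
  have hmain : DifferentiableAt ℂ (fun z => (H z + cauchyInt (Eᶜ.indicator g) (f.val z)) /
      deriv f.val z - cauchyInt (Dᶜ.indicator g) z) z₀ :=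
    ((hHd.add hcomp).div hd' (hderiv0 z₀ hz₀D)).sub hDc
  refine hmain.congr_of_eventuallyEq ?_
  filter_upwards [Metric.ball_mem_nhds z₀ hr] with z hz
  rw [hg.cauchyInt_indicator_add_compl hEm, hg.cauchyInt_indicator_add_compl hDm z, hchange z hz]
  have := hderiv0 z hz
  field_simp
  ring

/-- Near a critical point, Hölder continuity with exponent `(n - 1) / n`, `n` being the local degree,
compensates for the zero of `f'`. -/
lemma exists_norm_div_deriv_le_of_not_isPole (hg : IsBoundedDensity g M R) {b : ℂ}
    (hb : ¬ f.IsPole b) (h0 : cauchyInt g (f.val b) = 0) :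
    ∃ C, ∀ᶠ z in 𝓝 b, ‖cauchyInt g (f.val z) / deriv f.val z‖ ≤ C := by
  obtain ⟨α, hα0, hα1, C, hC0, hC⟩ := (f.analyticAt_val hb).exists_norm_sub_rpow_le_deriv
    (f.not_eventually_val_eq hb _)
  obtain ⟨C', hC'⟩ := hg.exists_holder hα0 hα1
  have hC'0 : 0 ≤ C' := by
    have := (norm_nonneg _).trans (hC' 1 0)
    simpa using this
  refine ⟨C' * C, ?_⟩
  filter_upwards [hC] with z hz
  by_cases hd : deriv f.val z = 0
  · simp only [hd, div_zero, norm_zero]; positivity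
  rw [norm_div, div_le_iff₀ (norm_pos_iff.2 hd)]
  calc ‖cauchyInt g (f.val z)‖ = ‖cauchyInt g (f.val z) - cauchyInt g (f.val b)‖ := by
        rw [h0, sub_zero]
    _ ≤ C' * ‖f.val z - f.val b‖ ^ α := hC' _ _
    _ ≤ C' * (C * ‖deriv f.val z‖) := by gcongr
    _ = _ := by ring

lemma deriv_invVal_eq {z : ℂ} (hz : ¬ f.IsPole z) (hn : f.toRatFunc.num.eval z ≠ 0) :
    deriv f.invVal z = - (deriv f.val z * f.invVal z ^ 2) := by
  have hz' : f.toRatFunc.denom.eval z ≠ 0 := hz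
  rw [(f.hasDerivAt_invVal hn).deriv, f.deriv_val hz, invVal]
  field_simp

lemma exists_norm_div_deriv_le_of_isPole (hg : IsBoundedDensity g M R) {b : ℂ}
    (hb : f.IsPole b) :
    ∃ C, ∀ᶠ z in 𝓝[≠] b, ‖cauchyInt g (f.val z) / deriv f.val z‖ ≤ C := by
  obtain ⟨α, hα0, hα1, C, hC0, hC⟩ := f.exists_norm_invVal_rpow_le hb
  obtain ⟨C', hC'⟩ := hg.exists_norm_cauchyInt_le
  have hC'0 : 0 ≤ C' := (norm_nonneg _).trans (hC' 0)
  have hnb := f.num_ne_zero_of_isPole hb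
  have hnum : ∀ᶠ w in 𝓝 b, f.toRatFunc.num.eval w ≠ 0 :=
    f.toRatFunc.num.continuous.continuousAt.eventually_ne hnb
  have hlt : ∀ᶠ z in 𝓝 b, ‖f.invVal z‖ < 1 := by
    refine (f.analyticAt_invVal hnb).continuousAt.norm.eventually_lt_const ?_
    simp [invVal, show f.toRatFunc.denom.eval b = 0 from hb]
  refine ⟨C' * C, ?_⟩
  filter_upwards [(hC.and (hnum.and hlt)).filter_mono nhdsWithin_le_nhds,
    eventually_eval_ne_zero f.denom_ne_zero b] with z ⟨h1, h2, h3⟩ h4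
  by_cases hd : deriv f.val z = 0
  · simp only [hd, div_zero, norm_zero]; positivity
  have hi : 0 < ‖f.invVal z‖ := norm_pos_iff.2 (div_ne_zero h4 h2)
  rw [norm_div, div_le_iff₀ (norm_pos_iff.2 hd)]
  rw [f.deriv_invVal_eq h4 h2, norm_neg, norm_mul, norm_pow] at h1
  have h5 : ‖f.invVal z‖ ^ 2 ≤ ‖f.invVal z‖ ^ α := by
    rw [← Real.rpow_two]
    exact Real.rpow_le_rpow_of_exponent_ge hi h3.le (by linarith)
  have h6 : 1 ≤ C * ‖deriv f.val z‖ := by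
    by_contra hlt
    push Not at hlt
    have : C * (‖deriv f.val z‖ * ‖f.invVal z‖ ^ 2) < ‖f.invVal z‖ ^ 2 := by
      rw [← mul_assoc]
      exact mul_lt_of_lt_one_left (by positivity) hlt
    linarith
  calc ‖cauchyInt g (f.val z)‖ ≤ C' * 1 := by rw [mul_one]; exact hC' _
    _ ≤ C' * (C * ‖deriv f.val z‖) := by gcongr
    _ = _ := by ring

/-- An entire extension, by Riemann's theorem, across finitely many points, followed by
Liouville's theorem. -/
lemma _root_.Complex.eq_zero_of_differentiableAt_of_bounded_of_tendsto {G : ℂ → ℂ} {B : Set ℂ} (hB : B.Finite)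
    (hd : ∀ z ∉ B, DifferentiableAt ℂ G z)
    (hb : ∀ b ∈ B, ∃ C, ∀ᶠ z in 𝓝[≠] b, ‖G z‖ ≤ C)
    (hlim : Tendsto G (cocompact ℂ) (𝓝 0)) {z : ℂ} (hz : z ∉ B) : G z = 0 := by
  classical
  set G' : ℂ → ℂ := fun z => if z ∈ B then limUnder (𝓝[≠] z) G else G z with hG'
  have hdiff : Differentiable ℂ G' := by
    intro w
    have hw : (B \ {w})ᶜ ∈ 𝓝 w :=
      (hB.subset Set.sdiff_subset).isClosed.isOpen_compl.mem_nhds (by simp)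
    by_cases hwB : w ∈ B
    · obtain ⟨C, hC⟩ := hb w hwB
      rw [eventually_nhdsWithin_iff] at hC
      have hs : (B \ {w})ᶜ ∩ {z | z ∈ ({w}ᶜ : Set ℂ) → ‖G z‖ ≤ C} ∈ 𝓝 w := inter_mem hw hC
      have := Complex.differentiableOn_update_limUnder_of_bddAbove hs (f := G) ?_ ?_
      · refine (this.differentiableAt hs).congr_of_eventuallyEq ?_
        filter_upwards [hw] with y hy
        by_cases hyw : y = w
        · subst hyw
          simp [hG', hwB]
        · have hyB : y ∉ B := fun h => hy ⟨h, hyw⟩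
          simp [hG', hyB, Function.update_of_ne hyw]
      · rintro y ⟨⟨hy, -⟩, hyw⟩
        exact (hd y fun h => hy ⟨h, hyw⟩).differentiableWithinAt
      · refine ⟨C, ?_⟩
        rintro _ ⟨y, ⟨⟨-, hy⟩, hyw⟩, rfl⟩
        exact hy hyw
    · refine (hd w hwB).congr_of_eventuallyEq ?_
      filter_upwards [hw] with y hy
      by_cases hyw : y = w
      · subst hyw; simp [hG', hwB]
      · have hyB : y ∉ B := fun h => hy ⟨h, hyw⟩
        simp [hG', hyB]
  have hlim' : Tendsto G' (cocompact ℂ) (𝓝 0) := by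
    refine hlim.congr' ?_
    filter_upwards [hB.isCompact.compl_mem_cocompact] with y hy
    simp only [hG']
    rw [if_neg hy]
  have := hdiff.apply_eq_of_tendsto_cocompact z hlim'
  simpa [hG', hz] using this

/-- The Cauchy transform of an invariant density behaves as an invariant vector field. -/
lemma cauchyInt_comp_eq_deriv_mul (hg : IsBoundedDensity g M R)
    (hinv : ∀ᵐ x, g (f.val x) * f.factor x = g x)
    (hcrit : ∀ v ∈ f.finiteCriticalValues, cauchyInt g v = 0)
    (hinf : Tendsto (fun z => cauchyInt g (f.val z) / deriv f.val z) (cocompact ℂ) (𝓝 0))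
    {z : ℂ} (hz : ¬ f.IsPole z) : cauchyInt g (f.val z) = deriv f.val z * cauchyInt g z := by
  by_cases hW : f.wronskian.eval z = 0
  · have hd := (f.deriv_val_eq_zero_iff hz).2 hW
    rw [hd, zero_mul]
    exact hcrit _ ⟨z, hz, hd, rfl⟩
  have h := Complex.eq_zero_of_differentiableAt_of_bounded_of_tendsto f.finite_bad
    (G := fun z => cauchyInt g (f.val z) / deriv f.val z - cauchyInt g z) (fun w hw => ?_)
    (fun b hb => ?_) (by simpa using hinf.sub hg.tendsto_cauchyInt)
    (z := z) (fun h => h.elim hz hW)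
  · have hd : deriv f.val z ≠ 0 := fun h => hW ((f.deriv_val_eq_zero_iff hz).1 h)
    rw [sub_eq_zero, div_eq_iff hd] at h
    rw [h, mul_comm]
  · exact f.differentiableAt_cauchyInt_comp_sub hg hinv (fun h => hw (Or.inl h))
      fun h => hw (Or.inr h)
  · obtain ⟨C', hC'⟩ := hg.exists_norm_cauchyInt_le
    have : ∃ C, ∀ᶠ z in 𝓝[≠] b, ‖cauchyInt g (f.val z) / deriv f.val z‖ ≤ C := by
      by_cases hbp : f.IsPole b
      · exact f.exists_norm_div_deriv_le_of_isPole hg hbp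
      · obtain ⟨C, hC⟩ := f.exists_norm_div_deriv_le_of_not_isPole hg hbp
          (hcrit _ ⟨b, hbp, (f.deriv_val_eq_zero_iff hbp).2 (hb.resolve_left hbp), rfl⟩)
        exact ⟨C, hC.filter_mono nhdsWithin_le_nhds⟩
    obtain ⟨C, hC⟩ := this
    refine ⟨C + C', ?_⟩
    filter_upwards [hC] with z hz
    exact (norm_sub_le _ _).trans (add_le_add hz (hC' z))

end RationalMap

/-! ### The action on the sphere and the Fatou set -/

namespace RationalMap

variable (f : RationalMap)

/-- The numerator of `f` in the coordinate `1 / z`. -/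
noncomputable def infNum : ℂ[X] :=
  f.toRatFunc.num.reflect (max f.toRatFunc.num.natDegree f.toRatFunc.denom.natDegree)

/-- The denominator of `f` in the coordinate `1 / z`. -/
noncomputable def infDenom : ℂ[X] :=
  f.toRatFunc.denom.reflect (max f.toRatFunc.num.natDegree f.toRatFunc.denom.natDegree)

lemma _root_.Polynomial.eval_reflect_eq {p : ℂ[X]} {N : ℕ} (hp : p.natDegree ≤ N) {w : ℂ} (hw : w ≠ 0) :
    (p.reflect N).eval w = p.eval w⁻¹ * w ^ N := by
  let : Invertible w⁻¹ := invertibleOfNonzero (inv_ne_zero hw)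
  have h := Polynomial.eval₂_reflect_mul_pow (RingHom.id ℂ) w⁻¹ N p hp
  rw [invOf_eq_inv, inv_inv, Polynomial.eval₂_id, Polynomial.eval₂_id] at h
  rw [← h, mul_assoc, ← mul_pow, inv_mul_cancel₀ hw, one_pow, mul_one]

lemma infNum_eval {w : ℂ} (hw : w ≠ 0) : f.infNum.eval w = f.toRatFunc.num.eval w⁻¹ *
    w ^ (max f.toRatFunc.num.natDegree f.toRatFunc.denom.natDegree) :=
  eval_reflect_eq (le_max_left _ _) hw

lemma infDenom_eval {w : ℂ} (hw : w ≠ 0) : f.infDenom.eval w = f.toRatFunc.denom.eval w⁻¹ *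
    w ^ (max f.toRatFunc.num.natDegree f.toRatFunc.denom.natDegree) :=
  eval_reflect_eq (le_max_right _ _) hw

lemma infNum_eval_zero : f.infNum.eval 0 =
    f.toRatFunc.num.coeff (max f.toRatFunc.num.natDegree f.toRatFunc.denom.natDegree) := by
  rw [← Polynomial.coeff_zero_eq_eval_zero, infNum, Polynomial.coeff_reflect]
  simp

lemma infDenom_eval_zero : f.infDenom.eval 0 =
    f.toRatFunc.denom.coeff (max f.toRatFunc.num.natDegree f.toRatFunc.denom.natDegree) := by
  rw [← Polynomial.coeff_zero_eq_eval_zero, infDenom, Polynomial.coeff_reflect]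
  simp

lemma infDenom_ne_zero : f.infDenom ≠ 0 := by
  rw [infDenom, Ne, Polynomial.reflect_eq_zero_iff]
  exact f.denom_ne_zero

lemma val_inv {w : ℂ} (hw : w ≠ 0) : f.val w⁻¹ = f.infNum.eval w / f.infDenom.eval w := by
  rw [f.infNum_eval hw, f.infDenom_eval hw, val, mul_div_mul_right _ _ (pow_ne_zero _ hw)]

lemma isPole_inv_iff {w : ℂ} (hw : w ≠ 0) : f.IsPole w⁻¹ ↔ f.infDenom.eval w = 0 := by
  rw [f.infDenom_eval hw, IsPole, mul_eq_zero, or_iff_left (pow_ne_zero _ hw)]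

open Classical in
/-- The point of the sphere with homogeneous coordinates `(p, q)`. -/
noncomputable def ratioPoint (p q : ℂ) : OnePoint ℂ :=
  if q = 0 then OnePoint.infty else ((p / q : ℂ) : OnePoint ℂ)

open Classical in
lemma sphereMap_coe (z : ℂ) : f.sphereMap (z : OnePoint ℂ) =
    if f.IsPole z then OnePoint.infty else ((f.val z : ℂ) : OnePoint ℂ) := rfl

lemma sphereMap_coe_of_not_isPole {z : ℂ} (hz : ¬ f.IsPole z) :
    f.sphereMap (z : OnePoint ℂ) = (f.val z : OnePoint ℂ) := by
  rw [sphereMap_coe, if_neg hz]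

lemma sphereMap_coe_of_isPole {z : ℂ} (hz : f.IsPole z) :
    f.sphereMap (z : OnePoint ℂ) = OnePoint.infty := by
  rw [sphereMap_coe, if_pos hz]

lemma chartInv_infty_zero : chartInv OnePoint.infty 0 = OnePoint.infty := if_pos rfl

lemma chartInv_infty_of_ne {w : ℂ} (hw : w ≠ 0) :
    chartInv OnePoint.infty w = ((w⁻¹ : ℂ) : OnePoint ℂ) := if_neg hw

lemma sphereMap_chartInv_infty (w : ℂ) : f.sphereMap (chartInv OnePoint.infty w) =
    ratioPoint (f.infNum.eval w) (f.infDenom.eval w) := by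
  by_cases hw : w = 0
  · subst hw
    rw [chartInv_infty_zero, f.infNum_eval_zero, f.infDenom_eval_zero, ratioPoint]
    simp only [sphereMap]
    by_cases h : f.toRatFunc.denom.natDegree < f.toRatFunc.num.natDegree
    · rw [if_pos h, if_pos]
      exact Polynomial.coeff_eq_zero_of_natDegree_lt (lt_max_of_lt_left h)
    · rw [if_neg h, max_eq_right (not_lt.1 h), if_neg, Polynomial.leadingCoeff]
      exact Polynomial.leadingCoeff_ne_zero.2 f.denom_ne_zero
  · rw [chartInv_infty_of_ne hw, sphereMap_coe, ratioPoint, f.val_inv hw]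
    simp only [f.isPole_inv_iff hw]

lemma infNum_ne_zero_of_infDenom_eq_zero {w : ℂ} (h : f.infDenom.eval w = 0) :
    f.infNum.eval w ≠ 0 := by
  by_cases hw : w = 0
  · subst hw
    rw [f.infDenom_eval_zero] at h
    rw [f.infNum_eval_zero]
    rcases le_total f.toRatFunc.num.natDegree f.toRatFunc.denom.natDegree with hle | hle
    · rw [max_eq_right hle] at h
      exact absurd h (Polynomial.leadingCoeff_ne_zero.2 f.denom_ne_zero)
    · rw [max_eq_left hle]
      have h2 := f.two_le_degree
      rw [max_eq_left hle] at h2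
      refine Polynomial.leadingCoeff_ne_zero.2 fun h0 => ?_
      rw [h0] at h2
      simp at h2
  · rw [f.infNum_eval hw]
    exact mul_ne_zero (f.num_ne_zero_of_isPole ((f.isPole_inv_iff hw).2 h)) (pow_ne_zero _ hw)

lemma map_chartInv_infty_nhds : map (chartInv OnePoint.infty) (𝓝 0) = 𝓝 OnePoint.infty := by
  have h : chartInv OnePoint.infty =ᶠ[𝓝[≠] (0 : ℂ)] ((↑) : ℂ → OnePoint ℂ) ∘ Inv.inv := by
    filter_upwards [self_mem_nhdsWithin] with w hw using chartInv_infty_of_ne hw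
  rw [OnePoint.nhds_infty_eq, coclosedCompact_eq_cocompact, ← Metric.cobounded_eq_cocompact,
    ← inv_nhdsNE_zero, ← nhdsNE_sup_pure, Filter.map_sup, Filter.map_pure, chartInv_infty_zero,
    Filter.map_congr h, ← Filter.map_map, Filter.map_inv]

/-- Local openness at `w₀` of a map given in homogeneous coordinates by analytic functions. -/
lemma nhds_le_map_ratioPoint {p q : ℂ → ℂ} {w₀ : ℂ} (hp : AnalyticAt ℂ p w₀)
    (hq : AnalyticAt ℂ q w₀) (h0 : q w₀ = 0 → p w₀ ≠ 0)
    (hpq : ∀ c, ¬ ∀ᶠ w in 𝓝 w₀, p w = c * q w) (hqp : ¬ ∀ᶠ w in 𝓝 w₀, q w = 0) :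
    𝓝 (ratioPoint (p w₀) (q w₀)) ≤ map (fun w => ratioPoint (p w) (q w)) (𝓝 w₀) := by
  by_cases hq0 : q w₀ = 0
  · have hp0 := h0 hq0
    have hpne : ∀ᶠ w in 𝓝 w₀, p w ≠ 0 := hp.continuousAt.eventually_ne hp0
    have hrw : (fun w => ratioPoint (p w) (q w)) =ᶠ[𝓝 w₀]
        chartInv OnePoint.infty ∘ fun w => q w / p w := by
      filter_upwards [hpne] with w hw
      by_cases hqw : q w = 0
      · simp [ratioPoint, hqw, chartInv_infty_zero]
      · simp [ratioPoint, hqw, chartInv_infty_of_ne (div_ne_zero hqw hw)]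
    have hop := (hq.div hp hp0).eventually_constant_or_nhds_le_map_nhds.resolve_left fun h => by
      refine hqp ?_
      filter_upwards [h, hpne] with w hw hpw
      simp only [Pi.div_apply, hq0, zero_div, div_eq_zero_iff] at hw
      exact hw.resolve_right hpw
    rw [Filter.map_congr hrw, ← Filter.map_map]
    simp only [ratioPoint, hq0, if_true]
    rw [← map_chartInv_infty_nhds]
    refine map_mono ?_
    simpa only [Pi.div_apply, Pi.div_def, hq0, zero_div] using hop
  · have hqne : ∀ᶠ w in 𝓝 w₀, q w ≠ 0 := hq.continuousAt.eventually_ne hq0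
    have hrw : (fun w => ratioPoint (p w) (q w)) =ᶠ[𝓝 w₀]
        ((↑) : ℂ → OnePoint ℂ) ∘ fun w => p w / q w := by
      filter_upwards [hqne] with w hw
      simp [ratioPoint, hw]
    have hop := (hp.div hq hq0).eventually_constant_or_nhds_le_map_nhds.resolve_left fun h => by
      refine hpq (p w₀ / q w₀) ?_
      filter_upwards [h, hqne] with w hw hqw
      exact (div_eq_iff hqw).1 hw
    rw [Filter.map_congr hrw, ← Filter.map_map]
    simp only [ratioPoint, hq0, if_false]
    rw [OnePoint.nhds_coe_eq]
    exact map_mono hop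

/-- Rational maps of the sphere are open. -/
lemma nhds_sphereMap_le (x : OnePoint ℂ) : 𝓝 (f.sphereMap x) ≤ map f.sphereMap (𝓝 x) := by
  have han : ∀ (p : ℂ[X]) (z : ℂ), AnalyticAt ℂ (fun w => p.eval w) z := fun p z =>
    p.differentiable.analyticAt z
  have hpq : ∀ (c z : ℂ), ¬ ∀ᶠ w in 𝓝 z, ¬ f.IsPole w → f.val w = c := by
    intro c z h
    obtain ⟨w, h1, h2⟩ := ((h.eventually_nhds.filter_mono nhdsWithin_le_nhds).and
      (eventually_eval_ne_zero f.denom_ne_zero z)).exists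
    refine f.not_eventually_val_eq h2 c ?_
    filter_upwards [h1, f.isOpen_not_isPole.mem_nhds h2] with y hy hy' using hy hy'
  induction x using OnePoint.rec with
  | infty =>
    rw [← map_chartInv_infty_nhds, Filter.map_map, show f.sphereMap OnePoint.infty = ratioPoint
      (f.infNum.eval 0) (f.infDenom.eval 0) by
        rw [← sphereMap_chartInv_infty, chartInv_infty_zero]]
    have : f.sphereMap ∘ chartInv OnePoint.infty =
        fun w => ratioPoint (f.infNum.eval w) (f.infDenom.eval w) := by
      ext1 w; exact f.sphereMap_chartInv_infty w
    rw [this]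
    refine nhds_le_map_ratioPoint (han _ _) (han _ _) f.infNum_ne_zero_of_infDenom_eq_zero ?_ ?_
    · intro c h
      -- move to a nearby finite point
      obtain ⟨w, h1, h2⟩ := ((h.eventually_nhds.filter_mono nhdsWithin_le_nhds).and
        (self_mem_nhdsWithin (a := (0 : ℂ)) (s := {0}ᶜ))).exists
      have hw : w ≠ 0 := h2
      refine hpq c w⁻¹ ?_
      have h3 : ∀ᶠ y in 𝓝 w⁻¹, f.infNum.eval y⁻¹ = c * f.infDenom.eval y⁻¹ := by
        have : Tendsto (fun y : ℂ => y⁻¹) (𝓝 w⁻¹) (𝓝 w) := by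
          simpa using tendsto_inv₀ (inv_ne_zero hw)
        exact this.eventually h1
      filter_upwards [h3, continuousAt_id.eventually_ne (inv_ne_zero hw)] with y hy hy0 hyp
      have hy0' : (y : ℂ)⁻¹ ≠ 0 := inv_ne_zero hy0
      have hv := f.val_inv hy0'
      rw [inv_inv] at hv
      rw [hv, div_eq_iff, hy]
      intro h0
      rw [← f.isPole_inv_iff hy0', inv_inv] at h0
      exact hyp h0
    · intro h
      obtain ⟨w, h1, h2⟩ := ((h.filter_mono nhdsWithin_le_nhds).and
        (eventually_eval_ne_zero f.infDenom_ne_zero 0)).exists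
      exact h2 h1
  | coe z =>
    rw [OnePoint.nhds_coe_eq, Filter.map_map]
    refine nhds_le_map_ratioPoint (han _ z) (han _ z) (fun h => f.num_ne_zero_of_isPole h) ?_ ?_
    · intro c h
      refine hpq c z ?_
      filter_upwards [h] with w hw hwp
      rw [val, div_eq_iff hwp, hw]
    · intro h
      obtain ⟨w, h1, h2⟩ := ((h.filter_mono nhdsWithin_le_nhds).and
        (eventually_eval_ne_zero f.denom_ne_zero z)).exists
      exact h2 h1

lemma isOpen_fatouSet : IsOpen f.fatouSet := by
  rw [isOpen_iff_mem_nhds]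
  rintro x ⟨U, hU, hx, h⟩
  exact mem_of_superset (hU.mem_nhds hx) fun y hy => ⟨U, hU, hy, h⟩

/-- The Fatou set is forward invariant, because rational maps are open. -/
lemma sphereMap_mem_fatouSet {x : OnePoint ℂ} (hx : x ∈ f.fatouSet) :
    f.sphereMap x ∈ f.fatouSet := by
  let : UniformSpace (OnePoint ℂ) := uniformSpaceOfCompactR1
  obtain ⟨U, hU, hxU, h⟩ := hx
  have hop : IsOpenMap f.sphereMap := IsOpenMap.of_nhds_le f.nhds_sphereMap_le
  refine ⟨f.sphereMap '' U, hop U hU, ⟨x, hxU, rfl⟩, ?_⟩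
  rintro _ ⟨y, hy, rfl⟩ V hV
  have h1 := h y hy V hV
  rw [hU.nhdsWithin_eq hy] at h1
  refine Eventually.filter_mono nhdsWithin_le_nhds ?_
  refine (f.nhds_sphereMap_le y) ?_
  rw [mem_map]
  filter_upwards [h1] with z hz n
  have := hz (n + 1)
  simpa only [Function.iterate_succ_apply] using this

lemma iterate_sphereMap_mem_fatouSet {x : OnePoint ℂ} (hx : x ∈ f.fatouSet) (n : ℕ) :
    f.sphereMap^[n] x ∈ f.fatouSet := by
  induction n with
  | zero => exact hx
  | succ n ih =>
    rw [Function.iterate_succ_apply']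
    exact f.sphereMap_mem_fatouSet ih

lemma isClosed_juliaPlane : IsClosed f.juliaPlane :=
  f.isOpen_fatouSet.isClosed_compl.preimage OnePoint.continuous_coe

lemma isBounded_juliaPlane (h : OnePoint.infty ∈ f.fatouSet) : Bornology.IsBounded f.juliaPlane := by
  have h1 := f.isOpen_fatouSet.mem_nhds h
  rw [OnePoint.nhds_infty_eq, coclosedCompact_eq_cocompact, ← Metric.cobounded_eq_cocompact] at h1
  refine Bornology.isBounded_def.2 ?_
  filter_upwards [mem_map.1 (mem_sup.1 h1).1] with z hz hz'
  exact hz' hz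

/-- The inclusion of the plane in the sphere is uniformly continuous. -/
lemma uniformContinuous_coe : letI : UniformSpace (OnePoint ℂ) := uniformSpaceOfCompactR1
    UniformContinuous ((↑) : ℂ → OnePoint ℂ) := by
  let : UniformSpace (OnePoint ℂ) := uniformSpaceOfCompactR1
  refine OnePoint.continuous_coe.uniformContinuous_of_tendsto_cocompact (x := OnePoint.infty) ?_
  rw [← coclosedCompact_eq_cocompact]
  exact OnePoint.tendsto_coe_infty

section IsPolynomial

variable {f}

lemma IsPolynomial.denom_eq_one (h : f.IsPolynomial) : f.toRatFunc.denom = 1 := by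
  obtain ⟨p, hp⟩ := h
  rw [← hp, RatFunc.denom_algebraMap]

lemma IsPolynomial.not_isPole (h : f.IsPolynomial) (z : ℂ) : ¬ f.IsPole z := by
  simp [IsPole, h.denom_eq_one]

lemma IsPolynomial.val_eq (h : f.IsPolynomial) (z : ℂ) : f.val z = f.toRatFunc.num.eval z := by
  simp [val, h.denom_eq_one]

lemma IsPolynomial.two_le_natDegree (h : f.IsPolynomial) : 2 ≤ f.toRatFunc.num.natDegree := by
  have := f.two_le_degree
  rw [h.denom_eq_one] at this
  simpa using this

lemma IsPolynomial.sphereMap_infty (h : f.IsPolynomial) :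
    f.sphereMap OnePoint.infty = OnePoint.infty := by
  have := h.two_le_natDegree
  refine if_pos ?_
  rw [h.denom_eq_one, Polynomial.natDegree_one]
  omega

lemma IsPolynomial.iterate_sphereMap_coe (h : f.IsPolynomial) (n : ℕ) (z : ℂ) :
    f.sphereMap^[n] (z : OnePoint ℂ) = (f.val^[n] z : OnePoint ℂ) := by
  induction n with
  | zero => rfl
  | succ n ih =>
    rw [Function.iterate_succ_apply', ih, sphereMap_coe_of_not_isPole f (h.not_isPole _),
      Function.iterate_succ_apply']

lemma IsPolynomial.continuous_val (h : f.IsPolynomial) : Continuous f.val := by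
  rw [show f.val = fun z => f.toRatFunc.num.eval z from funext h.val_eq]
  exact Polynomial.continuous _

/-- A polynomial of degree at least two expands near infinity. -/
lemma IsPolynomial.exists_two_mul_norm_le (h : f.IsPolynomial) :
    ∃ T > 0, ∀ z, T ≤ ‖z‖ → 2 * ‖z‖ ≤ ‖f.val z‖ := by
  set P := f.toRatFunc.num with hP
  have hdeg : 0 < P.divX.degree := by
    rw [← Polynomial.natDegree_pos_iff_degree_pos, Polynomial.natDegree_divX_eq_natDegree_tsub_one]
    have : 2 ≤ P.natDegree := h.two_le_natDegree
    omega
  have hlim := Polynomial.tendsto_norm_atTop P.divX hdeg (tendsto_norm_cocompact_atTop (E := ℂ))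
  have hev := hlim.eventually_ge_atTop 3
  rw [← Metric.cobounded_eq_cocompact, ← comap_norm_atTop, eventually_comap] at hev
  obtain ⟨T, hT⟩ := (hev.and ((eventually_ge_atTop ‖P.coeff 0‖).and
    (eventually_gt_atTop 0))).exists_forall_of_atTop
  refine ⟨T, (hT T le_rfl).2.2, fun z hz => ?_⟩
  obtain ⟨h1, h2, h3⟩ := hT _ hz
  rw [h.val_eq, ← hP, ← Polynomial.divX_mul_X_add P]
  simp only [eval_add, eval_mul, eval_X, eval_C]
  have h4 : ‖P.divX.eval z * z‖ - ‖P.coeff 0‖ ≤ ‖P.divX.eval z * z + P.coeff 0‖ := by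
    have := norm_sub_norm_le (P.divX.eval z * z) (-P.coeff 0)
    rwa [norm_neg, sub_neg_eq_add] at this
  rw [norm_mul] at h4
  have h5 := mul_le_mul_of_nonneg_right (h1 z rfl) (norm_nonneg z)
  linarith

lemma IsPolynomial.infty_mem_fatouSet (h : f.IsPolynomial) : OnePoint.infty ∈ f.fatouSet := by
  let : UniformSpace (OnePoint ℂ) := uniformSpaceOfCompactR1
  obtain ⟨T, hT0, hT⟩ := h.exists_two_mul_norm_le
  have hopen : ∀ r : ℝ, IsOpen (((↑) '' Metric.closedBall (0 : ℂ) r : Set (OnePoint ℂ))ᶜ) := fun r =>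
    OnePoint.isOpen_compl_image_coe.2 ⟨Metric.isClosed_closedBall, isCompact_closedBall _ _⟩
  have hinf : ∀ r : ℝ, OnePoint.infty ∈ ((↑) '' Metric.closedBall (0 : ℂ) r : Set (OnePoint ℂ))ᶜ :=
    fun r => OnePoint.infty_notMem_image_coe
  have hcoe : ∀ (r : ℝ) (z : ℂ), (z : OnePoint ℂ) ∈
      ((↑) '' Metric.closedBall (0 : ℂ) r : Set (OnePoint ℂ))ᶜ ↔ r < ‖z‖ := by
    intro r z
    rw [Set.mem_compl_iff, OnePoint.coe_injective.mem_set_image]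
    simp
  have hgrow : ∀ (n : ℕ) (z : ℂ), T ≤ ‖z‖ → 2 ^ n * ‖z‖ ≤ ‖f.val^[n] z‖ := by
    intro n z hz
    induction n with
    | zero => simp
    | succ n ih =>
      rw [Function.iterate_succ_apply']
      have h1 : T ≤ ‖f.val^[n] z‖ := by
        have : ‖z‖ ≤ 2 ^ n * ‖z‖ := le_mul_of_one_le_left (norm_nonneg _) (one_le_pow₀ one_le_two)
        linarith
      have := hT _ h1
      rw [pow_succ]
      linarith
  have hinfn : ∀ n, f.sphereMap^[n] OnePoint.infty = OnePoint.infty := fun n => by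
    induction n with
    | zero => rfl
    | succ n ih => rw [Function.iterate_succ_apply', ih, h.sphereMap_infty]
  refine ⟨((↑) '' Metric.closedBall (0 : ℂ) T)ᶜ, hopen T, hinf T, ?_⟩
  intro x hx V hV
  refine Eventually.filter_mono nhdsWithin_le_nhds ?_
  obtain ⟨V', hV', hsymm, hcomp⟩ := comp_symm_of_uniformity hV
  obtain ⟨T', hT'⟩ : ∃ T', ∀ z : ℂ, T' < ‖z‖ → (OnePoint.infty, (z : OnePoint ℂ)) ∈ V' := by
    have h1 := mem_nhds_left OnePoint.infty hV'
    rw [OnePoint.nhds_infty_eq, coclosedCompact_eq_cocompact, ← Metric.cobounded_eq_cocompact,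
      ← comap_norm_atTop] at h1
    have h2 : ∀ᶠ z : ℂ in comap norm atTop, (OnePoint.infty, (z : OnePoint ℂ)) ∈ V' :=
      mem_map.1 (mem_sup.1 h1).1
    rw [eventually_comap] at h2
    obtain ⟨T', hT'⟩ := h2.exists_forall_of_atTop
    exact ⟨T', fun z hz => hT' _ hz.le z rfl⟩
  have hrefl : ∀ y : OnePoint ℂ, (y, y) ∈ V' := fun y => refl_mem_uniformity hV'
  have hV'V : ∀ a b c, (a, b) ∈ V' → (b, c) ∈ V' → (a, c) ∈ V := fun a b c hab hbc =>
    hcomp ⟨b, hab, hbc⟩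
  induction x using OnePoint.rec with
  | infty =>
    filter_upwards [(hopen (max T T')).mem_nhds (hinf _)] with y hy n
    rw [hinfn]
    induction y using OnePoint.rec with
    | infty => rw [hinfn]; exact refl_mem_uniformity hV
    | coe z =>
      rw [hcoe, max_lt_iff] at hy
      rw [h.iterate_sphereMap_coe]
      refine hV'V _ _ _ (hrefl _) (hT' _ ?_)
      have h1 := hgrow n z hy.1.le
      have : ‖z‖ ≤ 2 ^ n * ‖z‖ := le_mul_of_one_le_left (norm_nonneg _) (one_le_pow₀ one_le_two)
      linarith
  | coe z =>
    rw [hcoe] at hx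
    obtain ⟨N, hN⟩ := pow_unbounded_of_one_lt (T' / T) (one_lt_two)
    rw [div_lt_iff₀ hT0] at hN
    rw [OnePoint.nhds_coe_eq, eventually_map]
    have h1 : ∀ᶠ w in 𝓝 z, T < ‖w‖ := continuous_norm.continuousAt.eventually_const_lt hx
    have h2 : ∀ᶠ w in 𝓝 z, ∀ n ∈ Finset.range N,
        (((f.val^[n] z : ℂ) : OnePoint ℂ), ((f.val^[n] w : ℂ) : OnePoint ℂ)) ∈ V := by
      rw [Filter.eventually_all_finset]
      intro n _
      have hc : Continuous fun w => ((f.val^[n] w : ℂ) : OnePoint ℂ) :=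
        OnePoint.continuous_coe.comp (h.continuous_val.iterate n)
      exact hc.continuousAt (mem_nhds_left _ hV)
    filter_upwards [h1, h2] with w hw1 hw2 n
    rw [h.iterate_sphereMap_coe, h.iterate_sphereMap_coe]
    by_cases hn : n < N
    · exact hw2 n (Finset.mem_range.2 hn)
    · have hbig : ∀ y : ℂ, T < ‖y‖ → T' < ‖f.val^[n] y‖ := by
        intro y hy
        have h3 := hgrow n y hy.le
        have h4 : (2 : ℝ) ^ N ≤ 2 ^ n := pow_le_pow_right₀ one_le_two (not_lt.1 hn)
        have h5 : (2 : ℝ) ^ N * T ≤ 2 ^ n * ‖y‖ := by gcongr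
        linarith
      exact hV'V _ _ _ (hsymm (hT' _ (hbig z hx))) (hT' _ (hbig w hw1))

end IsPolynomial

end RationalMap

/-! ### Behaviour at infinity, and vanishing on the Julia set -/

namespace RationalMap

variable {f : RationalMap} {g : ℂ → ℂ} {M R : ℝ}

lemma IsPolynomial.tendsto_cauchyInt_div_deriv (h : f.IsPolynomial) (hg : IsBoundedDensity g M R) :
    Tendsto (fun z => cauchyInt g (f.val z) / deriv f.val z) (cocompact ℂ) (𝓝 0) := by
  obtain ⟨C, hC⟩ := hg.exists_norm_cauchyInt_le
  have hdeg : 0 < f.toRatFunc.num.derivative.degree := by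
    rw [← Polynomial.natDegree_pos_iff_degree_pos]
    have := h.two_le_natDegree
    have h2 := Polynomial.natDegree_derivative f.toRatFunc.num
    omega
  have hlim := Polynomial.tendsto_norm_atTop _ hdeg (tendsto_norm_cocompact_atTop (E := ℂ))
  have hd : ∀ z, deriv f.val z = f.toRatFunc.num.derivative.eval z := fun z => by
    rw [show f.val = fun z => f.toRatFunc.num.eval z from funext h.val_eq, Polynomial.deriv]
  rw [tendsto_zero_iff_norm_tendsto_zero]
  have hlim' := (tendsto_inv_atTop_zero.comp hlim).const_mul C
  rw [mul_zero] at hlim'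
  refine squeeze_zero (fun _ => norm_nonneg _) (fun z => ?_) hlim'
  rw [norm_div, hd, div_eq_mul_inv, Function.comp_apply]
  gcongr
  exact hC _

/-- If `f(∞) = a` is finite and not a critical value, then `f(z) - a` is of order `1 / z` and `f'(z)`
is of order `1 / z²` at infinity. -/
lemma IsNormalizedAt.exists_bounds_at_infty {a : ℂ} (h : f.IsNormalizedAt a) :
    ∃ C > 0, ∀ᶠ z in cocompact ℂ, ‖f.val z - a‖ ≤ C * ‖z‖⁻¹ ∧
      (‖z‖ ^ 2)⁻¹ ≤ C * ‖deriv f.val z‖ := by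
  obtain ⟨-, hsa, hcv⟩ := h
  set φ : ℂ → ℂ := fun w => f.infNum.eval w / f.infDenom.eval w with hφ
  have h0 : f.infDenom.eval 0 ≠ 0 := by
    intro h0
    have := f.sphereMap_chartInv_infty 0
    rw [chartInv_infty_zero, hsa, ratioPoint, if_pos h0] at this
    exact OnePoint.coe_ne_infty _ this
  have hφ0 : φ 0 = a := by
    have := f.sphereMap_chartInv_infty 0
    rw [chartInv_infty_zero, hsa, ratioPoint, if_neg h0, OnePoint.coe_eq_coe] at this
    exact this.symm
  have hφa : AnalyticAt ℂ φ 0 :=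
    (f.infNum.differentiable.analyticAt 0).div (f.infDenom.differentiable.analyticAt 0) h0
  have hne : ∀ᶠ w in 𝓝 (0 : ℂ), f.infDenom.eval w ≠ 0 :=
    f.infDenom.continuous.continuousAt.eventually_ne h0
  have hd : deriv φ 0 ≠ 0 := by
    intro hd
    refine hcv ⟨OnePoint.infty, ?_, hsa⟩
    have e : (fun w : ℂ => chart (f.sphereMap OnePoint.infty)
        (f.sphereMap (chartInv OnePoint.infty w))) =ᶠ[𝓝 0] φ := by
      filter_upwards [hne] with w hw
      rw [hsa, f.sphereMap_chartInv_infty, ratioPoint, if_neg hw]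
      rfl
    have e0 : chart OnePoint.infty OnePoint.infty = 0 := rfl
    rw [IsCriticalPoint, e0, e.deriv_eq, hd]
  have hO : (fun w => φ w - a) =O[𝓝 0] fun w => w := by
    have := hφa.differentiableAt.isBigO_sub
    simpa [hφ0] using this
  obtain ⟨C, hC, hO⟩ := hO.exists_pos
  rw [Asymptotics.IsBigOWith] at hO
  have hpos : 0 < ‖deriv φ 0‖ := norm_pos_iff.2 hd
  have hdl : ∀ᶠ w in 𝓝 (0 : ℂ), ‖deriv φ 0‖ / 2 < ‖deriv φ w‖ :=
    hφa.deriv.continuousAt.norm.eventually_const_lt (by linarith)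
  have hinv : Tendsto (fun z : ℂ => z⁻¹) (cocompact ℂ) (𝓝 0) := by
    rw [← Metric.cobounded_eq_cocompact]
    exact tendsto_inv₀_cobounded
  have hz0 : ∀ᶠ z : ℂ in cocompact ℂ, z ≠ 0 := by
    have := (tendsto_norm_cocompact_atTop (E := ℂ)).eventually_gt_atTop 0
    filter_upwards [this] with z hz using norm_pos_iff.1 hz
  refine ⟨max C (2 / ‖deriv φ 0‖), lt_max_of_lt_left hC, ?_⟩
  filter_upwards [hinv.eventually hO, hinv.eventually hdl, hinv.eventually hφa.eventually_analyticAt,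
    hz0] with z h1 h2 h3 hz
  have hval : ∀ y : ℂ, y ≠ 0 → f.val y = φ y⁻¹ := fun y hy => by
    have := f.val_inv (inv_ne_zero hy)
    rwa [inv_inv] at this
  have hder : deriv f.val z = deriv φ z⁻¹ * -(z ^ 2)⁻¹ := by
    have e : f.val =ᶠ[𝓝 z] φ ∘ Inv.inv := by
      filter_upwards [continuousAt_id.eventually_ne hz] with y hy using hval y hy
    rw [e.deriv_eq]
    exact (h3.differentiableAt.hasDerivAt.comp z (hasDerivAt_inv hz)).deriv
  refine ⟨?_, ?_⟩
  · rw [hval z hz]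
    refine h1.trans ?_
    rw [norm_inv]
    gcongr
    exact le_max_left _ _
  · rw [hder, norm_mul, norm_neg, norm_inv, norm_pow, ← mul_assoc]
    refine le_mul_of_one_le_left (by positivity) ?_
    calc (1 : ℝ) = 2 / ‖deriv φ 0‖ * (‖deriv φ 0‖ / 2) := by field_simp
      _ ≤ _ := by gcongr; exact le_max_right _ _

lemma IsNormalizedAt.tendsto_cauchyInt_div_deriv {a : ℂ} (h : f.IsNormalizedAt a)
    {C r : ℝ} (hr : 0 < r) (hcube : ∀ w, ‖w - a‖ < r → ‖cauchyInt g w‖ ≤ C * ‖w - a‖ ^ 3) :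
    Tendsto (fun z => cauchyInt g (f.val z) / deriv f.val z) (cocompact ℂ) (𝓝 0) := by
  obtain ⟨K, hK, hev⟩ := h.exists_bounds_at_infty
  have hC : 0 ≤ C := by
    have h1 := (norm_nonneg _).trans (hcube (a + (r / 2 : ℝ))
      (by rw [add_sub_cancel_left, Complex.norm_real, Real.norm_of_nonneg (by positivity)]; linarith))
    refine nonneg_of_mul_nonneg_left h1 ?_
    rw [add_sub_cancel_left, Complex.norm_real, Real.norm_of_nonneg (by positivity)]
    positivity
  have hinv : Tendsto (fun z : ℂ => ‖z‖⁻¹) (cocompact ℂ) (𝓝 0) :=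
    tendsto_inv_atTop_zero.comp (tendsto_norm_cocompact_atTop (E := ℂ))
  have hsmall : ∀ᶠ z : ℂ in cocompact ℂ, K * ‖z‖⁻¹ < r := by
    have := hinv.const_mul K
    rw [mul_zero] at this
    exact this.eventually_lt_const hr
  have hlim := hinv.const_mul (C * K ^ 3 * K)
  rw [mul_zero] at hlim
  rw [tendsto_zero_iff_norm_tendsto_zero]
  refine squeeze_zero' (Eventually.of_forall fun _ => norm_nonneg _) ?_ hlim
  filter_upwards [hev, hsmall, (tendsto_norm_cocompact_atTop (E := ℂ)).eventually_gt_atTop 0]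
    with z ⟨h1, h2⟩ h3 hz
  have hd : 0 < ‖deriv f.val z‖ := by
    by_contra hd
    have hd' : ‖deriv f.val z‖ = 0 := le_antisymm (not_lt.1 hd) (norm_nonneg _)
    rw [hd', mul_zero] at h2
    have : 0 < (‖z‖ ^ 2)⁻¹ := by positivity
    linarith
  rw [norm_div, div_le_iff₀ hd]
  calc ‖cauchyInt g (f.val z)‖ ≤ C * ‖f.val z - a‖ ^ 3 := hcube _ (h1.trans_lt h3)
    _ ≤ C * (K * ‖z‖⁻¹) ^ 3 := by gcongr
    _ = C * K ^ 3 * ‖z‖⁻¹ * (‖z‖ ^ 2)⁻¹ := by rw [mul_pow, inv_pow, pow_succ ‖z‖ 2, mul_inv]; ring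
    _ ≤ C * K ^ 3 * ‖z‖⁻¹ * (K * ‖deriv f.val z‖) := by gcongr
    _ = _ := by ring

lemma volume_preimage_iterate_val (n : ℕ) (b : ℂ) : volume (f.val^[n] ⁻¹' {b}) = 0 :=
  (f.quasiMeasurePreserving_val.iterate n).preimage_null (measure_singleton b)

/-- Suppose the holomorphic map `h` takes a pole of `f` as a value, without being locally constant.
Then `f ∘ h` has a pole, so that its derivative is unbounded near that point. -/
lemma not_isPole_of_norm_deriv_comp_le {h : ℂ → ℂ} {w₀ : ℂ} (hh : AnalyticAt ℂ h w₀)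
    (hne : ¬ ∀ᶠ w in 𝓝 w₀, h w = h w₀) {L : ℝ}
    (hL : ∀ᶠ w in 𝓝 w₀, ¬ f.IsPole (h w) → ‖deriv f.val (h w) * deriv h w‖ ≤ L) :
    ¬ f.IsPole (h w₀) := by
  intro hpole
  have hnum := f.num_ne_zero_of_isPole hpole
  have hψ : AnalyticAt ℂ (f.invVal ∘ h) w₀ := (f.analyticAt_invVal hnum).comp hh
  have hψ0 : (f.invVal ∘ h) w₀ = 0 := by
    simp [invVal, show f.toRatFunc.denom.eval (h w₀) = 0 from hpole]
  have hnum' : ∀ᶠ w in 𝓝 w₀, f.toRatFunc.num.eval (h w) ≠ 0 :=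
    hh.continuousAt.eventually (f.toRatFunc.num.continuous.continuousAt.eventually_ne hnum)
  have hne' : ∀ᶠ w in 𝓝[≠] w₀, h w ≠ h w₀ :=
    (hh.eventually_eq_or_eventually_ne analyticAt_const).resolve_left hne
  have hden : ∀ᶠ w in 𝓝[≠] w₀, ¬ f.IsPole (h w) := by
    have h1 := eventually_eval_ne_zero f.denom_ne_zero (h w₀)
    rw [eventually_nhdsWithin_iff] at h1
    filter_upwards [hne', (hh.continuousAt.eventually h1).filter_mono nhdsWithin_le_nhds]
      with w hw1 hw2 using hw2 hw1
  have hψne : ∀ᶠ w in 𝓝[≠] w₀, (f.invVal ∘ h) w ≠ 0 := by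
    filter_upwards [hden, hnum'.filter_mono nhdsWithin_le_nhds] with w h1 h2
    exact div_ne_zero h1 h2
  obtain ⟨α, hα0, hα1, C, hC, hev⟩ := hψ.exists_norm_sub_rpow_le_deriv fun hc => by
    rw [hψ0] at hc
    obtain ⟨w, h1, h2⟩ := ((hc.filter_mono nhdsWithin_le_nhds).and hψne).exists
    exact h2 h1
  have hsmall : ∀ᶠ w in 𝓝 w₀, ‖(f.invVal ∘ h) w‖ < min 1 (C * |L| + 1)⁻¹ := by
    refine hψ.continuousAt.norm.eventually_lt_const ?_
    change ‖(f.invVal ∘ h) w₀‖ < _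
    rw [hψ0, norm_zero]
    positivity
  obtain ⟨w, ⟨h1, h2⟩, h3, h4, h5, h6, h7⟩ := ((hden.and hψne).and
    ((hev.and (hsmall.and (hnum'.and (hL.and hh.eventually_analyticAt)))).filter_mono
      nhdsWithin_le_nhds)).exists
  set t := ‖(f.invVal ∘ h) w‖ with ht
  have ht0 : 0 < t := norm_pos_iff.2 h2
  have hd : deriv (f.invVal ∘ h) w = -(deriv f.val (h w) * deriv h w) * f.invVal (h w) ^ 2 := by
    have := ((f.hasDerivAt_invVal h5).differentiableAt.hasDerivAt.comp w
      h7.differentiableAt.hasDerivAt).deriv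
    rw [this, f.deriv_invVal_eq h1 h5]
    ring
  rw [hψ0, sub_zero, hd, norm_mul, norm_neg, norm_pow] at h3
  have h8 : t ^ α ≤ C * (|L| * t ^ 2) := by
    refine h3.trans ?_
    have := (h6 h1).trans (le_abs_self L)
    gcongr
    exact le_rfl
  have h9 : t ≤ t ^ α := by
    calc t = t ^ (1 : ℝ) := (Real.rpow_one t).symm
      _ ≤ t ^ α := Real.rpow_le_rpow_of_exponent_ge ht0 (h4.le.trans (min_le_left _ _)) hα1.le
  have h10 : t * (C * |L| + 1) < 1 := by
    have := h4.trans_le (min_le_right _ _)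
    rwa [lt_inv_comm₀ ht0 (by positivity), ← one_div, lt_div_iff₀ ht0, mul_comm] at this
  nlinarith [mul_nonneg hC (abs_nonneg L)]

/-- An invariant vector field which is bounded and continuous vanishes on the Julia set: where it
does not vanish, the derivatives of all iterates are bounded. -/
lemma eq_zero_of_mem_juliaPlane {A : ℂ → ℂ} (hA : Continuous A) {C : ℝ} (hC : ∀ z, ‖A z‖ ≤ C)
    (hinv : ∀ z, ¬ f.IsPole z → A (f.val z) = deriv f.val z * A z) {z₀ : ℂ}
    (hz₀ : z₀ ∈ f.juliaPlane) : A z₀ = 0 := by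
  by_contra hne
  refine hz₀ ?_
  set ε := ‖A z₀‖ / 2 with hε
  have hpos : 0 < ‖A z₀‖ := norm_pos_iff.2 hne
  have hε0 : 0 < ε := by positivity
  have hev : ∀ᶠ z in 𝓝 z₀, ε < ‖A z‖ := hA.continuousAt.norm.eventually_const_lt (half_lt_self hpos)
  obtain ⟨r, hr, hrA⟩ := Metric.mem_nhds_iff.1 hev
  set D := Metric.ball z₀ r with hD
  have hDo : IsOpen D := Metric.isOpen_ball
  have hAD : ∀ w ∈ D, ε < ‖A w‖ := fun w hw => hrA hw
  have hLbound : ∀ (d : ℂ) (w y : ℂ), w ∈ D → A y = d * A w → ‖d‖ ≤ C / ε := by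
    intro d w y hw h
    rw [le_div_iff₀ hε0]
    calc ‖d‖ * ε ≤ ‖d‖ * ‖A w‖ := by gcongr; exact (hAD w hw).le
      _ = ‖A y‖ := by rw [h, norm_mul]
      _ ≤ C := hC _
  have hmain : ∀ n, ∀ w ∈ D, f.sphereMap^[n] (w : OnePoint ℂ) = (f.val^[n] w : OnePoint ℂ) ∧
      DifferentiableAt ℂ (f.val^[n]) w ∧ A (f.val^[n] w) = deriv (f.val^[n]) w * A w := by
    intro n
    induction n with
    | zero => intro w _; exact ⟨rfl, differentiableAt_id, by simp⟩
    | succ n ih =>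
      have hpole : ∀ w ∈ D, ¬ f.IsPole (f.val^[n] w) := by
        intro w hw
        have han : AnalyticAt ℂ (f.val^[n]) w := by
          rw [Complex.analyticAt_iff_eventually_differentiableAt]
          filter_upwards [hDo.mem_nhds hw] with y hy using (ih y hy).2.1
        refine not_isPole_of_norm_deriv_comp_le han (fun hc => ?_) (L := C / ε) ?_
        · have h1 := Measure.measure_pos_of_mem_nhds volume hc
          exact h1.ne' (volume_preimage_iterate_val n (f.val^[n] w))
        · filter_upwards [hDo.mem_nhds hw] with y hy hyp
          refine hLbound _ y (f.val (f.val^[n] y)) hy ?_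
          rw [hinv _ hyp, (ih y hy).2.2, mul_assoc]
      intro w hw
      obtain ⟨h1, h2, h3⟩ := ih w hw
      have hp := hpole w hw
      have hder := (f.hasDerivAt_val' hp).differentiableAt.hasDerivAt.comp w h2.hasDerivAt
      rw [Function.iterate_succ', Function.iterate_succ']
      refine ⟨?_, hder.differentiableAt, ?_⟩
      · rw [Function.comp_apply, h1, f.sphereMap_coe_of_not_isPole hp, Function.comp_apply]
      · rw [hder.deriv, Function.comp_apply, hinv _ hp, h3, mul_assoc]
  have hLip : ∀ n, ∀ w ∈ D, ∀ y ∈ D, ‖f.val^[n] y - f.val^[n] w‖ ≤ C / ε * ‖y - w‖ := by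
    intro n w hw y hy
    refine (convex_ball z₀ r).norm_image_sub_le_of_norm_deriv_le (𝕜 := ℂ)
      (fun x hx => (hmain n x hx).2.1) (fun x hx => ?_) hw hy
    exact hLbound _ x _ hx (hmain n x hx).2.2
  let : UniformSpace (OnePoint ℂ) := uniformSpaceOfCompactR1
  refine ⟨((↑) : ℂ → OnePoint ℂ) '' D, OnePoint.isOpenMap_coe D hDo,
    ⟨z₀, Metric.mem_ball_self hr, rfl⟩, ?_⟩
  rintro _ ⟨w, hw, rfl⟩ V hV
  refine Eventually.filter_mono nhdsWithin_le_nhds ?_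
  rw [OnePoint.nhds_coe_eq, eventually_map]
  obtain ⟨δ, hδ, hδV⟩ := Metric.mem_uniformity_dist.1 (uniformContinuous_coe hV)
  have hsmall : ∀ᶠ y in 𝓝 w, C / ε * ‖y - w‖ < δ := by
    have : ContinuousAt (fun y => C / ε * ‖y - w‖) w := by fun_prop
    exact this.eventually_lt_const (by simpa using hδ)
  filter_upwards [hsmall, hDo.mem_nhds hw] with y hy hyD n
  rw [(hmain n w hw).1, (hmain n y hyD).1]
  refine hδV ?_
  rw [dist_comm, dist_eq_norm]
  exact (hLip n w hw y hyD).trans_lt hy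

end RationalMap

/-! ### Injectivity of the Cauchy data -/

namespace RationalMap

variable {f : RationalMap}

lemma mem_fixedSpace_iff {ν : Lp ℂ ⊤ (volume : Measure ℂ)} : ν ∈ f.fixedSpace ↔
    (∀ᵐ z : ℂ, z ∉ f.juliaPlane → ν z = 0) ∧ ∀ᵐ z : ℂ, ν (f.val z) * f.factor z = ν z := by
  have h : f.pushforward ν = ν ↔ ∀ᵐ z : ℂ, ν (f.val z) * f.factor z = ν z := by
    rw [Lp.ext_iff]
    have h1 : (f.pushforward ν : ℂ → ℂ) =ᵐ[volume] fun z => ν (f.val z) * f.factor z :=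
      (f.memLp_pushforward ν).coeFn_toLp
    exact ⟨fun h => h1.symm.trans h, fun h => h1.trans h⟩
  rw [← h]
  exact Iff.rfl

/-- A pointwise bounded representative of an element of `L_∞(J)`, vanishing everywhere off `J`. -/
lemma exists_isBoundedDensity (hb : Bornology.IsBounded f.juliaPlane)
    {ν : Lp ℂ ⊤ (volume : Measure ℂ)} (hν : ν ∈ f.lInftyJulia) :
    ∃ (g : ℂ → ℂ) (M R : ℝ), IsBoundedDensity g M R ∧ (∀ x ∉ f.juliaPlane, g x = 0) ∧
      g =ᵐ[volume] ν := by
  obtain ⟨R, hR⟩ := hb.subset_closedBall 0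
  set M := lpNorm ν ⊤ volume with hM
  have hνm : Measurable (ν : ℂ → ℂ) := (Lp.stronglyMeasurable ν).measurable
  set S : Set ℂ := f.juliaPlane ∩ {x | ‖ν x‖ ≤ M} with hS
  have hSm : MeasurableSet S :=
    f.isClosed_juliaPlane.measurableSet.inter (measurableSet_le hνm.norm measurable_const)
  refine ⟨S.indicator ν, M, R, ⟨(hνm.indicator hSm).aestronglyMeasurable, fun x => ?_, ?_⟩, ?_, ?_⟩
  · by_cases hx : x ∈ S
    · rw [Set.indicator_of_mem hx]; exact hx.2
    · rw [Set.indicator_of_notMem hx, norm_zero]; exact lpNorm_nonneg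
  · intro x hx
    refine Set.indicator_of_notMem (fun h => ?_) _
    have := hR h.1
    rw [mem_closedBall_zero_iff] at this
    linarith
  · exact fun x hx => Set.indicator_of_notMem (fun h => hx h.1) _
  · filter_upwards [hν, ae_le_lpNorm_exponent_top (Lp.memLp ν)] with x h1 h2
    by_cases hx : x ∈ f.juliaPlane
    · have hxS : x ∈ S := ⟨hx, h2⟩
      exact Set.indicator_of_mem hxS _
    · rw [Set.indicator_of_notMem (fun h => hx h.1), h1 hx]

lemma cauchyTransform_eq {ν : Lp ℂ ⊤ (volume : Measure ℂ)} {g : ℂ → ℂ}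
    (hgJ : ∀ x ∉ f.juliaPlane, g x = 0) (hg : g =ᵐ[volume] ν) (k : ℕ) (z : ℂ) :
    f.cauchyTransform k ν z = ∫ x, g x / (z - x) ^ k := by
  rw [cauchyTransform, ← setIntegral_eq_integral_of_forall_compl_eq_zero
    (s := f.juliaPlane) (f := fun x => g x / (z - x) ^ k)
    (fun x hx => by rw [hgJ x hx, zero_div])]
  refine integral_congr_ae ?_
  filter_upwards [ae_restrict_of_ae hg] with x hx
  rw [hx]

lemma cauchyTransform_one_eq {ν : Lp ℂ ⊤ (volume : Measure ℂ)} {g : ℂ → ℂ}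
    (hgJ : ∀ x ∉ f.juliaPlane, g x = 0) (hg : g =ᵐ[volume] ν) (z : ℂ) :
    f.cauchyTransform 1 ν z = cauchyInt g z := by
  simp [cauchyTransform_eq hgJ hg, cauchyInt]

lemma integrableOn_div (hb : Bornology.IsBounded f.juliaPlane)
    {ν : Lp ℂ ⊤ (volume : Measure ℂ)} (hν : ν ∈ f.lInftyJulia) (z : ℂ) :
    IntegrableOn (fun x => ν x / (z - x)) f.juliaPlane := by
  obtain ⟨g, M, R, hg, -, hgν⟩ := exists_isBoundedDensity hb hν
  refine ((hg.integrable_div z).congr ?_).integrableOn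
  filter_upwards [hgν] with x hx
  rw [hx]

lemma exists_ball_disjoint_juliaPlane {a : ℂ} (ha : a ∉ f.juliaPlane) :
    ∃ r > 0, ∀ x ∈ Metric.ball a r, x ∉ f.juliaPlane :=
  Metric.isOpen_iff.1 f.isClosed_juliaPlane.isOpen_compl a ha

lemma integrableOn_div_pow (hb : Bornology.IsBounded f.juliaPlane)
    {ν : Lp ℂ ⊤ (volume : Measure ℂ)} (hν : ν ∈ f.lInftyJulia) {a : ℂ} (ha : a ∉ f.juliaPlane)
    (k : ℕ) : IntegrableOn (fun x => ν x / (a - x) ^ k) f.juliaPlane := by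
  obtain ⟨g, M, R, hg, hgJ, hgν⟩ := exists_isBoundedDensity hb hν
  obtain ⟨r, hr, hball⟩ := exists_ball_disjoint_juliaPlane ha
  refine ((hg.integrable_div_pow hr (fun x hx => hgJ x (hball x hx)) k).congr ?_).integrableOn
  filter_upwards [hgν] with x hx
  rw [hx]

lemma IsNormalizedAt.infty_mem_fatouSet {a : ℂ} (h : f.IsNormalizedAt a) :
    OnePoint.infty ∈ f.fatouSet := by
  obtain ⟨⟨U, ⟨⟨x, -, rfl⟩, -⟩, hU⟩, -⟩ := h
  exact connectedComponentIn_subset _ _ hU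

lemma IsNormalizedAt.notMem_juliaPlane {a : ℂ} (h : f.IsNormalizedAt a) : a ∉ f.juliaPlane := by
  have := f.sphereMap_mem_fatouSet h.infty_mem_fatouSet
  rw [h.2.1] at this
  exact fun ha => ha this

lemma infty_mem_fatouSet {a : ℂ} (hnorm : ¬ f.IsPolynomial → f.IsNormalizedAt a) :
    OnePoint.infty ∈ f.fatouSet := by
  by_cases h : f.IsPolynomial
  · exact h.infty_mem_fatouSet
  · exact (hnorm h).infty_mem_fatouSet

/-- An element of `Fix(f^*)` whose Cauchy transform vanishes at the critical values, and to third
order at `a` when `f` is not a polynomial, is zero. -/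
lemma eq_zero_of_cauchyTransform_eq_zero {a : ℂ} (hnorm : ¬ f.IsPolynomial → f.IsNormalizedAt a)
    {ν : Lp ℂ ⊤ (volume : Measure ℂ)} (hν : ν ∈ f.fixedSpace)
    (hcrit : ∀ v ∈ f.finiteCriticalValues, f.cauchyTransform 1 ν v = 0)
    (ha : ¬ f.IsPolynomial → ∀ k ∈ ({1, 2, 3} : Set ℕ), f.cauchyTransform k ν a = 0) :
    ν = 0 := by
  obtain ⟨g, M, R, hg, hgJ, hgν⟩ :=
    exists_isBoundedDensity (f.isBounded_juliaPlane (infty_mem_fatouSet hnorm)) hν.1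
  have hinv : ∀ᵐ x, g (f.val x) * f.factor x = g x := by
    filter_upwards [(mem_fixedSpace_iff.1 hν).2, hgν, f.quasiMeasurePreserving_val.ae hgν]
      with x h1 h2 h3
    rw [h2, h3, h1]
  have hinf : Tendsto (fun z => cauchyInt g (f.val z) / deriv f.val z) (cocompact ℂ) (𝓝 0) := by
    by_cases h : f.IsPolynomial
    · exact h.tendsto_cauchyInt_div_deriv hg
    · obtain ⟨r, hr, hball⟩ := exists_ball_disjoint_juliaPlane (hnorm h).notMem_juliaPlane
      obtain ⟨C, hC⟩ := hg.exists_norm_cauchyInt_le_cube hr (fun x hx => hgJ x (hball x hx))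
        fun k hk => by rw [← cauchyTransform_eq hgJ hgν]; exact ha h k hk
      exact (hnorm h).tendsto_cauchyInt_div_deriv (half_pos hr) hC
  have hvec : ∀ z, ¬ f.IsPole z → cauchyInt g (f.val z) = deriv f.val z * cauchyInt g z :=
    fun z hz => f.cauchyInt_comp_eq_deriv_mul hg hinv
      (fun v hv => by rw [← cauchyTransform_one_eq hgJ hgν]; exact hcrit v hv) hinf hz
  obtain ⟨C, hC⟩ := hg.exists_norm_cauchyInt_le
  have hJ : ∀ z ∈ f.juliaPlane, cauchyInt g z = 0 := fun z hz =>
    eq_zero_of_mem_juliaPlane hg.continuous_cauchyInt hC hvec hz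
  have h0 := hg.ae_eq_zero_of_cauchyInt_eq_zero
    (hg.cauchyInt_eq_zero_of_eqOn f.isClosed_juliaPlane hgJ hJ)
  rw [Lp.eq_zero_iff_ae_eq_zero]
  filter_upwards [h0, hgν] with x h1 h2
  rw [← h2, h1, Pi.zero_apply]

lemma cauchyTransform_add {k : ℕ} {z : ℂ} {ν ν' : Lp ℂ ⊤ (volume : Measure ℂ)}
    (h : IntegrableOn (fun x => ν x / (z - x) ^ k) f.juliaPlane)
    (h' : IntegrableOn (fun x => ν' x / (z - x) ^ k) f.juliaPlane) :
    f.cauchyTransform k (ν + ν') z = f.cauchyTransform k ν z + f.cauchyTransform k ν' z := by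
  unfold cauchyTransform
  rw [← integral_add h h']
  refine integral_congr_ae ?_
  filter_upwards [ae_restrict_of_ae (Lp.coeFn_add ν ν')] with x hx
  rw [hx, Pi.add_apply, add_div]

lemma cauchyTransform_smul {k : ℕ} {z : ℂ} (c : ℂ) (ν : Lp ℂ ⊤ (volume : Measure ℂ)) :
    f.cauchyTransform k (c • ν) z = c * f.cauchyTransform k ν z := by
  unfold cauchyTransform
  rw [← integral_const_mul]
  refine integral_congr_ae ?_
  filter_upwards [ae_restrict_of_ae (Lp.coeFn_smul c ν)] with x hx
  rw [hx, Pi.smul_apply, smul_eq_mul, mul_div_assoc]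

lemma isLinearMap_cauchyData {a : ℂ} (hnorm : ¬ f.IsPolynomial → f.IsNormalizedAt a) {p : ℕ}
    (v : Fin p → ℂ) : IsLinearMap ℂ (f.cauchyData v a) := by
  have hb := f.isBounded_juliaPlane (infty_mem_fatouSet hnorm)
  have h1 : ∀ (ν : f.fixedSpace) (z : ℂ),
      IntegrableOn (fun x => ν.1 x / (z - x) ^ 1) f.juliaPlane := fun ν z => by
    simpa only [pow_one] using integrableOn_div hb ν.2.1 z
  constructor
  · intro ν ν'
    ext j
    induction j using Fin.addCases with
    | left j =>
      simp only [cauchyData, Fin.append_left, Pi.add_apply, Submodule.coe_add]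
      exact cauchyTransform_add (h1 ν _) (h1 ν' _)
    | right j =>
      simp only [cauchyData, Fin.append_right, Pi.add_apply, Submodule.coe_add]
      by_cases h : f.IsPolynomial
      · simp [h]
      · have hk : ∀ (k : ℕ) (μ : f.fixedSpace),
            IntegrableOn (fun x => μ.1 x / (a - x) ^ k) f.juliaPlane := fun k μ =>
          integrableOn_div_pow hb μ.2.1 (hnorm h).notMem_juliaPlane k
        simp only [if_neg h]
        fin_cases j <;> exact cauchyTransform_add (hk _ ν) (hk _ ν')
  · intro c ν
    ext j
    induction j using Fin.addCases with
    | left j =>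
      simp only [cauchyData, Fin.append_left, Pi.smul_apply, Submodule.coe_smul, smul_eq_mul]
      exact cauchyTransform_smul c ν.1
    | right j =>
      simp only [cauchyData, Fin.append_right, Pi.smul_apply, Submodule.coe_smul, smul_eq_mul]
      by_cases h : f.IsPolynomial
      · simp [h]
      · simp only [if_neg h]
        fin_cases j <;> exact cauchyTransform_smul c ν.1

lemma injective_cauchyData {a : ℂ} (hnorm : ¬ f.IsPolynomial → f.IsNormalizedAt a) {p : ℕ}
    {v : Fin p → ℂ} (hrange : Set.range v = f.finiteCriticalValues) :
    Function.Injective (f.cauchyData v a) := by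
  set L := (isLinearMap_cauchyData hnorm v).mk' (f.cauchyData v a) with hL
  change Function.Injective L
  rw [injective_iff_map_eq_zero]
  intro ν hν
  have hν' : f.cauchyData v a ν = 0 := hν
  refine Subtype.ext (eq_zero_of_cauchyTransform_eq_zero hnorm ν.2 ?_ ?_)
  · rw [← hrange]
    rintro _ ⟨j, rfl⟩
    have := congrFun hν' (Fin.castAdd 3 j)
    simpa only [cauchyData, Fin.append_left, Pi.zero_apply] using this
  · intro h
    have hj : ∀ j : Fin 3, ![f.cauchyTransform 1 ν.1 a, f.cauchyTransform 2 ν.1 a,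
        f.cauchyTransform 3 ν.1 a] j = 0 := fun j => by
      have := congrFun hν' (Fin.natAdd p j)
      simpa only [cauchyData, Fin.append_right, if_neg h, Pi.zero_apply] using this
    rintro k (rfl | rfl | rfl)
    · exact hj 0
    · exact hj 1
    · exact hj 2

lemma finiteDimensional_fixedSpace {a : ℂ} (hnorm : ¬ f.IsPolynomial → f.IsNormalizedAt a) {p : ℕ}
    {v : Fin p → ℂ} (hrange : Set.range v = f.finiteCriticalValues) :
    FiniteDimensional ℂ f.fixedSpace :=
  FiniteDimensional.of_injective ((isLinearMap_cauchyData hnorm v).mk' (f.cauchyData v a))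
    (injective_cauchyData hnorm hrange)

end RationalMap

/-! ### Ergodic decomposition of the fixed space -/

namespace RationalMap

variable {f : RationalMap}

lemma ae_not_isPole : ∀ᵐ z : ℂ, ¬ f.IsPole z := by
  filter_upwards [measure_eq_zero_iff_ae_notMem.1 (f.finite_bad.measure_zero volume)] with z hz h
  exact hz (Or.inl h)

lemma ae_norm_factor_eq_one : ∀ᵐ z : ℂ, ‖f.factor z‖ = 1 := by
  filter_upwards [measure_eq_zero_iff_ae_notMem.1 (f.finite_bad.measure_zero volume)] with z hz
  have hp : ¬ f.IsPole z := fun h => hz (Or.inl h)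
  have hd : deriv f.val z ≠ 0 := fun h => hz (Or.inr ((f.deriv_val_eq_zero_iff hp).1 h))
  have : ‖deriv f.val z‖ ≠ 0 := norm_ne_zero_iff.2 hd
  simp only [factor, norm_div, norm_pow, Complex.norm_real, norm_norm]
  field_simp

lemma isCompletelyInvariant_iff {E : Set ℂ} : f.IsCompletelyInvariant E ↔
    ∀ x, f.sphereMap x ∈ ((↑) '' E : Set (OnePoint ℂ)) ↔ x ∈ ((↑) '' E : Set (OnePoint ℂ)) :=
  Set.ext_iff

namespace IsCompletelyInvariant

variable {E E' : Set ℂ}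

lemma ae_val_mem_iff (h : f.IsCompletelyInvariant E) : ∀ᵐ z : ℂ, f.val z ∈ E ↔ z ∈ E := by
  filter_upwards [ae_not_isPole (f := f)] with z hz
  have := isCompletelyInvariant_iff.1 h z
  rwa [f.sphereMap_coe_of_not_isPole hz, OnePoint.coe_injective.mem_set_image,
    OnePoint.coe_injective.mem_set_image] at this

lemma sdiff (h : f.IsCompletelyInvariant E) (h' : f.IsCompletelyInvariant E') :
    f.IsCompletelyInvariant (E \ E') := by
  unfold IsCompletelyInvariant at *
  rw [Set.image_sdiff OnePoint.coe_injective, Set.preimage_sdiff, h, h']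

lemma inter (h : f.IsCompletelyInvariant E) (h' : f.IsCompletelyInvariant E') :
    f.IsCompletelyInvariant (E ∩ E') := by
  unfold IsCompletelyInvariant at *
  rw [Set.image_inter OnePoint.coe_injective, Set.preimage_inter, h, h']

lemma iUnion {ι : Sort*} {E : ι → Set ℂ} (h : ∀ i, f.IsCompletelyInvariant (E i)) :
    f.IsCompletelyInvariant (⋃ i, E i) := by
  unfold IsCompletelyInvariant at *
  rw [Set.image_iUnion, Set.preimage_iUnion, Set.iUnion_congr h]

end IsCompletelyInvariant

/-- A measurable subset of `J` which is invariant up to null sets agrees almost everywhere with a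
completely invariant set, the set of points whose orbit eventually stays in it. -/
lemma exists_isCompletelyInvariant (hinf : OnePoint.infty ∈ f.fatouSet) {S : Set ℂ}
    (hS : MeasurableSet S) (hSJ : S ⊆ f.juliaPlane) (hinv : ∀ᵐ z : ℂ, f.val z ∈ S ↔ z ∈ S) :
    ∃ E, MeasurableSet E ∧ E ⊆ f.juliaPlane ∧ f.IsCompletelyInvariant E ∧
      ∀ᵐ z : ℂ, z ∈ E ↔ z ∈ S := by
  set S' : Set (OnePoint ℂ) := (↑) '' S with hS'
  have hfatou : ∀ x ∈ f.fatouSet, ∀ n, f.sphereMap^[n] x ∉ S' := by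
    rintro x hx n ⟨z, hz, hzx⟩
    have := f.iterate_sphereMap_mem_fatouSet hx n
    rw [← hzx] at this
    exact hSJ hz this
  set T : ℕ → Set ℂ := fun n => {z | f.sphereMap^[n] (z : OnePoint ℂ) ∈ S'} with hT
  have hT0 : T 0 = S := by
    ext z
    simp [hT, hS']
  have hTs : ∀ n, T (n + 1) = {z | ¬ f.IsPole z} ∩ f.val ⁻¹' T n := by
    intro n
    ext z
    simp only [hT, Set.mem_ofPred_eq, Set.mem_inter_iff, Set.mem_preimage, Function.iterate_succ_apply]
    by_cases hz : f.IsPole z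
    · rw [f.sphereMap_coe_of_isPole hz]
      simp [hz, hfatou _ hinf n]
    · rw [f.sphereMap_coe_of_not_isPole hz]
      simp [hz]
  have hTm : ∀ n, MeasurableSet (T n) := by
    intro n
    induction n with
    | zero => rw [hT0]; exact hS
    | succ n ih =>
      rw [hTs]
      exact f.isOpen_not_isPole.measurableSet.inter (f.measurable_val ih)
  have hTae : ∀ n, ∀ᵐ z : ℂ, z ∈ T n ↔ z ∈ S := by
    intro n
    induction n with
    | zero => rw [hT0]; exact Eventually.of_forall fun _ => Iff.rfl
    | succ n ih =>
      filter_upwards [f.quasiMeasurePreserving_val.ae ih, hinv, ae_not_isPole (f := f)]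
        with z h1 h2 h3
      rw [hTs, ← h2, ← h1]
      exact and_iff_right h3
  set B : Set (OnePoint ℂ) := {x | ∃ N, ∀ n, N ≤ n → f.sphereMap^[n] x ∈ S'} with hB
  have hBfatou : ∀ x ∈ B, x ∉ f.fatouSet := fun x ⟨N, hN⟩ hx => hfatou x hx N (hN N le_rfl)
  have hBinv : ∀ x, f.sphereMap x ∈ B ↔ x ∈ B := by
    intro x
    constructor
    · rintro ⟨N, hN⟩
      refine ⟨N + 1, fun n hn => ?_⟩
      obtain ⟨k, rfl⟩ : ∃ k, n = k + 1 := ⟨n - 1, by omega⟩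
      exact hN k (by omega)
    · rintro ⟨N, hN⟩
      exact ⟨N, fun n hn => hN (n + 1) (by omega)⟩
  have hBE : ((↑) '' {z : ℂ | (z : OnePoint ℂ) ∈ B} : Set (OnePoint ℂ)) = B := by
    ext x
    constructor
    · rintro ⟨z, hz, rfl⟩
      exact hz
    · intro hx
      induction x using OnePoint.rec with
      | infty => exact absurd hinf (hBfatou _ hx)
      | coe z => exact ⟨z, hx, rfl⟩
  refine ⟨{z : ℂ | (z : OnePoint ℂ) ∈ B}, ?_, fun z hz => hBfatou _ hz, ?_, ?_⟩
  · have : {z : ℂ | (z : OnePoint ℂ) ∈ B} = ⋃ N, ⋂ n, ⋂ (_ : N ≤ n), T n := by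
      ext z
      simp [hB, hT]
    rw [this]
    exact MeasurableSet.iUnion fun N => MeasurableSet.iInter fun n => MeasurableSet.iInter fun _ =>
      hTm n
  · rw [isCompletelyInvariant_iff, hBE]
    exact hBinv
  · filter_upwards [ae_all_iff.2 hTae] with z hz
    exact ⟨fun ⟨N, hN⟩ => (hz N).1 (hN N le_rfl), fun h => ⟨0, fun n _ => (hz n).2 h⟩⟩

lemma exists_mem_fixedSpace {h : ℂ → ℂ} (hm : AEStronglyMeasurable h volume) {C : ℝ}
    (hC : ∀ z, ‖h z‖ ≤ C) (hJ : ∀ᵐ z : ℂ, z ∉ f.juliaPlane → h z = 0)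
    (hinv : ∀ᵐ z : ℂ, h (f.val z) * f.factor z = h z) :
    ∃ ν ∈ f.fixedSpace, (ν : ℂ → ℂ) =ᵐ[volume] h := by
  have hLp : MemLp h ⊤ volume := memLp_top_of_bound hm C (Eventually.of_forall hC)
  refine ⟨hLp.toLp h, mem_fixedSpace_iff.2 ⟨?_, ?_⟩, hLp.coeFn_toLp⟩
  · filter_upwards [hLp.coeFn_toLp, hJ] with z h1 h2 hz
    rw [h1, h2 hz]
  · filter_upwards [hLp.coeFn_toLp, hinv, f.quasiMeasurePreserving_val.ae hLp.coeFn_toLp]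
      with z h1 h2 h3
    rw [h1, h3, h2]

/-- Normalizing the restriction of a fixed point of `f^*` to an invariant set to have modulus one
yields an invariant line field. -/
lemma exists_isInvariantLineField {ν : Lp ℂ ⊤ (volume : Measure ℂ)} (hν : ν ∈ f.fixedSpace)
    {A : Set ℂ} (hA : MeasurableSet A) (hinv : ∀ᵐ z : ℂ, f.val z ∈ A ↔ z ∈ A)
    (hpos : volume (A ∩ {z | ν z ≠ 0}) ≠ 0) :
    ∃ μ : Lp ℂ ⊤ (volume : Measure ℂ), f.IsInvariantLineField μ ∧
      ∀ᵐ z : ℂ, μ z ≠ 0 ↔ z ∈ A ∧ ν z ≠ 0 := by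
  rw [mem_fixedSpace_iff] at hν
  set h : ℂ → ℂ := A.indicator fun z => ν z / (‖ν z‖ : ℂ) with hh
  have hνm : Measurable (ν : ℂ → ℂ) := (Lp.stronglyMeasurable ν).measurable
  have hm : Measurable h := (hνm.div (Complex.measurable_ofReal.comp hνm.norm)).indicator hA
  have h1 : ∀ z, z ∈ A → ν z ≠ 0 → ‖h z‖ = 1 := by
    intro z hz hz0
    rw [hh, Set.indicator_of_mem hz, norm_div, Complex.norm_real, norm_norm,
      div_self (norm_ne_zero_iff.2 hz0)]
  have h0 : ∀ z, ¬ (z ∈ A ∧ ν z ≠ 0) → h z = 0 := by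
    intro z hz
    by_cases hzA : z ∈ A
    · have : ν z = 0 := by_contra fun hc => hz ⟨hzA, hc⟩
      rw [hh, Set.indicator_of_mem hzA, this, zero_div]
    · rw [hh, Set.indicator_of_notMem hzA]
  have hle : ∀ z, ‖h z‖ ≤ 1 := by
    intro z
    by_cases hc : z ∈ A ∧ ν z ≠ 0
    · exact (h1 z hc.1 hc.2).le
    · rw [h0 z hc, norm_zero]; exact zero_le_one
  have hhJ : ∀ᵐ z : ℂ, z ∉ f.juliaPlane → h z = 0 := by
    filter_upwards [hν.1] with z hz hzJ
    exact h0 z fun hc => hc.2 (hz hzJ)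
  have hhinv : ∀ᵐ z : ℂ, h (f.val z) * f.factor z = h z := by
    filter_upwards [hν.2, hinv, ae_norm_factor_eq_one (f := f)] with z hz hzA hfac
    by_cases hc : z ∈ A
    · rw [hh, Set.indicator_of_mem hc, Set.indicator_of_mem (hzA.2 hc), ← hz, norm_mul, hfac,
        mul_one]
      ring
    · rw [hh, Set.indicator_of_notMem hc, Set.indicator_of_notMem fun h => hc (hzA.1 h), zero_mul]
  obtain ⟨μ, hμ, hμh⟩ := exists_mem_fixedSpace hm.aestronglyMeasurable hle hhJ hhinv
  refine ⟨μ, ⟨hμ, ?_, ?_⟩, ?_⟩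
  · filter_upwards [hμh] with z hz
    rw [hz]
    by_cases hc : z ∈ A ∧ ν z ≠ 0
    · exact Or.inl (h1 z hc.1 hc.2)
    · exact Or.inr (h0 z hc)
  · refine (pos_iff_ne_zero.2 hpos).trans_le (measure_mono_ae ?_)
    filter_upwards [hμh] with z hz hc
    change ‖μ z‖ = 1
    rw [hz]
    exact h1 z hc.1 hc.2
  · filter_upwards [hμh] with z hz
    rw [hz]
    refine ⟨fun hne => by_contra fun hc => hne (h0 z hc), fun hc hne => ?_⟩
    have := h1 z hc.1 hc.2
    rw [hne, norm_zero] at this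
    exact zero_ne_one this

/-- The invariant line fields of the family have pairwise disjoint supports, up to null sets. -/
def IsDisjointFamily (f : RationalMap) {m : ℕ} (μ : Fin m → Lp ℂ ⊤ (volume : Measure ℂ)) : Prop :=
  (∀ i, f.IsInvariantLineField (μ i)) ∧ ∀ i j, i ≠ j → ∀ᵐ z : ℂ, μ i z = 0 ∨ μ j z = 0

lemma ae_sum_smul_eq {m : ℕ} (μ : Fin m → Lp ℂ ⊤ (volume : Measure ℂ)) (c : Fin m → ℂ) :
    ∀ᵐ z : ℂ, (∑ i, c i • μ i : Lp ℂ ⊤ (volume : Measure ℂ)) z = ∑ i, c i * μ i z := by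
  filter_upwards [Lp.coeFn_finsetSum Finset.univ fun i => c i • μ i,
    ae_all_iff.2 fun i => Lp.coeFn_smul (c i) (μ i)] with z h1 h2
  rw [h1, Finset.sum_apply]
  exact Finset.sum_congr rfl fun i _ => by rw [h2, Pi.smul_apply, smul_eq_mul]

namespace IsDisjointFamily

variable {m : ℕ} {μ : Fin m → Lp ℂ ⊤ (volume : Measure ℂ)}

lemma linearIndependent (h : f.IsDisjointFamily μ) : LinearIndependent ℂ μ := by
  rw [Fintype.linearIndependent_iff]
  intro c hc i
  by_contra hci
  refine (h.1 i).2.2.ne' (measure_eq_zero_iff_ae_notMem.2 ?_)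
  have h0 := Lp.coeFn_zero ℂ ⊤ (volume : Measure ℂ)
  rw [← hc] at h0
  have hd : ∀ᵐ z : ℂ, ∀ j, j ≠ i → μ i z = 0 ∨ μ j z = 0 :=
    ae_all_iff.2 fun j => by
      by_cases hj : j = i
      · exact Eventually.of_forall fun _ hne => absurd hj hne
      · filter_upwards [h.2 i j (Ne.symm hj)] with z hz _ using hz
  filter_upwards [h0, ae_sum_smul_eq μ c, hd] with z h1 h2 h3 hz
  have hz : ‖μ i z‖ = 1 := hz
  have hne : μ i z ≠ 0 := fun h => by rw [h, norm_zero] at hz; exact zero_ne_one hz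
  rw [h2, Finset.sum_eq_single i (fun j _ hj => by rw [(h3 j hj).resolve_left hne, mul_zero])
    (by simp), Pi.zero_apply] at h1
  exact (mul_ne_zero hci hne) h1

lemma cons (h : f.IsDisjointFamily μ) {μ' : Lp ℂ ⊤ (volume : Measure ℂ)}
    (h' : f.IsInvariantLineField μ') (hd : ∀ i, ∀ᵐ z : ℂ, μ' z = 0 ∨ μ i z = 0) :
    f.IsDisjointFamily (Fin.cons μ' μ : Fin (m + 1) → Lp ℂ ⊤ (volume : Measure ℂ)) := by
  refine ⟨fun i => ?_, fun i j hij => ?_⟩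
  · refine Fin.cases h' (fun i => ?_) i
    exact h.1 i
  · induction i using Fin.cases with
    | zero =>
      induction j using Fin.cases with
      | zero => exact absurd rfl hij
      | succ j => exact hd j
    | succ i =>
      induction j using Fin.cases with
      | zero => filter_upwards [hd i] with z hz using hz.symm
      | succ j => exact h.2 i j fun e => hij (by rw [e])

lemma update (h : f.IsDisjointFamily μ) {i : Fin m} {μ' : Lp ℂ ⊤ (volume : Measure ℂ)}
    (h' : f.IsInvariantLineField μ') (hd : ∀ᵐ z : ℂ, μ' z ≠ 0 → μ i z ≠ 0) :
    f.IsDisjointFamily (Function.update μ i μ') := by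
  have key : ∀ j, j ≠ i → ∀ᵐ z : ℂ, μ' z = 0 ∨ μ j z = 0 := by
    intro j hj
    filter_upwards [h.2 j i hj, hd] with z h1 h2
    by_cases h0 : μ' z = 0
    · exact Or.inl h0
    · exact Or.inr (h1.resolve_right (h2 h0))
  refine ⟨fun j => ?_, fun j k hjk => ?_⟩
  · by_cases hj : j = i
    · subst hj; rwa [Function.update_self]
    · rw [Function.update_of_ne hj]; exact h.1 j
  · by_cases hj : j = i
    · subst hj
      rw [Function.update_self, Function.update_of_ne hjk.symm]
      exact key k hjk.symm
    · rw [Function.update_of_ne hj]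
      by_cases hk : k = i
      · subst hk
        rw [Function.update_self]
        filter_upwards [key j hj] with z hz using hz.symm
      · rw [Function.update_of_ne hk]
        exact h.2 j k hjk

end IsDisjointFamily

lemma exists_maximal_isDisjointFamily [FiniteDimensional ℂ f.fixedSpace] :
    ∃ (m : ℕ) (μ : Fin m → Lp ℂ ⊤ (volume : Measure ℂ)), f.IsDisjointFamily μ ∧
      ∀ μ' : Fin (m + 1) → Lp ℂ ⊤ (volume : Measure ℂ), ¬ f.IsDisjointFamily μ' := by
  classical
  have hbound : ∃ n, ¬ ∃ μ : Fin n → Lp ℂ ⊤ (volume : Measure ℂ), f.IsDisjointFamily μ := by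
    refine ⟨Module.finrank ℂ f.fixedSpace + 1, ?_⟩
    rintro ⟨μ, hμ⟩
    set μ' : Fin (Module.finrank ℂ f.fixedSpace + 1) → f.fixedSpace :=
      fun i => ⟨μ i, (hμ.1 i).1⟩ with hμ'
    have hli : LinearIndependent ℂ μ' :=
      LinearIndependent.of_comp f.fixedSpace.subtype hμ.linearIndependent
    have := hli.fintype_card_le_finrank
    simp at this
  have hfind := Nat.find_spec hbound
  have hmin := fun k => Nat.find_min hbound (m := k)
  generalize Nat.find hbound = n at hfind hmin
  obtain _ | m := n
  · exact absurd ⟨Fin.elim0, fun i => i.elim0, fun i => i.elim0⟩ hfind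
  · obtain ⟨μ, hμ⟩ := not_not.1 (hmin m (Nat.lt_succ_self m))
    exact ⟨m, μ, hμ, fun μ' h => hfind ⟨μ', h⟩⟩

namespace IsErgodicSubset

variable {E : Set ℂ}

/-- Invariant functions are constant on ergodic sets. -/
lemma exists_ae_eq_const (hE : f.IsErgodicSubset E) (hinf : OnePoint.infty ∈ f.fatouSet)
    {q : ℂ → ℂ} (hq : Measurable q) (hinv : ∀ᵐ z : ℂ, q (f.val z) = q z) :
    ∃ t, ∀ᵐ z : ℂ, z ∈ E → q z = t := by
  obtain ⟨hEm, hEJ, -, hEinv, herg⟩ := hE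
  obtain ⟨t, ht⟩ := exists_eventuallyEq_const_of_forall_separating (l := ae (volume.restrict E))
    (f := q) MeasurableSet fun U hU => by
      obtain ⟨A, hAm, -, hAinv, hAae⟩ := exists_isCompletelyInvariant hinf (hEm.inter (hq hU))
        (Set.inter_subset_left.trans hEJ) (by
          filter_upwards [hinv, hEinv.ae_val_mem_iff] with z h1 h2
          simp only [Set.mem_inter_iff, Set.mem_preimage, h1, h2])
      rw [ae_restrict_iff' hEm, ae_restrict_iff' hEm]
      rcases herg (E ∩ A) Set.inter_subset_left (hEm.inter hAm) (hEinv.inter hAinv) with h | h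
      · right
        filter_upwards [hAae, measure_eq_zero_iff_ae_notMem.1 h] with z h1 h2 hzE hzU
        exact h2 ⟨hzE, h1.2 ⟨hzE, hzU⟩⟩
      · left
        filter_upwards [hAae, measure_eq_zero_iff_ae_notMem.1 h] with z h1 h2 hzE
        by_contra hzU
        exact h2 ⟨hzE, fun hz => hzU (h1.1 hz.2).2⟩
  refine ⟨t, ?_⟩
  rw [EventuallyEq, ae_restrict_iff' hEm] at ht
  exact ht

/-- On an ergodic set carrying an invariant line field `μ`, every fixed point of `f^*` is a constant
multiple of `μ`, since the quotient is an invariant function. -/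
lemma exists_ae_eq_mul (hE : f.IsErgodicSubset E) (hinf : OnePoint.infty ∈ f.fatouSet)
    {μ ν : Lp ℂ ⊤ (volume : Measure ℂ)} (hμ : f.IsInvariantLineField μ)
    (hμE : ∀ᵐ z : ℂ, z ∈ E → μ z ≠ 0) (hν : ν ∈ f.fixedSpace) :
    ∃ t, ∀ᵐ z : ℂ, z ∈ E → ν z = t * μ z := by
  obtain ⟨t, ht⟩ := hE.exists_ae_eq_const hinf (q := fun z => ν z / μ z)
    ((Lp.stronglyMeasurable ν).measurable.div (Lp.stronglyMeasurable μ).measurable) (by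
      filter_upwards [(mem_fixedSpace_iff.1 hν).2, (mem_fixedSpace_iff.1 hμ.1).2,
        ae_norm_factor_eq_one (f := f)] with z h1 h2 h3
      rw [← h1, ← h2, mul_div_mul_right]
      intro h0
      rw [h0, norm_zero] at h3
      exact zero_ne_one h3)
  refine ⟨t, ?_⟩
  filter_upwards [ht, hμE] with z h1 h2 hz
  rw [← h1 hz, div_mul_cancel₀ _ (h2 hz)]

end IsErgodicSubset

/-- The support of an invariant line field is a completely invariant set, up to a null set. -/
lemma IsInvariantLineField.exists_isCompletelyInvariant {μ : Lp ℂ ⊤ (volume : Measure ℂ)}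
    (hμ : f.IsInvariantLineField μ) (hinf : OnePoint.infty ∈ f.fatouSet) :
    ∃ E, MeasurableSet E ∧ E ⊆ f.juliaPlane ∧ f.IsCompletelyInvariant E ∧
      ∀ᵐ z : ℂ, z ∈ E ↔ μ z ≠ 0 := by
  have hfix := mem_fixedSpace_iff.1 hμ.1
  have hm : MeasurableSet {z | μ z ≠ 0} :=
    (Lp.stronglyMeasurable μ).measurable (measurableSet_singleton 0).compl
  have hae : ∀ᵐ z : ℂ, z ∈ f.juliaPlane ∩ {z | μ z ≠ 0} ↔ μ z ≠ 0 := by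
    filter_upwards [hfix.1] with z hz
    exact ⟨fun h => h.2, fun h => ⟨by_contra fun hJ => h (hz hJ), h⟩⟩
  obtain ⟨E, h1, h2, h3, h4⟩ := RationalMap.exists_isCompletelyInvariant hinf
    (f.isClosed_juliaPlane.measurableSet.inter hm) Set.inter_subset_left (by
      filter_upwards [hae, f.quasiMeasurePreserving_val.ae hae, hfix.2,
        ae_norm_factor_eq_one (f := f)] with z h1 h2 h3 h4
      rw [h1, h2, ← h3]
      have : f.factor z ≠ 0 := fun h0 => by rw [h0, norm_zero] at h4; exact zero_ne_one h4
      simp [this])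
  refine ⟨E, h1, h2, h3, ?_⟩
  filter_upwards [hae, h4] with z h5 h6
  rw [h6, h5]

/-- A maximal family of invariant line fields with disjoint supports consists of ergodic ones and
spans the fixed space. -/
lemma exists_ergodic_decomposition [FiniteDimensional ℂ f.fixedSpace]
    (hinf : OnePoint.infty ∈ f.fatouSet) :
    ∃ (m : ℕ) (E : Fin m → Set ℂ) (μ : Fin m → Lp ℂ ⊤ (volume : Measure ℂ)),
      Pairwise (fun i j => Disjoint (E i) (E j)) ∧ (∀ i, f.IsErgodicLineField (E i) (μ i)) ∧
      LinearIndependent ℂ μ ∧ ∀ ν ∈ f.fixedSpace, ∃ t : Fin m → ℂ, ν = ∑ i, t i • μ i := by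
  obtain ⟨m, μ, hμ, hmax⟩ := exists_maximal_isDisjointFamily (f := f)
  have hno : ∀ (μ₁ : Fin m → Lp ℂ ⊤ (volume : Measure ℂ)) (μ' : Lp ℂ ⊤ (volume : Measure ℂ)),
      f.IsDisjointFamily μ₁ → f.IsInvariantLineField μ' →
      ¬ ∀ i, ∀ᵐ z : ℂ, μ' z = 0 ∨ μ₁ i z = 0 := fun μ₁ μ' h1 h2 h3 => hmax _ (h1.cons h2 h3)
  choose E' hE'm hE'J hE'inv hE'ae using fun i => (hμ.1 i).exists_isCompletelyInvariant hinf
  set E : Fin m → Set ℂ := fun i => E' i \ ⋃ j, ⋃ (_ : j ≠ i), E' j with hE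
  have hEinv : ∀ i, f.IsCompletelyInvariant (E i) := fun i =>
    (hE'inv i).sdiff (.iUnion fun j => .iUnion fun _ => hE'inv j)
  have hEm : ∀ i, MeasurableSet (E i) := fun i =>
    (hE'm i).diff (.iUnion fun j => .iUnion fun _ => hE'm j)
  have hEdisj : Pairwise fun i j => Disjoint (E i) (E j) := by
    intro i j hij
    rw [Set.disjoint_left]
    rintro z ⟨-, hz⟩ ⟨hz', -⟩
    exact hz (Set.mem_iUnion₂.2 ⟨j, hij.symm, hz'⟩)
  have hEae : ∀ i, ∀ᵐ z : ℂ, z ∈ E i ↔ μ i z ≠ 0 := by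
    intro i
    have hd : ∀ᵐ z : ℂ, ∀ j, j ≠ i → μ i z = 0 ∨ μ j z = 0 := ae_all_iff.2 fun j => by
      by_cases hj : j = i
      · exact Eventually.of_forall fun _ hne => absurd hj hne
      · filter_upwards [hμ.2 i j (Ne.symm hj)] with z hz _ using hz
    filter_upwards [ae_all_iff.2 hE'ae, hd] with z h1 h2
    rw [← h1 i]
    refine ⟨fun h => h.1, fun h => ⟨h, fun hz => ?_⟩⟩
    obtain ⟨j, hj, hzj⟩ := Set.mem_iUnion₂.1 hz
    rcases h2 j hj with h3 | h3
    · exact (h1 i).1 h h3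
    · exact (h1 j).1 hzj h3
  have hpos : ∀ i, 0 < volume (E i) := by
    intro i
    refine (hμ.1 i).2.2.trans_le (measure_mono_ae ?_)
    filter_upwards [hEae i] with z hz h1
    have h1 : ‖μ i z‖ = 1 := h1
    exact hz.2 fun h0 => by rw [h0, norm_zero] at h1; exact zero_ne_one h1
  have herg : ∀ i, f.IsErgodicSubset (E i) := by
    refine fun i => ⟨hEm i, Set.sdiff_subset.trans (hE'J i), hpos i, hEinv i, ?_⟩
    intro A hAE hAm hAinv
    by_contra hA
    push Not at hA
    -- otherwise `μ i` splits into two line fields, contradicting maximality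
    have hsplit : ∀ B ⊆ E i, MeasurableSet B → f.IsCompletelyInvariant B → volume B ≠ 0 →
        ∃ μ' : Lp ℂ ⊤ (volume : Measure ℂ), f.IsInvariantLineField μ' ∧
          ∀ᵐ z : ℂ, μ' z ≠ 0 ↔ z ∈ B ∧ μ i z ≠ 0 := fun B hBE hBm hBinv hB0 => by
      refine exists_isInvariantLineField (hμ.1 i).1 hBm hBinv.ae_val_mem_iff fun h0 => hB0 ?_
      rw [measure_eq_zero_iff_ae_notMem] at h0 ⊢
      filter_upwards [h0, hEae i] with z h1 h2 hzB
      exact h1 ⟨hzB, h2.1 (hBE hzB)⟩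
    obtain ⟨μ₁, h1, h1'⟩ := hsplit A hAE hAm hAinv hA.1
    obtain ⟨μ₂, h2, h2'⟩ := hsplit (E i \ A) Set.sdiff_subset ((hEm i).diff hAm)
      ((hEinv i).sdiff hAinv) hA.2
    refine hno (Function.update μ i μ₂) μ₁ (hμ.update h2 ?_) h1 fun j => ?_
    · filter_upwards [h2'] with z hz h using (hz.1 h).2
    · by_cases hj : j = i
      · subst hj
        rw [Function.update_self]
        filter_upwards [h1', h2'] with z h3 h4
        by_contra hc
        push Not at hc
        exact (h4.1 hc.2).1.2 (h3.1 hc.1).1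
      · rw [Function.update_of_ne hj]
        filter_upwards [h1', hμ.2 j i hj] with z h3 h4
        by_contra hc
        push Not at hc
        exact (h3.1 hc.1).2 (h4.resolve_left hc.2)
  have hmul : ∀ i, ∀ ν ∈ f.fixedSpace, ∃ t, ∀ᵐ z : ℂ, z ∈ E i → ν z = t * μ i z := fun i ν hν =>
    (herg i).exists_ae_eq_mul hinf (hμ.1 i)
      (by filter_upwards [hEae i] with z hz h using hz.1 h) hν
  refine ⟨m, E, μ, hEdisj, fun i => ⟨herg i, hμ.1 i, ?_, ?_⟩, hμ.linearIndependent, ?_⟩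
  · filter_upwards [hEae i] with z hz
    exact propext hz.symm
  · intro μ' hμ' hsupp
    obtain ⟨t, ht⟩ := hmul i μ' hμ'.1
    have hEnorm : ∀ᵐ z : ℂ, z ∈ E i → ‖μ i z‖ = 1 := by
      filter_upwards [hEae i, (hμ.1 i).2.1] with z h1 h2 h3 using h2.resolve_right (h1.1 h3)
    have hsupp' : ∀ᵐ z : ℂ, μ' z ≠ 0 → z ∈ E i := hsupp
    refine ⟨t, ?_, Lp.ext ?_⟩
    · by_contra hne
      refine hμ'.2.2.ne' (measure_eq_zero_iff_ae_notMem.2 ?_)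
      filter_upwards [ht, hEnorm, hsupp'] with z h1 h2 h3 h4
      have h4 : ‖μ' z‖ = 1 := h4
      have hz : z ∈ E i := h3 fun h0 => by rw [h0, norm_zero] at h4; exact zero_ne_one h4
      rw [h1 hz, norm_mul, h2 hz, mul_one] at h4
      exact hne h4
    · filter_upwards [ht, hsupp', hEae i, Lp.coeFn_smul t (μ i)] with z h1 h2 h3 h4
      rw [h4, Pi.smul_apply, smul_eq_mul]
      by_cases hz : z ∈ E i
      · exact h1 hz
      · have h5 : μ' z = 0 := by_contra fun h => hz (h2 h)
        have h6 : μ i z = 0 := by_contra fun h => hz (h3.2 h)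
        rw [h5, h6, mul_zero]
  · intro ν hν
    choose t ht using fun i => hmul i ν hν
    -- `ν` vanishes off the sets `E i`: otherwise it gives a further line field
    have hoff : ∀ᵐ z : ℂ, z ∉ ⋃ i, E i → ν z = 0 := by
      by_contra hc
      have hUm : MeasurableSet (⋃ i, E i)ᶜ := (MeasurableSet.iUnion hEm).compl
      have hUinv : ∀ᵐ z : ℂ, f.val z ∈ (⋃ i, E i)ᶜ ↔ z ∈ (⋃ i, E i)ᶜ := by
        filter_upwards [(IsCompletelyInvariant.iUnion hEinv).ae_val_mem_iff] with z hz
        exact not_congr hz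
      obtain ⟨μ', h1, h2⟩ := exists_isInvariantLineField hν hUm hUinv fun h0 => hc (by
        filter_upwards [measure_eq_zero_iff_ae_notMem.1 h0] with z hz hzU
        by_contra hne
        exact hz ⟨hzU, hne⟩)
      refine hno μ μ' hμ h1 fun i => ?_
      filter_upwards [h2, hEae i] with z h3 h4
      by_contra hcz
      push Not at hcz
      exact (h3.1 hcz.1).1 (Set.mem_iUnion.2 ⟨i, h4.2 hcz.2⟩)
    refine ⟨t, Lp.ext ?_⟩
    filter_upwards [ae_sum_smul_eq μ t, hoff, ae_all_iff.2 ht, ae_all_iff.2 hEae] with z h1 h2 h3 h4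
    rw [h1]
    by_cases hz : z ∈ ⋃ i, E i
    · obtain ⟨i, hi⟩ := Set.mem_iUnion.1 hz
      rw [h3 i hi, Finset.sum_eq_single i (fun j _ hj => ?_) (by simp)]
      have : z ∉ E j := fun hzj => Set.disjoint_left.1 (hEdisj hj) hzj hi
      rw [not_not.1 (mt (h4 j).2 this), mul_zero]
    · rw [h2 hz]
      refine (Finset.sum_eq_zero fun j _ => ?_).symm
      have : z ∉ E j := fun hzj => hz (Set.mem_iUnion.2 ⟨j, hzj⟩)
      rw [not_not.1 (mt (h4 j).2 this), mul_zero]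

end RationalMap

theorem proposition3p2 (f : RationalMap) (a : ℂ)
    (hnorm : ¬ f.IsPolynomial → f.IsNormalizedAt a)
    (p : ℕ) (v : Fin p → ℂ) (hv : Function.Injective v)
    (hrange : Set.range v = f.finiteCriticalValues) :
    -- the integrals defining the map exist
    (∀ ν ∈ f.fixedSpace,
      (∀ j, IntegrableOn (fun x => ν x / (v j - x)) f.juliaPlane) ∧
      (¬ f.IsPolynomial → ∀ k ∈ ({1, 2, 3} : Set ℕ),
        IntegrableOn (fun x => ν x / (a - x) ^ k) f.juliaPlane)) ∧
    -- the map is linear and injective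
    IsLinearMap ℂ (f.cauchyData v a) ∧
    Function.Injective (f.cauchyData v a) ∧
    -- the fixed space is spanned by finitely many ergodic line fields
    ∃ (m : ℕ) (E : Fin m → Set ℂ) (μ : Fin m → f.fixedSpace),
      Pairwise (fun i j => Disjoint (E i) (E j)) ∧
      (∀ i, f.IsErgodicLineField (E i) (μ i).1) ∧
      DirectSum.IsInternal (fun i => Submodule.span ℂ {μ i}) ∧
      ∀ ν : f.fixedSpace, ∃! t : Fin m → ℂ, ν = ∑ i, t i • μ i := by
  have hinf := RationalMap.infty_mem_fatouSet hnorm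
  have hb := f.isBounded_juliaPlane hinf
  refine ⟨fun ν hν => ⟨fun j => RationalMap.integrableOn_div hb hν.1 (v j), fun h k _ =>
    RationalMap.integrableOn_div_pow hb hν.1 (hnorm h).notMem_juliaPlane k⟩,
    RationalMap.isLinearMap_cauchyData hnorm v, RationalMap.injective_cauchyData hnorm hrange, ?_⟩
  have := RationalMap.finiteDimensional_fixedSpace hnorm hrange
  obtain ⟨m, E, μ, hdisj, herg, hli, hspan⟩ := RationalMap.exists_ergodic_decomposition hinf
  set μ' : Fin m → f.fixedSpace := fun i => ⟨μ i, (herg i).2.1.1⟩ with hμ'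
  have hli' : LinearIndependent ℂ μ' := LinearIndependent.of_comp f.fixedSpace.subtype hli
  have hrep : ∀ ν : f.fixedSpace, ∃ t : Fin m → ℂ, ν = ∑ i, t i • μ' i := by
    intro ν
    obtain ⟨t, ht⟩ := hspan ν.1 ν.2
    refine ⟨t, Subtype.ext ?_⟩
    rw [ht]
    simp [hμ']
  refine ⟨m, E, μ', hdisj, herg, ?_, fun ν => ?_⟩
  · refine DirectSum.isInternal_submodule_of_iSupIndep_of_iSup_eq_top
      hli'.iSupIndep_span_singleton ?_
    rw [eq_top_iff]
    intro ν _
    obtain ⟨t, rfl⟩ := hrep ν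
    exact Submodule.sum_mem _ fun i _ => Submodule.smul_mem _ _
      (Submodule.mem_iSup_of_mem i (Submodule.mem_span_singleton_self _))
  · obtain ⟨t, ht⟩ := hrep ν
    refine ⟨t, ht, fun s hs => funext fun i => ?_⟩
    have hs' : ν = ∑ i, s i • μ' i := hs
    have hzero : ∑ i, (s i - t i) • μ' i = 0 := by
      simp only [sub_smul, Finset.sum_sub_distrib]
      rw [← hs', ← ht, sub_self]
    exact sub_eq_zero.1 (Fintype.linearIndependent_iff.1 hli' _ hzero i)
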